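/- **Setting.** All algorithms below are probabilistic polynomial time (PPT) in the security parameter $\lambda$; $\mathsf{neg}$ denotes functions that are eventually below $\lambda^{-c}$ for every $c>0$. Let $\mathcal G(1^\lambda,3)$ be a generator of trilinear map instances $\Gamma=(N,G_1,G_2,G_3,e,g_1,g_2,g_3)$: $N=pq$ for distinct $\lambda$-bit primes $p,q$, each $G_i$ is cyclic of order $N$ with generator $g_i$, and $e(g_i^a,g_j^b)=g_{i+j}^{ab}$ for $i+j\le 3$. Group elements have representations of length polynomial in $\lambda$, and multiplication and exponentiation in the $G_i$ and the pairing $G_1\times G_1\to G_2$ are computable in polynomial time from the public data of $\Gamma$ (no public algorithm is required for the maps into $G_3$, which only the client evaluates). Assumptions, each for all PPT $\mathcal A$ and $\Gamma\leftarrow\mathcal G(1^\lambda,3)$: - *3-co-CDHS*: with $h_1=g_1^p$, $h_2=g_2^p$, $\Pr[\mathcal A(p,q,\Gamma,h_1^a,h_2^b)=h_2^{ab}]\in\mathsf{neg}$ for $a,b\leftarrow\mathbb Z_N$. - *DLIN* (in $G_1$): $|\Pr[\mathcal A(p,q,\Gamma,u,v,w,u^a,v^b,w^{a+b})=1]-\Pr[\mathcal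 A(p,q,\Gamma,u,v,w,u^a,v^b,w^c)=1]|\in\mathsf{neg}$ for $u,v,w\leftarrow G_1$ and $a,b,c\leftarrow\mathbb Z_N$. - *SDA*: for each $i\in\{1,2,3\}$, $|\Pr[\mathcal A(\Gamma,u)=1]-\Pr[\mathcal A(\Gamma,u^q)=1]|\in\mathsf{neg}$ for $u\leftarrow G_i$. **Functions.** For each $\lambda$ let $M$ be an $n\times n$ matrix and $\mathbb D$ a set of input vectors $x$ of length $n$, entries being integer representatives of residues mod $q$ (of at most $\lambda$ bits for $x$), and let $\mathbb M$ be a finite message space such that, mod $q$, every entry of $Mx$ with $x\in\mathbb D$ lies in $\mathbb M$. Here $n$, $M$ and the list $\mathbb M$ may depend on $\lambda$ and are produced from $1^\lambda$ in polynomial time (so $n,|\mathbb M|\le\mathrm{poly}(\lambda)$), and membership in $\mathbb D$ is decidable in polynomial time. **Scheme $\Pi_{\rm mm}$.** - $\mathsf{KeyGen}(1^\lambda,M)$: pick $\Gamma\leftarrow\mathcal G(1^\lambda,3)$; $\alpha_i,\beta_i\leftarrow\mathbb Z_N$ and $A_i,B_i\leftarrow G_1$ for $i\in[n]$, forming $K$,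 with $\mathsf F_K(i,j)=A_j^{\alpha_i}B_j^{\beta_i}$; $a\leftarrow\mathbb Z_N$; $u\leftarrow G_1$, $h=u^q$; $T_{ij}=g_1^{p^2aM_{ij}}\mathsf F_K(i,j)$; $\eta=g_3^{p^2a}$. Output $pk=(\Gamma,g_1,h,M,T)$, $sk=(p,q,K,a,\eta)$. - $\mathsf{ProbGen}(sk,x)$: $\sigma_j=g_1^{x_j}h^{r_j}$ with $r_j\leftarrow\mathbb Z_N$; $\tau_i=e\big(\prod_j\mathsf F_K(i,j)^{x_j},g_2^p\big)$, computed in closed form as $e\big((\prod_jA_j^{x_j})^{\alpha_i}(\prod_jB_j^{x_j})^{\beta_i},g_2^p\big)$. - $\mathsf{Compute}(pk,\sigma)$: $\rho_i=\prod_j\sigma_j^{M_{ij}}$, $\pi_i=\prod_je(T_{ij},\sigma_j)$. - $\mathsf{Verify}(sk,\tau,\rho,\pi)$: for every $i$ find $y_i\in\mathbb M$ with $\rho_i^p=(g_1^p)^{y_i}$ and test $e(\pi_i,g_1^p)=\eta^{py_i}\tau_i$; output $y\in\mathbb Z_q^n$ if all this succeeds and $\perp$ otherwise. **Theorem.** There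 is an absolute constant $C$ such that for every such generator and family of functions: 1. *(Correctness)* for all keys, all $x\in\mathbb D$ and all coins, if the server is honest, $\mathsf{Verify}$ outputs $Mx \bmod q$. 2. *(Client cost $O(n)$)* $\mathsf{ProbGen}$ and $\mathsf{Verify}$ each use at most $Cn$ coin draws, multiplications, exponentiations, pairings and equality tests, apart from the searches for the $y_i$ in the at most $n$ decryptions of $\mathsf{Verify}$, each of which tries at most $|\mathbb M|$ candidates. 3. If 3-co-CDHS, DLIN and SDA all hold for $\mathcal G$, then $\Pi_{\rm mm}$ is - *secure*: a PPT adversary that is given $pk$, adaptively obtains the encodings $\sigma$ of polynomially many inputs of its choice, then chooses $\hat x\in\mathbb D$, receives its encoding $\hat\sigma$, and answers $(\bar\rho,\bar\pi)$, makes $\mathsf{Verify}$ output a value outside $\{M\hat x,\perp\}$ with negligible probability only; - *input private*: a PPT adversary that is given $pk$ and adaptive access to the oracle $x\mapsto\sigma$ (before and after the challenge), chooses $x_0,x_1\in\mathbb D$ and receives the encoding $\sigma$ of $x_b$ for $b\leftarrow\{0,1\}$, outputs $b'=b$ with probability at most $\tfrac12+\mathsf{neg}(\lambda)$. -/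

import Mathlib

open scoped BigOperators

namespace MatVC

noncomputable section

/-! ## Machine model: programs over finite data, with a step count -/

/-- Data: finite binary trees with natural numbers (in binary) at the leaves. -/
inductive Val where
  | num (n : ℕ) : Val
  | pair (a b : Val) : Val
  deriving DecidableEq

/-- Length of a datum in bits, up to a constant factor. -/
def Val.size : Val → ℕ
  | .num n => n.size + 1
  | .pair a b => a.size + b.size + 1

def Val.fst : Val → Val
  | .num _ => .num 0
  | .pair a _ => a

def Val.snd : Val → Val
  | .num _ => .num 0
  | .pair _ b => b

def Val.isPair : Val → Val
  | .num _ => .num 0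
  | .pair _ _ => .num 1

def Val.arith (f : ℕ → ℕ → ℕ) : Val → Val
  | .pair (.num a) (.num b) => .num (f a b)
  | _ => .num 0

def Val.list : List Val → Val
  | [] => .num 0
  | a :: l => .pair a (Val.list l)

def Val.vec {n : ℕ} (v : Fin n → Val) : Val := Val.list (List.ofFn v)

def Val.natVec {n : ℕ} (x : Fin n → ℕ) : Val := Val.vec fun j => .num (x j)

/-- The string `1^κ`: the number whose binary expansion consists of `κ` ones. -/
def Val.unary (κ : ℕ) : Val := .num (2 ^ κ - 1)

/-- Deterministic programs.  Every program computes a total function `Val → Val`; the only loop is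
the `for` loop, whose number of iterations is read off the data. -/
inductive Prog where
  | id : Prog
  | const (v : Val) : Prog
  | comp (f g : Prog) : Prog
  | pair (f g : Prog) : Prog
  | fst : Prog
  | snd : Prog
  | isPair : Prog
  | size : Prog
  | eq : Prog
  | add : Prog
  | sub : Prog
  | mul : Prog
  | div : Prog
  | mod : Prog
  | ite (c f g : Prog) : Prog
  | loop (f : Prog) : Prog

/-- The function computed by a program. -/
def Prog.eval : Prog → Val → Val
  | .id, x => x
  | .const v, _ => v
  | .comp f g, x => f.eval (g.eval x)
  | .pair f g, x => .pair (f.eval x) (g.eval x)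
  | .fst, x => x.fst
  | .snd, x => x.snd
  | .isPair, x => x.isPair
  | .size, x => .num x.size
  | .eq, x => if x.fst = x.snd then .num 1 else .num 0
  | .add, x => x.arith (· + ·)
  | .sub, x => x.arith (· - ·)
  | .mul, x => x.arith (· * ·)
  | .div, x => x.arith (· / ·)
  | .mod, x => x.arith (· % ·)
  | .ite c f g, x => if c.eval x = .num 0 then g.eval x else f.eval x
  | .loop f, .pair (.num k) x => f.eval^[k] x
  | .loop _, .num n => .num n
  | .loop _, .pair (.pair a b) x => .pair (.pair a b) x

/-- The number of steps of a run.  Primitive operations are charged the bit length of the data they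
read and write (its square for multiplication and division); a loop is charged all its
iterations. -/
def Prog.cost : Prog → Val → ℕ
  | .id, x => x.size + 1
  | .const v, _ => v.size + 1
  | .comp f g, x => g.cost x + f.cost (g.eval x) + 1
  | .pair f g, x => f.cost x + g.cost x + 1
  | .fst, x => x.size + 1
  | .snd, x => x.size + 1
  | .isPair, x => x.size + 1
  | .size, x => 2 * x.size + 1
  | .eq, x => x.size + 1
  | .add, x => x.size + 1
  | .sub, x => x.size + 1
  | .mul, x => (x.size + 1) ^ 2
  | .div, x => (x.size + 1) ^ 2
  | .mod, x => (x.size + 1) ^ 2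
  | .ite c f g, x => c.cost x + (if c.eval x = .num 0 then g.cost x else f.cost x) + 1
  | .loop f, .pair (.num k) x =>
      (Val.pair (.num k) x).size + 1 + ∑ i ∈ Finset.range k, (f.cost (f.eval^[i] x) + 1)
  | .loop _, .num n => (Val.num n).size + 1
  | .loop _, .pair (.pair a b) x => (Val.pair (.pair a b) x).size + 1

/-- The running time is bounded, on every input, by a polynomial in the length of the input. -/
def Prog.PolyTime (f : Prog) : Prop :=
  ∃ P : Polynomial ℕ, ∀ x : Val, f.cost x ≤ P.eval x.size

/-- A probabilistic polynomial-time algorithm: a polynomial-time program that is given `1^κ` and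
polynomially many uniform coin flips in addition to its input. -/
structure PPT where
  prog : Prog
  polyTime : prog.PolyTime
  coins : Polynomial ℕ

def PPT.coinDist (A : PPT) (κ : ℕ) : PMF (Fin (2 ^ A.coins.eval κ)) :=
  PMF.uniformOfFintype _

def PPT.run (A : PPT) (κ : ℕ) (ω : Fin (2 ^ A.coins.eval κ)) (x : Val) : Val :=
  A.prog.eval (Val.list [Val.unary κ, .num ω, x])

/-- Probability that a random experiment outputs `true`. -/
def prTrue (E : PMF Bool) : ℝ := (E true).toReal

/-- `f` is eventually smaller than every inverse power of the security parameter. -/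
def Negligible (f : ℕ → ℝ) : Prop :=
  Asymptotics.SuperpolynomialDecay Filter.atTop (fun κ : ℕ => (κ : ℝ)) f

open Classical in
/-- The object encoded by the datum `v`, if there is one. -/
def parse {α : Type} (enc : α → Val) (v : Val) : Option α :=
  if h : ∃ a, enc a = v then some h.choose else none

/-! ## Trilinear maps in composite order -/

/-- A trilinear map instance `(N, G₁, G₂, G₃, e, g₁, g₂, g₃)` with `N = p * q`.  The group `G i` is
the group of level `i + 1`, and `e` maps levels `a` and `b` with `a + b ≤ 3` to level `a + b`.
Elements are represented by data through `enc`; `desc` is the public description of the groups. -/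
structure TrilinearInstance where
  p : ℕ
  q : ℕ
  prime_p : p.Prime
  prime_q : q.Prime
  p_ne_q : p ≠ q
  G : Fin 3 → Type
  [commGroup : ∀ i, CommGroup (G i)]
  [fintype : ∀ i, Fintype (G i)]
  card_G : ∀ i, Fintype.card (G i) = p * q
  g : ∀ i, G i
  g_gen : ∀ i (x : G i), x ∈ Subgroup.zpowers (g i)
  e : ∀ {i j k : Fin 3}, (i : ℕ) + 1 + ((j : ℕ) + 1) = (k : ℕ) + 1 → G i → G j → G k
  e_pow : ∀ {i j k : Fin 3} (h : (i : ℕ) + 1 + ((j : ℕ) + 1) = (k : ℕ) + 1) (a b : ℕ),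
    e h (g i ^ a) (g j ^ b) = g k ^ (a * b)
  enc : ∀ i, G i → Val
  enc_inj : ∀ i, Function.Injective (enc i)
  desc : Val

attribute [instance] TrilinearInstance.commGroup TrilinearInstance.fintype

namespace TrilinearInstance

variable (Γ : TrilinearInstance)

def N : ℕ := Γ.p * Γ.q

instance : NeZero Γ.N :=
  ⟨Nat.mul_ne_zero Γ.prime_p.ne_zero Γ.prime_q.ne_zero⟩

/-- The public data of the instance, as handed to an algorithm. -/
def code : Val :=
  Val.list [Γ.desc, .num Γ.N, Γ.enc 0 (Γ.g 0), Γ.enc 1 (Γ.g 1), Γ.enc 2 (Γ.g 2)]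

/-- `e : G₁ × G₁ → G₂`. -/
def e₁₁ : Γ.G 0 → Γ.G 0 → Γ.G 1 := Γ.e (by decide)

/-- `e : G₁ × G₂ → G₃`. -/
def e₁₂ : Γ.G 0 → Γ.G 1 → Γ.G 2 := Γ.e (by decide)

/-- `e : G₂ × G₁ → G₃`. -/
def e₂₁ : Γ.G 1 → Γ.G 0 → Γ.G 2 := Γ.e (by decide)

end TrilinearInstance

/-- A generator `𝒢(1^κ, 3)` of trilinear map instances: `p` and `q` are `κ`-bit primes (there are no
two such primes for `κ < 2`), elements have polynomial length, and multiplication, exponentiation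
and the pairing `G₁ × G₁ → G₂` are polynomial-time computable from the public data.
(The maps into `G₃` are evaluated only by the client; no public algorithm for them is required.) -/
structure TrilinearGenerator where
  Seed : ℕ → Type
  sample : ∀ κ, PMF (Seed κ)
  inst : ∀ κ, Seed κ → TrilinearInstance
  bits : ∀ κ, 2 ≤ κ → ∀ s, (inst κ s).p.size = κ ∧ (inst κ s).q.size = κ
  length : ∃ P : Polynomial ℕ, ∀ κ s, (inst κ s).code.size ≤ P.eval κ ∧
    ∀ i x, ((inst κ s).enc i x).size ≤ P.eval κ
  mulAlg : ∃ f : Prog, f.PolyTime ∧ ∀ κ s (i : Fin 3) (x y : (inst κ s).G i),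
    f.eval (Val.list [(inst κ s).code, .num i, (inst κ s).enc i x, (inst κ s).enc i y])
      = (inst κ s).enc i (x * y)
  powAlg : ∃ f : Prog, f.PolyTime ∧ ∀ κ s (i : Fin 3) (x : (inst κ s).G i) (a : ℕ),
    f.eval (Val.list [(inst κ s).code, .num i, (inst κ s).enc i x, .num a])
      = (inst κ s).enc i (x ^ a)
  pairAlg : ∃ f : Prog, f.PolyTime ∧ ∀ κ s (x y : (inst κ s).G 0),
    f.eval (Val.list [(inst κ s).code, (inst κ s).enc 0 x, (inst κ s).enc 0 y])
      = (inst κ s).enc 1 ((inst κ s).e₁₁ x y)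

/-! ## The assumptions -/

/-- `𝒜(Γ, u)` if `real = true`, and `𝒜(Γ, u^q)` otherwise, for uniform `u` in the group `i`. -/
def sdaExp (𝒢 : TrilinearGenerator) (i : Fin 3) (A : PPT) (real : Bool) (κ : ℕ) : PMF Bool := do
  let s ← 𝒢.sample κ
  let Γ := 𝒢.inst κ s
  let ω ← A.coinDist κ
  let u ← PMF.uniformOfFintype (Γ.G i)
  let z := if real then u else u ^ Γ.q
  pure (decide (A.run κ ω (Val.list [Γ.code, Γ.enc i z]) = .num 1))

/-- The subgroup decision assumption, in each of the groups. -/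
def SDA (𝒢 : TrilinearGenerator) : Prop :=
  ∀ (i : Fin 3) (A : PPT),
    Negligible fun κ => |prTrue (sdaExp 𝒢 i A true κ) - prTrue (sdaExp 𝒢 i A false κ)|

/-- With `h₁ = g₁^p` and `h₂ = g₂^p`: does `𝒜(p, q, Γ, h₁^a, h₂^b)` output `h₂^(ab)`? -/
def coCDHSExp (𝒢 : TrilinearGenerator) (A : PPT) (κ : ℕ) : PMF Bool := do
  let s ← 𝒢.sample κ
  let Γ := 𝒢.inst κ s
  let ω ← A.coinDist κ
  let a ← PMF.uniformOfFintype (ZMod Γ.N)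
  let b ← PMF.uniformOfFintype (ZMod Γ.N)
  let h₁ := Γ.g 0 ^ Γ.p
  let h₂ := Γ.g 1 ^ Γ.p
  pure (decide (A.run κ ω (Val.list [.num Γ.p, .num Γ.q, Γ.code,
    Γ.enc 0 (h₁ ^ a.val), Γ.enc 1 (h₂ ^ b.val)]) = Γ.enc 1 (h₂ ^ (a.val * b.val))))

/-- The trilinear co-computational Diffie-Hellman assumption for the order `q` subgroups. -/
def CoCDHS (𝒢 : TrilinearGenerator) : Prop :=
  ∀ A : PPT, Negligible fun κ => prTrue (coCDHSExp 𝒢 A κ)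

/-- `𝒜(p, q, Γ, u, v, w, u^a, v^b, w^(a+b))` if `real = true`, and
`𝒜(p, q, Γ, u, v, w, u^a, v^b, w^c)` otherwise, with `u, v, w` uniform in `G₁`. -/
def dlinExp (𝒢 : TrilinearGenerator) (A : PPT) (real : Bool) (κ : ℕ) : PMF Bool := do
  let s ← 𝒢.sample κ
  let Γ := 𝒢.inst κ s
  let ω ← A.coinDist κ
  let u ← PMF.uniformOfFintype (Γ.G 0)
  let v ← PMF.uniformOfFintype (Γ.G 0)
  let w ← PMF.uniformOfFintype (Γ.G 0)
  let a ← PMF.uniformOfFintype (ZMod Γ.N)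
  let b ← PMF.uniformOfFintype (ZMod Γ.N)
  let c ← PMF.uniformOfFintype (ZMod Γ.N)
  let z := if real then w ^ (a.val + b.val) else w ^ c.val
  pure (decide (A.run κ ω (Val.list [.num Γ.p, .num Γ.q, Γ.code, Γ.enc 0 u, Γ.enc 0 v, Γ.enc 0 w,
    Γ.enc 0 (u ^ a.val), Γ.enc 0 (v ^ b.val), Γ.enc 0 z]) = .num 1))

/-- The decision linear assumption in the group `G₁` of the trilinear instance. -/
def DLIN (𝒢 : TrilinearGenerator) : Prop :=
  ∀ A : PPT, Negligible fun κ => |prTrue (dlinExp 𝒢 A true κ) - prTrue (dlinExp 𝒢 A false κ)|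

/-! ## Counting the operations of the client -/

/-- The result of a computation with the number of operations spent on it: `ops` counts coin draws,
group multiplications, exponentiations, pairings and equality tests in the groups; `trials` counts
the candidate plaintexts tried during decryptions. -/
structure Counted (α : Type) where
  val : α
  ops : ℕ
  trials : ℕ

namespace Counted

instance : Monad Counted where
  pure a := ⟨a, 0, 0⟩
  bind m f := ⟨(f m.val).val, m.ops + (f m.val).ops, m.trials + (f m.val).trials⟩

/-- One operation with result `a`. -/
def op {α : Type} (a : α) : Counted α := ⟨a, 1, 0⟩

/-- Run one computation for every index. -/
def forEach {n : ℕ} {α : Type} (f : Fin n → Counted α) : Counted (Fin n → α) :=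
  ⟨fun i => (f i).val, ∑ i, (f i).ops, ∑ i, (f i).trials⟩

/-- Multiply `n` group elements. -/
def prod {n : ℕ} {G : Type} [CommGroup G] (x : Fin n → G) : Counted G := ⟨∏ i, x i, n, 0⟩

/-- Find the first candidate in a list that passes a test. -/
def search (l : List ℕ) (test : ℕ → Bool) : Counted (Option ℕ) := ⟨l.find? test, 0, l.length⟩

end Counted

/-! ## The scheme -/

section Scheme

variable (Γ : TrilinearInstance) (n : ℕ)

/-- A key `K` of the pseudorandom function. -/
structure PRFKey where
  α : Fin n → ZMod Γ.N
  β : Fin n → ZMod Γ.N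
  A : Fin n → Γ.G 0
  B : Fin n → Γ.G 0

structure PublicKey where
  h : Γ.G 0
  M : Matrix (Fin n) (Fin n) ℕ
  T : Fin n → Fin n → Γ.G 0

/-- The secret key; the primes `p` and `q` are read off the instance. -/
structure SecretKey where
  K : PRFKey Γ n
  a : ZMod Γ.N
  η : Γ.G 2

variable {Γ n}

/-- `F_K(i, j) = A_j^(α_i) * B_j^(β_i)`. -/
def PRFKey.F (K : PRFKey Γ n) (i j : Fin n) : Γ.G 0 :=
  K.A j ^ (K.α i).val * K.B j ^ (K.β i).val

def PublicKey.code (pk : PublicKey Γ n) : Val :=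
  Val.list [Γ.code, Γ.enc 0 pk.h, Val.vec fun i => Val.natVec fun j => pk.M i j,
    Val.vec fun i => Val.vec fun j => Γ.enc 0 (pk.T i j)]

/-- `KeyGen(1^κ, M)`, after the instance `Γ` has been picked. -/
def keyGen (Γ : TrilinearInstance) {n : ℕ} (M : Matrix (Fin n) (Fin n) ℕ) :
    PMF (PublicKey Γ n × SecretKey Γ n) := do
  let α ← PMF.uniformOfFintype (Fin n → ZMod Γ.N)
  let β ← PMF.uniformOfFintype (Fin n → ZMod Γ.N)
  let A ← PMF.uniformOfFintype (Fin n → Γ.G 0)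
  let B ← PMF.uniformOfFintype (Fin n → Γ.G 0)
  let K : PRFKey Γ n := ⟨α, β, A, B⟩
  let a ← PMF.uniformOfFintype (ZMod Γ.N)
  let u ← PMF.uniformOfFintype (Γ.G 0)
  pure (⟨u ^ Γ.q, M, fun i j => Γ.g 0 ^ (Γ.p ^ 2 * a.val * M i j) * K.F i j⟩,
    ⟨K, a, Γ.g 2 ^ (Γ.p ^ 2 * a.val)⟩)

/-- `ProbGen` on input `x` with coins `r`: `σ_j = g₁^(x_j) * h^(r_j)` and
`τ_i = e(∏_j F_K(i,j)^(x_j), g₂^p)`, the product being computed in closed form as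
`(∏_j A_j^(x_j))^(α_i) * (∏_j B_j^(x_j))^(β_i)`. -/
def probGenWith (pk : PublicKey Γ n) (sk : SecretKey Γ n) (x : Fin n → ℕ)
    (r : Fin n → ZMod Γ.N) : Counted ((Fin n → Γ.G 0) × (Fin n → Γ.G 2)) := do
  let σ ← Counted.forEach fun j => do
    let t ← Counted.op (r j)
    let c ← Counted.op (Γ.g 0 ^ x j)
    let d ← Counted.op (pk.h ^ t.val)
    Counted.op (c * d)
  let A' ← Counted.forEach fun j => Counted.op (sk.K.A j ^ x j)
  let A ← Counted.prod A'
  let B' ← Counted.forEach fun j => Counted.op (sk.K.B j ^ x j)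
  let B ← Counted.prod B'
  let τ ← Counted.forEach fun i => do
    let c ← Counted.op (A ^ (sk.K.α i).val)
    let d ← Counted.op (B ^ (sk.K.β i).val)
    let f ← Counted.op (c * d)
    let k ← Counted.op (Γ.g 1 ^ Γ.p)
    Counted.op (Γ.e₁₂ f k)
  pure (σ, τ)

/-- `ProbGen(sk, x)`. -/
def probGen (pk : PublicKey Γ n) (sk : SecretKey Γ n) (x : Fin n → ℕ) :
    PMF ((Fin n → Γ.G 0) × (Fin n → Γ.G 2)) := do
  let r ← PMF.uniformOfFintype (Fin n → ZMod Γ.N)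
  pure (probGenWith pk sk x r).val

/-- `Compute(pk, σ)`. -/
def compute (pk : PublicKey Γ n) (σ : Fin n → Γ.G 0) : (Fin n → Γ.G 0) × (Fin n → Γ.G 1) :=
  (fun i => ∏ j, σ j ^ pk.M i j, fun i => ∏ j, Γ.e₁₁ (pk.T i j) (σ j))

open Classical in
/-- Decryption: the message `m` in the message space with `c^p = (g₁^p)^m`, if there is one. -/
def decryptC (msgs : List ℕ) (c : Γ.G 0) : Counted (Option ℕ) := do
  let cp ← Counted.op (c ^ Γ.p)
  let gp ← Counted.op (Γ.g 0 ^ Γ.p)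
  Counted.search msgs fun m => decide (cp = gp ^ m)

open Classical in
/-- `Verify(sk, τ, ρ, π)`: decrypt `ρ_i` to `y_i` and test `e(π_i, g₁^p) = η^(p y_i) * τ_i` for every
`i`; output `y ∈ (ℤ/q)^n` if everything succeeds and `⊥ = none` otherwise. -/
def verifyC (msgs : List ℕ) (sk : SecretKey Γ n) (τ : Fin n → Γ.G 2) (ρ : Fin n → Γ.G 0)
    (π : Fin n → Γ.G 1) : Counted (Option (Fin n → ZMod Γ.q)) := do
  let y ← Counted.forEach fun i => do
    match (← decryptC msgs (ρ i)) with
    | none => pure none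
    | some m => do
      let gp ← Counted.op (Γ.g 0 ^ Γ.p)
      let l ← Counted.op (Γ.e₂₁ (π i) gp)
      let t ← Counted.op (sk.η ^ (Γ.p * m))
      let r ← Counted.op (t * τ i)
      let ok ← Counted.op (decide (l = r))
      pure (if ok then some (m : ZMod Γ.q) else none)
  pure (if ∀ i, (y i).isSome then some (fun i => (y i).getD 0) else none)

/-- The function `x ↦ M x` with values in `(ℤ/q)^n`. -/
def evalFun (Γ : TrilinearInstance) {n : ℕ} (M : Matrix (Fin n) (Fin n) ℕ) (x : Fin n → ℕ) :
    Fin n → ZMod Γ.q :=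
  (M.map (Nat.cast : ℕ → ZMod Γ.q)).mulVec fun j => (x j : ZMod Γ.q)

end Scheme

/-! ## Correctness, cost, security and input privacy -/

/-- The functions to be outsourced: for each security parameter `κ` a square matrix `M κ` of order
`n κ` (entries are integer representatives of residues modulo the secret prime `q`), a domain
`D κ` of input vectors of `κ`-bit representatives and a finite message space `msgs κ` that
contains the entries of `M x` modulo `q` for every input `x`.  The data `n κ`, `M κ`, `msgs κ` are
produced in polynomial time from `1^κ` (so their sizes are polynomial), and membership in `D κ` is
decidable in polynomial time. -/
structure MatrixFamily (𝒢 : TrilinearGenerator) where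
  n : ℕ → ℕ
  M : ∀ κ, Matrix (Fin (n κ)) (Fin (n κ)) ℕ
  D : ∀ κ, Set (Fin (n κ) → ℕ)
  msgs : ℕ → List ℕ
  lt_two_pow : ∀ κ, ∀ x ∈ D κ, ∀ j, x j < 2 ^ κ
  result_mem : ∀ κ, ∀ s ∈ (𝒢.sample κ).support, ∀ x ∈ D κ, ∀ i,
    ∃ m ∈ msgs κ, (m : ZMod (𝒢.inst κ s).q) = evalFun (𝒢.inst κ s) (M κ) x i
  genAlg : ∃ f : Prog, f.PolyTime ∧ ∀ κ, f.eval (Val.unary κ) =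
    Val.list [.num (n κ), Val.vec fun i => Val.natVec fun j => M κ i j, Val.list ((msgs κ).map .num)]
  memAlg : ∃ f : Prog, f.PolyTime ∧ ∀ κ v,
    ((∃ x ∈ D κ, Val.natVec x = v) → f.eval (Val.list [Val.unary κ, v]) = .num 1) ∧
    ((¬ ∃ x ∈ D κ, Val.natVec x = v) → f.eval (Val.list [Val.unary κ, v]) = .num 0)

variable (𝒢 : TrilinearGenerator) (F : MatrixFamily 𝒢)

/-- The input vector in the domain that is encoded by a datum, if any. -/
def MatrixFamily.input {𝒢 : TrilinearGenerator} (F : MatrixFamily 𝒢) (κ : ℕ) (v : Val) :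
    Option (F.D κ) :=
  parse (fun x : F.D κ => Val.natVec x.1) v

/-- Correctness: for every matrix of the family, all keys, all inputs and all coins, an honest
server makes the client output `M x`. -/
def IsCorrect : Prop :=
  ∀ κ, ∀ s ∈ (𝒢.sample κ).support, ∀ key ∈ (keyGen (𝒢.inst κ s) (F.M κ)).support,
    ∀ x ∈ F.D κ, ∀ o ∈ (probGen key.1 key.2 x).support,
      (verifyC (F.msgs κ) key.2 o.2 (compute key.1 o.1).1 (compute key.1 o.1).2).val
        = some (evalFun (𝒢.inst κ s) (F.M κ) x)

/-- The client's cost is at most `C * n`: each of `ProbGen` and `Verify` takes at most `C * n` coin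
draws, multiplications, exponentiations, pairings and equality tests; `ProbGen` decrypts nothing,
and the decryptions in `Verify` try at most `|msgs|` candidates for each of the `n` ciphertexts. -/
def ClientCostLE (C : ℕ) : Prop :=
  ∀ κ s (pk : PublicKey (𝒢.inst κ s) (F.n κ)) (sk : SecretKey (𝒢.inst κ s) (F.n κ)),
    (∀ x r, (probGenWith pk sk x r).ops ≤ C * F.n κ ∧ (probGenWith pk sk x r).trials = 0) ∧
    (∀ τ ρ π, (verifyC (F.msgs κ) sk τ ρ π).ops ≤ C * F.n κ ∧
      (verifyC (F.msgs κ) sk τ ρ π).trials ≤ F.n κ * (F.msgs κ).length)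

/-- `PubProbGen(sk, ·)`: on an input vector `x` of the domain run `ProbGen` and return `σ`, recorded
as the pair `(x, σ)`; every other query is rejected and recorded as `0`. -/
def pubProbGen {κ : ℕ} {s : 𝒢.Seed κ} (pk : PublicKey (𝒢.inst κ s) (F.n κ))
    (sk : SecretKey (𝒢.inst κ s) (F.n κ)) (v : Val) : PMF Val :=
  match F.input κ v with
  | none => pure (.num 0)
  | some x => do
    let o ← probGen pk sk x.1
    pure (.pair (Val.natVec x.1) (Val.vec fun j => (𝒢.inst κ s).enc 0 (o.1 j)))

/-- `l` adaptive queries; the transcript `t` lists the records of the queries, the latest first. -/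
def queryPhase (ask : Val → Val) (ans : Val → PMF Val) : ℕ → Val → PMF Val
  | 0, t => pure t
  | l + 1, t => do
    let a ← ans (ask t)
    queryPhase ask ans l (.pair a t)

/-- An adversary in the security experiment, with its number of queries. -/
structure VerAdversary extends PPT where
  queries : Polynomial ℕ

/-- An adversary in the privacy experiment, with the numbers of its oracle queries before and after
the challenge. -/
structure PriAdversary extends PPT where
  queries₁ : Polynomial ℕ
  queries₂ : Polynomial ℕ

/-- The security experiment.  The first entry of the adversary's input tells it the stage. -/
def verExp (A : VerAdversary) (κ : ℕ) : PMF Bool := do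
  let s ← 𝒢.sample κ
  let Γ := 𝒢.inst κ s
  let ω ← A.coinDist κ
  let (pk, sk) ← keyGen Γ (F.M κ)
  let t ← queryPhase (fun t => A.run κ ω (Val.list [.num 0, pk.code, t])) (pubProbGen 𝒢 F pk sk)
    (A.queries.eval κ) (.num 0)
  match F.input κ (A.run κ ω (Val.list [.num 1, pk.code, t])) with
  | none => pure false
  | some x => do
    let (σ, τ) ← probGen pk sk x.1
    let forged := A.run κ ω (Val.list [.num 2, pk.code, t, Val.vec fun j => Γ.enc 0 (σ j)])
    match parse (fun ρπ : (Fin (F.n κ) → Γ.G 0) × (Fin (F.n κ) → Γ.G 1) =>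
        Val.pair (Val.vec fun i => Γ.enc 0 (ρπ.1 i)) (Val.vec fun i => Γ.enc 1 (ρπ.2 i))) forged with
    | none => pure false
    | some (ρ, π) =>
      let y := (verifyC (F.msgs κ) sk τ ρ π).val
      pure (decide (y ≠ some (evalFun Γ (F.M κ) x.1) ∧ y ≠ none))

/-- Security: no adversary makes the client accept a wrong result, except with negligible
probability. -/
def IsSecure : Prop :=
  ∀ A : VerAdversary, Negligible fun κ => prTrue (verExp 𝒢 F A κ)

/-- The input privacy experiment. -/
def priExp (A : PriAdversary) (κ : ℕ) : PMF Bool := do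
  let s ← 𝒢.sample κ
  let Γ := 𝒢.inst κ s
  let ω ← A.coinDist κ
  let (pk, sk) ← keyGen Γ (F.M κ)
  let t ← queryPhase (fun t => A.run κ ω (Val.list [.num 0, pk.code, t])) (pubProbGen 𝒢 F pk sk)
    (A.queries₁.eval κ) (.num 0)
  let ch := A.run κ ω (Val.list [.num 1, pk.code, t])
  match F.input κ ch.fst, F.input κ ch.snd with
  | some x₀, some x₁ => do
    let b ← PMF.uniformOfFintype Bool
    let (σ, _) ← probGen pk sk (if b then x₁.1 else x₀.1)
    let view := Val.list [pk.code, t, Val.natVec x₀.1, Val.natVec x₁.1,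
      Val.vec fun j => Γ.enc 0 (σ j)]
    let t' ← queryPhase (fun t' => A.run κ ω (Val.list [.num 2, view, t']))
      (pubProbGen 𝒢 F pk sk) (A.queries₂.eval κ) (.num 0)
    pure (decide (A.run κ ω (Val.list [.num 3, view, t']) = .num (if b then 1 else 0)))
  | _, _ => pure false

/-- Input privacy: no adversary guesses the bit with probability noticeably above `1/2`. -/
def IsPrivate : Prop :=
  ∀ A : PriAdversary, ∃ ν : ℕ → ℝ, Negligible ν ∧
    ∀ κ, prTrue (priExp 𝒢 F A κ) ≤ 1 / 2 + ν κ

end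

end MatVC

/-!
Correctness is a computation in the exponents.  For security and privacy the pseudorandom matrix is
replaced by a uniform one, after which the adversary can be dealt with unconditionally.

**Correctness and cost.**  Every element of `G i` is a power of `g i`, so the laws of the pairings
reduce to congruences modulo `N = p * q`.  Raising to the power `p` removes the blinding by
`h = u ^ q`, and what is left of an exponent is its residue modulo `q`.  The check of the client in
`G₃` is equivalent to one in `G₂` that involves only the pairing of `G₁` with itself (`check_iff`),
which is why the reductions below never need the maps into `G₃`.

**Pseudorandomness.**  `matrix_pseudorandom`: under the decision linear assumption the matrix of the
`F_K(i, j) = A_j ^ α_i * B_j ^ β_i` is indistinguishable from a uniform matrix over `G₁`, even given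
`p` and `q`.  The hybrids replace one row after the other.  In each step a challenge
`(u, v, w, u ^ a, v ^ b, Z)` is rerandomized: with `A_j = u ^ x_j * w ^ z_j` and
`B_j = v ^ y_j * w ^ z_j` the row `(u ^ a) ^ x_j * (v ^ b) ^ y_j * Z ^ z_j` is a row with exponents
`a, b` if `Z = w ^ (a + b)`.  If `Z = w ^ c` for an independent `c`, then the row is uniform, since
`A` and `B` leave the `z_j` undetermined; this holds if `u, v, w` are generators and `c - a - b` is a
unit, and so up to an exponentially small error.

**Security.**  The experiment, with its winning condition phrased in `G₂` for all plaintexts that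
might be claimed, can be run in polynomial time from `p`, `q` and the matrix of blinding factors.  So
the matrix may be taken to be uniform; then so is `T`, independently of the exponent `a`, and a
wrong plaintext is accepted for at most one residue of `a` modulo `q` (`modEq_of_forgery`).  The
adversary therefore wins with probability at most `n * |candidates| / q`
(`prTrue_secExp_random_le`).

**Privacy.**  Again the matrix may be taken to be uniform, so that `T` is independent of the rest of
the key.  The subgroup decision assumption then allows `h` to be uniform in `G₁` instead of `u ^ q`.
A uniform `h` is a generator with overwhelming probability, and the vectors `g₁ ^ x_j * h ^ r_j` are
then uniform whatever `x` is (`prTrue_priTail_le`).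

**Machine model.**  The reductions are actual programs.  `PT f` says that `f : Val → Val` is computed
by a polynomial-time program; it is closed under the constructions that are needed, among them
bounded loops whose state is truncated to a polynomial length (`PT.citer`).  Random choices are read
off one uniform number: `Impl K E D` says that `D` splits a uniform number below a multiple of `K`
into a sample of `E` and a uniform remainder.  Since the coins of a program are uniform below a power
of `2`, a simulation is exact up to an error of `2 ^ (-κ)` (`exists_ppt_of_sim`).
-/

namespace MatVC

noncomputable section

/-! ### Polynomial-time functions on data -/

theorem polynomial_eval_mono (P : Polynomial ℕ) {a b : ℕ} (h : a ≤ b) : P.eval a ≤ P.eval b := by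
  rw [Polynomial.eval_eq_sum_range, Polynomial.eval_eq_sum_range]
  gcongr

/-- A natural-number valued function on data that is bounded by a polynomial in the length. -/
def PolyBdd (f : Val → ℕ) : Prop := ∃ P : Polynomial ℕ, ∀ x, f x ≤ P.eval x.size

namespace PolyBdd

theorem mono {f g : Val → ℕ} (hg : PolyBdd g) (h : ∀ x, f x ≤ g x) : PolyBdd f :=
  hg.imp fun _ hP x => (h x).trans (hP x)

theorem const (c : ℕ) : PolyBdd fun _ => c := ⟨Polynomial.C c, by simp⟩

theorem size : PolyBdd Val.size := ⟨Polynomial.X, by simp⟩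

theorem add {f g : Val → ℕ} (hf : PolyBdd f) (hg : PolyBdd g) : PolyBdd fun x => f x + g x := by
  obtain ⟨P, hP⟩ := hf
  obtain ⟨Q, hQ⟩ := hg
  exact ⟨P + Q, fun x => by simpa using add_le_add (hP x) (hQ x)⟩

theorem mul {f g : Val → ℕ} (hf : PolyBdd f) (hg : PolyBdd g) : PolyBdd fun x => f x * g x := by
  obtain ⟨P, hP⟩ := hf
  obtain ⟨Q, hQ⟩ := hg
  exact ⟨P * Q, fun x => by simpa using Nat.mul_le_mul (hP x) (hQ x)⟩

theorem polynomial {f : Val → ℕ} (hf : PolyBdd f) (P : Polynomial ℕ) :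
    PolyBdd fun x => P.eval (f x) := by
  obtain ⟨Q, hQ⟩ := hf
  exact ⟨P.comp Q, fun x => by simpa using polynomial_eval_mono P (hQ x)⟩

theorem comp {f : Val → ℕ} {g : Val → Val} (hf : PolyBdd f) (hg : PolyBdd fun x => (g x).size) :
    PolyBdd fun x => f (g x) := by
  obtain ⟨P, hP⟩ := hf
  exact (hg.polynomial P).mono fun x => hP (g x)

end PolyBdd

theorem Val.size_pos (v : Val) : 0 < v.size := by cases v <;> simp [Val.size]

theorem Val.size_fst_le (v : Val) : v.fst.size ≤ v.size := by
  cases v <;> simp [Val.fst, Val.size]; omega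

theorem Val.size_snd_le (v : Val) : v.snd.size ≤ v.size := by
  cases v <;> simp [Val.snd, Val.size]; omega

theorem natSize_le_self (n : ℕ) : n.size ≤ n := Nat.size_le.2 Nat.lt_two_pow_self

theorem natSize_mul_le (a b : ℕ) : (a * b).size ≤ a.size + b.size := by
  rw [Nat.size_le, pow_add]
  exact Nat.mul_lt_mul'' (Nat.lt_size_self a) (Nat.lt_size_self b)

theorem natSize_add_le (a b : ℕ) : (a + b).size ≤ a.size + b.size + 1 := by
  rw [Nat.size_le, pow_succ, pow_add]
  have h1 := Nat.lt_size_self a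
  have h2 := Nat.lt_size_self b
  have h3 : 0 < 2 ^ a.size := by positivity
  have h4 : 0 < 2 ^ b.size := by positivity
  nlinarith

theorem natSize_pow_le (b e : ℕ) : (b ^ e).size ≤ e * b.size + 1 := by
  rw [Nat.size_le, pow_succ, mul_comm e, pow_mul]
  have h1 := Nat.pow_le_pow_left (Nat.lt_size_self b).le e
  have h3 : 0 < (2 ^ b.size) ^ e := by positivity
  omega

theorem Val.size_arith_le {f : ℕ → ℕ → ℕ} {C : ℕ → ℕ} (hC : ∀ x, 1 ≤ C x)
    (h : ∀ a b, (f a b).size + 1 ≤ C (a.size + 1 + (b.size + 1) + 1)) (v : Val) :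
    (v.arith f).size ≤ C v.size := by
  match v with
  | .num n => simpa [Val.arith, Val.size] using hC _
  | .pair (.num a) (.num b) => simpa [Val.arith, Val.size] using h a b
  | .pair (.pair _ _) _ => simpa [Val.arith, Val.size] using hC _
  | .pair (.num _) (.pair _ _) => simpa [Val.arith, Val.size] using hC _

/-- A program writes no more than it pays for. -/
theorem Prog.size_eval_le (f : Prog) (x : Val) : (f.eval x).size ≤ f.cost x := by
  have hs := x.size_pos
  induction f generalizing x with
  | id => simp [eval, cost]
  | const v => simp [eval, cost]
  | comp f g hf hg =>
    have := hf (g.eval x) (Val.size_pos _)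
    simp only [eval, cost]; omega
  | pair f g hf hg =>
    have := hf x hs
    have := hg x hs
    simp only [eval, cost, Val.size]; omega
  | fst => have := x.size_fst_le; simp only [eval, cost]; omega
  | snd => have := x.size_snd_le; simp only [eval, cost]; omega
  | isPair => cases x <;> simp [eval, cost, Val.isPair, Val.size]
  | size =>
    have := natSize_le_self x.size
    simp only [eval, cost, Val.size]; omega
  | eq =>
    simp only [eval, cost]; split_ifs <;> simp [Val.size]; omega
  | add =>
    refine Val.size_arith_le (C := fun s => s + 1) (by simp) (fun a b => ?_) x
    have := natSize_add_le a b
    omega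
  | sub =>
    refine Val.size_arith_le (C := fun s => s + 1) (by simp) (fun a b => ?_) x
    have := Nat.size_le_size (Nat.sub_le a b)
    omega
  | mul =>
    refine Val.size_arith_le (C := fun s => (s + 1) ^ 2)
      (fun _ => Nat.one_le_pow _ _ (by omega)) (fun a b => ?_) x
    have := natSize_mul_le a b
    nlinarith
  | div =>
    refine Val.size_arith_le (C := fun s => (s + 1) ^ 2)
      (fun _ => Nat.one_le_pow _ _ (by omega)) (fun a b => ?_) x
    have := Nat.size_le_size (Nat.div_le_self a b)
    exact le_trans (by omega) (Nat.le_self_pow two_ne_zero _)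
  | mod =>
    refine Val.size_arith_le (C := fun s => (s + 1) ^ 2)
      (fun _ => Nat.one_le_pow _ _ (by omega)) (fun a b => ?_) x
    have := Nat.size_le_size (Nat.mod_le a b)
    exact le_trans (by omega) (Nat.le_self_pow two_ne_zero _)
  | ite c f g hc hf hg =>
    have := hf x hs
    have := hg x hs
    simp only [eval, cost]; split_ifs <;> omega
  | loop f hf =>
    match x with
    | .num n => simp [eval, cost]
    | .pair (.pair a b) x => simp [eval, cost]
    | .pair (.num k) x =>
      simp only [eval, cost]
      cases k with
      | zero => simp only [Function.iterate_zero, id_eq, Val.size]; omega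
      | succ k =>
        rw [Function.iterate_succ_apply', Finset.sum_range_succ]
        have := hf (f.eval^[k] x) (Val.size_pos _)
        omega

/-- Functions that are computed by a polynomial-time program. -/
@[fun_prop]
def PT (f : Val → Val) : Prop := ∃ P : Prog, P.PolyTime ∧ ∀ x, P.eval x = f x

/-- Numerical functions that are computed by a polynomial-time program. -/
@[fun_prop]
def PTN (f : Val → ℕ) : Prop := PT fun x => .num (f x)

/-- Numerical functions that are computed by a polynomial-time program and whose *value* is bounded
by a polynomial in the length of the input; these may serve as numbers of iterations. -/
def PTS (f : Val → ℕ) : Prop := PTN f ∧ PolyBdd f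

/-- The number stored in a datum; `0` for pairs. -/
def Val.toNat : Val → ℕ
  | .num n => n
  | .pair _ _ => 0

/-- Case distinction on a number: `b` if it vanishes and `a` otherwise. -/
def Val.cond (c : ℕ) (a b : Val) : Val := if c = 0 then b else a

/-- Equality test with value `1` or `0`. -/
def eqv (a b : Val) : ℕ := if a = b then 1 else 0

@[simp] theorem Val.toNat_num (n : ℕ) : (Val.num n).toNat = n := rfl
@[simp] theorem Val.fst_pair (a b : Val) : (Val.pair a b).fst = a := rfl
@[simp] theorem Val.snd_pair (a b : Val) : (Val.pair a b).snd = b := rfl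

theorem PT.of_prog {P : Prog} (h : P.PolyTime) : PT P.eval := ⟨P, h, fun _ => rfl⟩

theorem PT.polyBdd_size {f : Val → Val} (hf : PT f) : PolyBdd fun x => (f x).size := by
  obtain ⟨P, hP, h⟩ := hf
  exact PolyBdd.mono hP fun x => (h x) ▸ P.size_eval_le x

@[fun_prop]
theorem PT.id : PT fun x => x :=
  ⟨.id, (PolyBdd.size.add (.const 1)).mono fun _ => le_rfl, fun _ => rfl⟩

@[fun_prop]
theorem PT.const (v : Val) : PT fun _ => v := ⟨.const v, PolyBdd.const (v.size + 1), fun _ => rfl⟩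

@[fun_prop]
theorem PT.comp {f g : Val → Val} (hf : PT f) (hg : PT g) : PT fun x => f (g x) := by
  have hs := hg.polyBdd_size
  obtain ⟨P, hP, h⟩ := hf
  obtain ⟨Q, hQ, h'⟩ := hg
  refine ⟨.comp P Q, ?_, fun x => by simp [Prog.eval, h, h']⟩
  exact (((PolyBdd.add hQ (PolyBdd.comp hP hs)).add (.const 1))).mono fun x => by
    simp [Prog.cost, h']

@[fun_prop]
theorem PT.pair {f g : Val → Val} (hf : PT f) (hg : PT g) : PT fun x => .pair (f x) (g x) := by
  obtain ⟨P, hP, h⟩ := hf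
  obtain ⟨Q, hQ, h'⟩ := hg
  exact ⟨.pair P Q, (PolyBdd.add hP hQ).add (.const 1), fun x => by simp [Prog.eval, h, h']⟩

theorem PT.prim {P : Prog} {f : Val → Val} (h : ∀ x, P.eval x = f x)
    (hc : ∀ x, P.cost x ≤ 2 * (x.size + 1) ^ 2) : PT f :=
  ⟨P, ((PolyBdd.const 2).mul (((PolyBdd.size.add (.const 1)).mul
    (PolyBdd.size.add (.const 1))))).mono fun x => (hc x).trans_eq (by ring), h⟩

@[fun_prop]
theorem PT.fst {f : Val → Val} (hf : PT f) : PT fun x => (f x).fst :=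
  PT.comp (f := Val.fst) (PT.prim (P := .fst) (fun _ => rfl) fun x => by
    simp only [Prog.cost]; nlinarith) hf

@[fun_prop]
theorem PT.snd {f : Val → Val} (hf : PT f) : PT fun x => (f x).snd :=
  PT.comp (f := Val.snd) (PT.prim (P := .snd) (fun _ => rfl) fun x => by
    simp only [Prog.cost]; nlinarith) hf

@[fun_prop]
theorem PT.num {f : Val → ℕ} (hf : PTN f) : PT fun x => .num (f x) := hf

@[fun_prop]
theorem PTN.comp {f : Val → ℕ} {g : Val → Val} (hf : PTN f) (hg : PT g) : PTN fun x => f (g x) :=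
  PT.comp (f := fun x => .num (f x)) hf hg

@[fun_prop]
theorem PTN.const (n : ℕ) : PTN fun _ => n := PT.const (.num n)

@[fun_prop]
theorem PTN.size {f : Val → Val} (hf : PT f) : PTN fun x => (f x).size :=
  PT.comp (f := fun x => .num x.size) (PT.prim (P := .size) (fun _ => rfl) fun x => by
    simp only [Prog.cost]; nlinarith) hf

theorem PTN.arith {P : Prog} {o : ℕ → ℕ → ℕ} (h : ∀ x, P.eval x = x.arith o)
    (hc : ∀ x, P.cost x ≤ 2 * (x.size + 1) ^ 2) {f g : Val → ℕ} (hf : PTN f) (hg : PTN g) :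
    PTN fun x => o (f x) (g x) :=
  PT.comp (f := Val.arith o) (g := fun x => .pair (.num (f x)) (.num (g x)))
    (PT.prim h hc) (PT.pair hf hg)

@[fun_prop]
theorem PTN.add {f g : Val → ℕ} (hf : PTN f) (hg : PTN g) : PTN fun x => f x + g x :=
  PTN.arith (P := .add) (fun _ => rfl) (fun x => by simp only [Prog.cost]; nlinarith) hf hg

@[fun_prop]
theorem PTN.sub {f g : Val → ℕ} (hf : PTN f) (hg : PTN g) : PTN fun x => f x - g x :=
  PTN.arith (P := .sub) (fun _ => rfl) (fun x => by simp only [Prog.cost]; nlinarith) hf hg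

@[fun_prop]
theorem PTN.mul {f g : Val → ℕ} (hf : PTN f) (hg : PTN g) : PTN fun x => f x * g x :=
  PTN.arith (P := .mul) (fun _ => rfl) (fun x => by simp only [Prog.cost]; nlinarith) hf hg

@[fun_prop]
theorem PTN.div {f g : Val → ℕ} (hf : PTN f) (hg : PTN g) : PTN fun x => f x / g x :=
  PTN.arith (P := .div) (fun _ => rfl) (fun x => by simp only [Prog.cost]; nlinarith) hf hg

@[fun_prop]
theorem PTN.mod {f g : Val → ℕ} (hf : PTN f) (hg : PTN g) : PTN fun x => f x % g x :=
  PTN.arith (P := .mod) (fun _ => rfl) (fun x => by simp only [Prog.cost]; nlinarith) hf hg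

@[fun_prop]
theorem PTN.min {f g : Val → ℕ} (hf : PTN f) (hg : PTN g) : PTN fun x => min (f x) (g x) := by
  have : PTN fun x => f x - (f x - g x) := by fun_prop
  refine cast (congrArg PTN (funext fun x => ?_)) this
  omega

@[fun_prop]
theorem PTN.toNat {f : Val → Val} (hf : PT f) : PTN fun x => (f x).toNat := by
  have h : PT fun x => Val.arith (· + ·) (.pair (f x) (.num 0)) :=
    PT.comp (f := Val.arith (· + ·)) (g := fun x => .pair (f x) (.num 0))
      (PT.prim (P := .add) (fun _ => rfl) fun x => by simp only [Prog.cost]; nlinarith) (by fun_prop)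
  have h2 : ∀ v : Val, Val.arith (· + ·) (.pair v (.num 0)) = .num v.toNat := fun v => by
    cases v <;> simp [Val.arith, Val.toNat]
  exact cast (congrArg PT (funext fun x => h2 _)) h

@[fun_prop]
theorem PTN.eqv {f g : Val → Val} (hf : PT f) (hg : PT g) : PTN fun x => eqv (f x) (g x) := by
  have h : PT fun x => if x.fst = x.snd then .num 1 else .num 0 :=
    PT.prim (P := .eq) (fun _ => rfl) fun x => by simp only [Prog.cost]; nlinarith
  refine cast (congrArg PT (funext fun x => ?_)) (h.comp (hf.pair hg))
  simp only [Val.fst_pair, Val.snd_pair, MatVC.eqv]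
  by_cases h : f x = g x <;> simp [h]

@[fun_prop]
theorem PT.cond {c : Val → ℕ} {f g : Val → Val} (hc : PTN c) (hf : PT f) (hg : PT g) :
    PT fun x => Val.cond (c x) (f x) (g x) := by
  obtain ⟨P, hP, h⟩ := hf
  obtain ⟨Q, hQ, h'⟩ := hg
  obtain ⟨R, hR, h''⟩ := hc
  refine ⟨.ite R P Q, ((PolyBdd.add hR (PolyBdd.add hP hQ)).add (.const 1)).mono fun x => ?_,
    fun x => ?_⟩
  · simp only [Prog.cost]; split_ifs <;> omega
  · simp [Prog.eval, h, h', h'', Val.cond]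

theorem PTS.ptn {f : Val → ℕ} (hf : PTS f) : PTN f := hf.1

theorem PTS.const (n : ℕ) : PTS fun _ => n := ⟨.const n, .const n⟩

theorem PTS.size {f : Val → Val} (hf : PT f) : PTS fun x => (f x).size :=
  ⟨.size hf, hf.polyBdd_size⟩

theorem PTS.add {f g : Val → ℕ} (hf : PTS f) (hg : PTS g) : PTS fun x => f x + g x :=
  ⟨hf.1.add hg.1, hf.2.add hg.2⟩

theorem PTS.mul {f g : Val → ℕ} (hf : PTS f) (hg : PTS g) : PTS fun x => f x * g x :=
  ⟨hf.1.mul hg.1, hf.2.mul hg.2⟩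

theorem PTS.of_le {f g : Val → ℕ} (hf : PTN f) (hg : PTS g) (h : ∀ x, f x ≤ g x) : PTS f :=
  ⟨hf, hg.2.mono h⟩

theorem PTS.sub {f g : Val → ℕ} (hf : PTS f) (hg : PTN g) : PTS fun x => f x - g x :=
  .of_le (hf.1.sub hg) hf fun _ => Nat.sub_le _ _

theorem PTS.min_left {f g : Val → ℕ} (hf : PTN f) (hg : PTS g) : PTS fun x => min (f x) (g x) :=
  .of_le (.min hf hg.1) hg fun _ => min_le_right _ _

theorem PTS.polynomial {f : Val → ℕ} (hf : PTS f) (P : Polynomial ℕ) :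
    PTS fun x => P.eval (f x) := by
  induction P using Polynomial.induction_on with
  | C a => simpa using PTS.const a
  | add p q hp hq => simpa using hp.add hq
  | monomial n a h => simpa [pow_succ, mul_assoc] using h.mul hf

/-! ### Iteration with bounded intermediate results -/

/-- Replace data of length above `B` by `0`. -/
def clamp (B : ℕ) (v : Val) : Val := Val.cond (v.size - B) (.num 0) v

theorem clamp_of_le {B : ℕ} {v : Val} (h : v.size ≤ B) : clamp B v = v := by
  simp [clamp, Val.cond, h]

theorem size_clamp_le (B : ℕ) (v : Val) : (clamp B v).size ≤ B + 1 := by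
  unfold clamp Val.cond
  split_ifs with h
  · omega
  · simp [Val.size]

/-- `k`-fold iteration of `f`, intermediate results of length above `B` being replaced by `0`.  The
truncation makes the iteration polynomial-time on all inputs. -/
def citer (B k : ℕ) (f : Val → Val) (s : Val) : Val := (fun t => clamp B (f t))^[k] s

theorem citer_eq_iterate {B k : ℕ} {f : Val → Val} {s : Val}
    (h : ∀ i ≤ k, (f^[i] s).size ≤ B) : citer B k f s = f^[k] s := by
  unfold citer
  induction k with
  | zero => rfl
  | succ k ih =>
    rw [Function.iterate_succ_apply', Function.iterate_succ_apply',
      ih fun i hi => h i (by omega), clamp_of_le]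
    simpa only [Function.iterate_succ_apply'] using h (k + 1) le_rfl

theorem size_citer_le (B k : ℕ) (f : Val → Val) (s : Val) :
    (citer B k f s).size ≤ s.size + B + 1 := by
  unfold citer
  cases k with
  | zero => simp only [Function.iterate_zero, id]; omega
  | succ k =>
    rw [Function.iterate_succ_apply']
    have := size_clamp_le B (f ((fun t => clamp B (f t))^[k] s))
    omega

theorem PT.citer {B k : Val → ℕ} {f : Val → Val → Val} {s : Val → Val} (hB : PTS B) (hk : PTS k)
    (hf : PT fun z => f z.fst z.snd) (hs : PT s) :
    PT fun x => citer (B x) (k x) (f x) (s x) := by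
  have hbody : PT fun z => .pair z.fst (clamp z.fst.snd.toNat (f z.fst.fst z.snd)) := by
    have : PT fun z => f z.fst.fst z.snd :=
      PT.comp (f := fun z => f z.fst z.snd) (g := fun z => .pair z.fst.fst z.snd) hf (by fun_prop)
    exact .pair (.fst .id) (.cond (.sub (.size this) (by fun_prop)) (.const _) this)
  have hB' := hB.ptn
  have hk' := hk.ptn
  have hinit : PT fun x => .pair (.num (k x)) (.pair (.pair x (.num (B x))) (s x)) := by fun_prop
  have hloop : PT fun x => .pair (.pair x (.num (B x))) (MatVC.citer (B x) (k x) (f x) (s x)) := by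
    obtain ⟨P, hP, hPe⟩ := hbody
    have hbdd := hinit.polyBdd_size
    obtain ⟨Q, hQ, hQe⟩ := hinit
    have hit : ∀ x i, P.eval^[i] (.pair (.pair x (.num (B x))) (s x))
        = .pair (.pair x (.num (B x))) (MatVC.citer (B x) i (f x) (s x)) := by
      intro x i
      induction i with
      | zero => rfl
      | succ i ih =>
        rw [Function.iterate_succ_apply', ih, hPe]
        simp [MatVC.citer, Function.iterate_succ_apply']
    refine ⟨.comp (.loop P) Q, ?_, fun x => by rw [Prog.eval, hQe, Prog.eval, hit]⟩
    obtain ⟨S, hS⟩ := (hP : PolyBdd P.cost)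
    have hi : PolyBdd fun x =>
        S.eval ((Val.pair (.num (k x)) (.pair (.pair x (.num (B x))) (s x))).size + B x + 1) + 1 :=
      (((hbdd.add hB.2).add (.const 1)).polynomial S).add (.const 1)
    refine ((PolyBdd.add hQ ((hbdd.add (.const 1)).add (hk.2.mul hi))).add (.const 1)).mono
      fun x => ?_
    rw [Prog.cost, hQe, Prog.cost]
    gcongr
    refine (Finset.sum_le_card_nsmul _ _ (S.eval ((Val.pair (.num (k x))
      (.pair (.pair x (.num (B x))) (s x))).size + B x + 1) + 1) fun i _ => ?_).trans_eq (by simp)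
    rw [hit]
    refine Nat.succ_le_succ ((hS _).trans (polynomial_eval_mono _ ?_))
    have := size_citer_le (B x) i (f x) (s x)
    simp only [Val.size] at this ⊢
    omega
  exact hloop.snd

/-! ### Lists -/

/-- The entry of index `i` of a list; a junk value if there is none. -/
def Val.nth (l : Val) (i : ℕ) : Val := (Val.snd^[i] l).fst

theorem Val.snd_iterate_of_size_le (l : Val) (i : ℕ) (h : l.size ≤ i) : Val.snd^[i] l = .num 0 := by
  induction i generalizing l with
  | zero => have := l.size_pos; omega
  | succ i ih =>
    rw [Function.iterate_succ_apply]
    cases l with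
    | num n =>
      clear h ih
      induction i with
      | zero => rfl
      | succ i ih => rw [Function.iterate_succ_apply', ih]; rfl
    | pair a b =>
      have := a.size_pos
      refine ih _ ?_
      simp only [Val.size, Val.snd] at h ⊢
      omega

theorem Val.size_snd_iterate_le (l : Val) (i : ℕ) : (Val.snd^[i] l).size ≤ l.size := by
  induction i with
  | zero => rfl
  | succ i ih => rw [Function.iterate_succ_apply']; exact (Val.size_snd_le _).trans ih

@[fun_prop]
theorem PT.nth {l : Val → Val} {i : Val → ℕ} (hl : PT l) (hi : PTN i) :
    PT fun x => (l x).nth (i x) := by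
  have h : PT fun x => (MatVC.citer (l x).size (min (i x) (l x).size) Val.snd (l x)).fst :=
    PT.fst (PT.citer (f := fun _ => Val.snd) (.size hl) (.min_left hi (.size hl))
      (by fun_prop) hl)
  refine cast (congrArg PT (funext fun x => ?_)) h
  rw [citer_eq_iterate fun i _ => Val.size_snd_iterate_le _ i, Val.nth]
  rcases le_total (i x) (l x).size with h | h
  · rw [min_eq_left h]
  · rw [min_eq_right h, Val.snd_iterate_of_size_le _ _ le_rfl, Val.snd_iterate_of_size_le _ _ h]

@[simp] theorem Val.nth_pair_zero (a b : Val) : (Val.pair a b).nth 0 = a := rfl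

@[simp] theorem Val.nth_pair_succ (a b : Val) (i : ℕ) : (Val.pair a b).nth (i + 1) = b.nth i := by
  rw [Val.nth, Function.iterate_succ_apply]; rfl

theorem Val.nth_list (l : List Val) (i : ℕ) (h : i < l.length) : (Val.list l).nth i = l[i] := by
  induction l generalizing i with
  | nil => simp at h
  | cons a l ih =>
    cases i with
    | zero => rfl
    | succ i => simpa [Val.list] using ih i (by simpa using h)

@[simp] theorem Val.nth_vec {n : ℕ} (v : Fin n → Val) (i : Fin n) : (Val.vec v).nth i = v i := by
  rw [Val.vec, Val.nth_list _ _ (by simp)]; simp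

theorem Val.size_list (l : List Val) : (Val.list l).size = (l.map fun v => v.size + 1).sum + 1 := by
  induction l with
  | nil => simp [Val.list, Val.size]
  | cons a l ih => simp only [Val.list, Val.size, ih, List.map_cons, List.sum_cons]; omega

/-- The list `[f 0, …, f (k - 1)]`. -/
def tab (k : ℕ) (f : ℕ → Val) : Val := Val.list ((List.range k).map f)

theorem tab_eq_vec {n : ℕ} {f : ℕ → Val} {v : Fin n → Val} (h : ∀ i : Fin n, f i = v i) :
    tab n f = Val.vec v := by
  rw [tab, Val.vec]
  congr 1
  refine List.ext_getElem (by simp) fun i h1 h2 => ?_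
  simpa using h ⟨i, by simpa using h2⟩

theorem size_tab_le {k b : ℕ} {f : ℕ → Val} (h : ∀ i < k, (f i).size ≤ b) :
    (tab k f).size ≤ k * (b + 1) + 1 := by
  rw [tab, Val.size_list, List.map_map]
  have : ((List.range k).map ((fun v => v.size + 1) ∘ f)).sum
      ≤ ((List.range k).map ((fun v => v.size + 1) ∘ f)).length • (b + 1) := by
    refine List.sum_le_card_nsmul _ _ fun x hx => ?_
    simp only [List.mem_map, List.mem_range] at hx
    obtain ⟨i, hi, rfl⟩ := hx
    simpa using h i hi
  simp only [List.length_map, List.length_range, smul_eq_mul] at this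
  omega

theorem size_vec_le {n b : ℕ} {v : Fin n → Val} (h : ∀ i, (v i).size ≤ b) :
    (Val.vec v).size ≤ n * (b + 1) + 1 := by
  rw [← tab_eq_vec (f := fun i => if h : i < n then v ⟨i, h⟩ else .num 0) (by simp)]
  exact size_tab_le fun i hi => by simpa [hi] using h ⟨i, hi⟩

theorem tab_step_iterate (k : ℕ) (f : ℕ → Val) (i : ℕ) (hi : i ≤ k) :
    (fun t : Val => Val.pair (.num (t.fst.toNat - 1)) (.pair (f (t.fst.toNat - 1)) t.snd))^[i]
      (.pair (.num k) (.num 0))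
      = .pair (.num (k - i)) (tab i fun j => f (k - i + j)) := by
  induction i with
  | zero => rfl
  | succ i ih =>
    rw [Function.iterate_succ_apply', ih (by omega)]
    simp only [Val.fst_pair, Val.snd_pair, Val.toNat_num, tab, List.range_succ_eq_map,
      List.map_cons, List.map_map, Val.list]
    refine congrArg₂ _ (by congr 1) (congrArg₂ _ (by congr 1) ?_)
    congr 1
    refine List.map_congr_left fun j _ => ?_
    simp only [Function.comp]
    congr 1
    omega

theorem PT.tab {k : Val → ℕ} {f : Val → ℕ → Val} (hk : PTS k)
    (hf : PT fun z => f z.fst z.snd.toNat) : PT fun x => tab (k x) (f x) := by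
  obtain ⟨S, hS⟩ := hf.polyBdd_size
  have hel : ∀ x, ∀ i ≤ k x, (f x i).size ≤ S.eval (x.size + k x + 2) := by
    intro x i hi
    have := hS (.pair x (.num i))
    refine this.trans (polynomial_eval_mono _ ?_)
    have h1 := natSize_le_self i
    simp only [Val.size]
    omega
  have hB : PTS fun x => k x * (S.eval (x.size + k x + 2) + 1) + k x + 3 :=
    ((hk.mul (((((PTS.size .id).add hk).add (.const 2)).polynomial S).add (.const 1))).add hk).add
      (.const 3)
  have h := (PT.citer (f := fun x t => .pair (.num (t.fst.toNat - 1))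
      (.pair (f x (t.fst.toNat - 1)) t.snd)) (s := fun x => .pair (.num (k x)) (.num 0)) hB hk
      (by
        exact .pair (by fun_prop) (.pair (PT.comp (f := fun z => f z.fst z.snd.toNat)
          (g := fun z => .pair z.fst (.num (z.snd.fst.toNat - 1))) hf (by fun_prop))
          (by fun_prop)))
      (by have := hk.ptn; fun_prop)).snd
  refine cast (congrArg PT (funext fun x => ?_)) h
  rw [citer_eq_iterate, tab_step_iterate _ _ _ le_rfl]
  · simp
  · intro i hi
    rw [tab_step_iterate _ _ _ hi]
    have h1 := size_tab_le (k := i) (b := S.eval (x.size + k x + 2))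
      (f := fun j => f x (k x - i + j)) fun j hj => hel x _ (by omega)
    have h2 := natSize_le_self (k x - i)
    have h3 := Nat.mul_le_mul_right (S.eval (x.size + k x + 2) + 1) hi
    simp only [Val.size]
    omega

/-! ### Recursion along an index, and powers -/

/-- The value after `k` steps `v ↦ f i v`, `i = 0, …, k - 1`, computed with truncation at `B`. -/
def cfold (B k : ℕ) (f : ℕ → Val → Val) (v : Val) : Val :=
  (citer B k (fun t => .pair (.num (t.fst.toNat + 1)) (f t.fst.toNat t.snd))
    (.pair (.num 0) v)).snd

theorem cfold_eq {B k : ℕ} {f : ℕ → Val → Val} (a : ℕ → Val)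
    (ha : ∀ i < k, f i (a i) = a (i + 1)) (hB : ∀ i ≤ k, (a i).size + i + 2 ≤ B) :
    cfold B k f (a 0) = a k := by
  have key : ∀ i ≤ k, (fun t : Val => Val.pair (.num (t.fst.toNat + 1)) (f t.fst.toNat t.snd))^[i]
      (.pair (.num 0) (a 0)) = .pair (.num i) (a i) := by
    intro i hi
    induction i with
    | zero => rfl
    | succ i ih =>
      rw [Function.iterate_succ_apply', ih (by omega)]
      simp [ha i (by omega)]
  rw [cfold, citer_eq_iterate, key k le_rfl, Val.snd_pair]
  intro i hi
  rw [key i hi]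
  have h1 := hB i hi
  have h2 := natSize_le_self i
  simp only [Val.size]
  omega

theorem PT.cfold {B k : Val → ℕ} {f : Val → ℕ → Val → Val} {v : Val → Val} (hB : PTS B)
    (hk : PTS k) (hf : PT fun z => f z.fst z.snd.fst.toNat z.snd.snd) (hv : PT v) :
    PT fun x => cfold (B x) (k x) (f x) (v x) :=
  (PT.citer (f := fun x t => .pair (.num (t.fst.toNat + 1)) (f x t.fst.toNat t.snd))
    (s := fun x => .pair (.num 0) (v x)) hB hk (.pair (by fun_prop) hf) (by fun_prop)).snd

theorem PTN.pow {b e : Val → ℕ} (hb : PTN b) (he : PTS e) : PTN fun x => b x ^ e x := by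
  have hB : PTS fun x => e x * (Val.num (b x)).size + e x + 4 :=
    ((he.mul (.size hb)).add he).add (.const 4)
  have h := PT.cfold (f := fun x _ t => .num (t.toNat * b x)) (v := fun _ => .num 1) hB he
    (by fun_prop) (by fun_prop)
  refine cast (congrArg PT (funext fun x => ?_)) h
  refine cfold_eq (fun i => .num (b x ^ i)) (fun i _ => by simp [pow_succ]) fun i hi => ?_
  have h1 := natSize_pow_le (b x) i
  have h2 := Nat.mul_le_mul_right (b x).size hi
  simp only [Val.size]
  nlinarith

/-! ### Probabilities of Boolean experiments -/

theorem prTrue_nonneg (E : PMF Bool) : 0 ≤ prTrue E := ENNReal.toReal_nonneg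

theorem prTrue_le_one (E : PMF Bool) : prTrue E ≤ 1 :=
  ENNReal.toReal_mono ENNReal.one_ne_top (E.coe_le_one true)

theorem prTrue_pure (b : Bool) : prTrue (PMF.pure b) = if b then 1 else 0 := by
  cases b <;> simp [prTrue, PMF.pure_apply]

theorem summable_toReal {α : Type*} (μ : PMF α) : Summable fun a => (μ a).toReal :=
  ENNReal.summable_toReal (by simp [μ.tsum_coe])

theorem tsum_toReal {α : Type*} (μ : PMF α) : ∑' a, (μ a).toReal = 1 := by
  rw [← ENNReal.tsum_toReal_eq fun a => μ.apply_ne_top a, μ.tsum_coe, ENNReal.toReal_one]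

theorem summable_mul_prTrue {α : Type*} (μ : PMF α) (f : α → PMF Bool) :
    Summable fun a => (μ a).toReal * prTrue (f a) :=
  (summable_toReal μ).of_nonneg_of_le
    (fun _ => mul_nonneg ENNReal.toReal_nonneg (prTrue_nonneg _))
    fun _ => mul_le_of_le_one_right ENNReal.toReal_nonneg (prTrue_le_one _)

theorem prTrue_bind {α : Type*} (μ : PMF α) (f : α → PMF Bool) :
    prTrue (μ.bind f) = ∑' a, (μ a).toReal * prTrue (f a) := by
  rw [prTrue, PMF.bind_apply, ENNReal.tsum_toReal_eq]
  · simp [prTrue]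
  · exact fun a => ENNReal.mul_ne_top (μ.apply_ne_top a) ((f a).apply_ne_top true)

theorem prTrue_bind_le_add {α : Type*} (μ : PMF α) {f g : α → PMF Bool} {δ : ℝ}
    (h : ∀ a ∈ μ.support, prTrue (f a) ≤ prTrue (g a) + δ) :
    prTrue (μ.bind f) ≤ prTrue (μ.bind g) + δ := by
  rw [prTrue_bind, prTrue_bind]
  have h2 : ∑' a, (μ a).toReal * δ = δ := by rw [tsum_mul_right, tsum_toReal, one_mul]
  rw [← h2, ← (summable_mul_prTrue μ g).tsum_add ((summable_toReal μ).mul_right δ)]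
  refine (summable_mul_prTrue μ f).tsum_le_tsum (fun a => ?_)
    ((summable_mul_prTrue μ g).add ((summable_toReal μ).mul_right δ))
  rw [← mul_add]
  by_cases ha : a ∈ μ.support
  · exact mul_le_mul_of_nonneg_left (h a ha) ENNReal.toReal_nonneg
  · simp [(PMF.apply_eq_zero_iff μ a).2 ha]

theorem prTrue_bind_mono {α : Type*} (μ : PMF α) {f g : α → PMF Bool}
    (h : ∀ a ∈ μ.support, prTrue (f a) ≤ prTrue (g a)) :
    prTrue (μ.bind f) ≤ prTrue (μ.bind g) := by
  simpa using prTrue_bind_le_add μ (δ := 0) (by simpa using h)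

theorem prTrue_bind_le {α : Type*} (μ : PMF α) {f : α → PMF Bool} {c : ℝ}
    (h : ∀ a, prTrue (f a) ≤ c) : prTrue (μ.bind f) ≤ c := by
  have := prTrue_bind_le_add μ (f := f) (g := fun _ => PMF.pure false) (δ := c)
    fun a _ => by simpa [prTrue_pure] using h a
  simpa [prTrue_pure] using this

theorem abs_prTrue_bind_sub_le {α : Type*} (μ : PMF α) {f g : α → PMF Bool} {δ : ℝ}
    (h : ∀ a, |prTrue (f a) - prTrue (g a)| ≤ δ) :
    |prTrue (μ.bind f) - prTrue (μ.bind g)| ≤ δ := by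
  refine abs_sub_le_iff.2 ⟨?_, ?_⟩
  · have := prTrue_bind_le_add μ (f := f) (g := g) (δ := δ)
      fun a _ => by linarith [(abs_sub_le_iff.1 (h a)).1]
    linarith
  · have := prTrue_bind_le_add μ (f := g) (g := f) (δ := δ)
      fun a _ => by linarith [(abs_sub_le_iff.1 (h a)).2]
    linarith

theorem abs_prTrue_sub_le_one (E E' : PMF Bool) : |prTrue E - prTrue E'| ≤ 1 :=
  abs_sub_le_iff.2 ⟨by linarith [prTrue_nonneg E', prTrue_le_one E],
    by linarith [prTrue_nonneg E, prTrue_le_one E']⟩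

/-! ### Uniform distributions -/

section Uniform

variable {α β : Type} [Fintype α] [Nonempty α] [Fintype β] [Nonempty β]

theorem uniform_map_bijective {f : α → β} (hf : Function.Bijective f) :
    (PMF.uniformOfFintype α).map f = PMF.uniformOfFintype β := by
  classical
  ext b
  obtain ⟨a, rfl⟩ := hf.2 b
  rw [PMF.map_apply, tsum_eq_single a]
  · simp [Fintype.card_of_bijective hf]
  · intro a' ha'
    rw [if_neg fun h => ha' (hf.1 h.symm)]

theorem uniform_bind_bijective {γ : Type} {f : α → β} (hf : Function.Bijective f)
    (k : β → PMF γ) :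
    ((PMF.uniformOfFintype α).bind fun a => k (f a)) = (PMF.uniformOfFintype β).bind k := by
  rw [← uniform_map_bijective hf, PMF.bind_map]; rfl

theorem uniform_prod : ((PMF.uniformOfFintype α).bind fun a =>
    (PMF.uniformOfFintype β).map (Prod.mk a)) = PMF.uniformOfFintype (α × β) := by
  classical
  ext ⟨a, b⟩
  rw [PMF.bind_apply, tsum_eq_single a]
  · rw [PMF.map_apply, tsum_eq_single b]
    · simp [ENNReal.mul_inv]
    · intro b' hb'
      rw [if_neg fun h => hb' (Prod.mk.inj h).2.symm]
  · intro a' ha'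
    rw [PMF.map_apply, ENNReal.tsum_eq_zero.2, mul_zero]
    intro b'
    rw [if_neg fun h => ha' (Prod.mk.inj h).1.symm]

theorem prTrue_uniform_bind (f : α → PMF Bool) :
    prTrue ((PMF.uniformOfFintype α).bind f) = (∑ a, prTrue (f a)) / Fintype.card α := by
  rw [prTrue_bind, tsum_fintype, Finset.sum_div]
  refine Finset.sum_congr rfl fun a _ => ?_
  simp [div_eq_inv_mul]

/-- Two experiments that start with a uniform choice and whose continuations are close for all but
a few choices. -/
theorem abs_prTrue_uniform_bind_sub_le {f g : α → PMF Bool} {δ ε : ℝ} (hδ : 0 ≤ δ)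
    (bad : Finset α) (hbad : (bad.card : ℝ) / Fintype.card α ≤ ε)
    (h : ∀ a ∉ bad, |prTrue (f a) - prTrue (g a)| ≤ δ) :
    |prTrue ((PMF.uniformOfFintype α).bind f) - prTrue ((PMF.uniformOfFintype α).bind g)|
      ≤ ε + δ := by
  classical
  have hc : (0 : ℝ) < Fintype.card α := by exact_mod_cast Fintype.card_pos
  rw [prTrue_uniform_bind, prTrue_uniform_bind, ← sub_div, ← Finset.sum_sub_distrib, abs_div,
    abs_of_pos hc, div_le_iff₀ hc]
  rw [div_le_iff₀ hc] at hbad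
  calc |∑ a, (prTrue (f a) - prTrue (g a))| ≤ ∑ a, |prTrue (f a) - prTrue (g a)| :=
        Finset.abs_sum_le_sum_abs _ _
    _ ≤ ∑ a, ((if a ∈ bad then 1 else 0) + δ) := by
        refine Finset.sum_le_sum fun a _ => ?_
        split_ifs with ha
        · linarith [abs_prTrue_sub_le_one (f a) (g a)]
        · linarith [h a ha]
    _ ≤ (ε + δ) * Fintype.card α := by
        rw [Finset.sum_add_distrib, Finset.sum_boole]
        simp only [Finset.filter_mem_eq_inter, Finset.univ_inter, Finset.sum_const,
          Finset.card_univ, nsmul_eq_mul]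
        nlinarith

end Uniform

/-! ### Random choices read off a number -/

/-- The uniform distribution on `{0, …, m - 1}`. -/
def unifNat (m : ℕ) : PMF ℕ :=
  if h : m = 0 then PMF.pure 0
  else haveI : NeZero m := ⟨h⟩; (PMF.uniformOfFintype (Fin m)).map Fin.val

theorem unifNat_eq (m : ℕ) [NeZero m] :
    unifNat m = (PMF.uniformOfFintype (Fin m)).map Fin.val := by
  rw [unifNat, dif_neg (NeZero.ne m)]

/-- `D` reads a sample of `E` off a uniform number below a multiple of `K`, leaving a uniform number
that is independent of the sample. -/
def Impl {β : Type} (K : ℕ) (E : PMF β) (D : ℕ → β × ℕ) : Prop :=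
  ∀ L : ℕ, 0 < L → (unifNat (K * L)).map D = E.bind fun b => (unifNat L).map (Prod.mk b)

/-- `f` reads a sample of `E` off a uniform number below a multiple of `K`. -/
def Sim {β : Type} (K : ℕ) (E : PMF β) (f : ℕ → β) : Prop :=
  ∀ L : ℕ, 0 < L → (unifNat (K * L)).map f = E

theorem Impl.divMod (K : ℕ) (hK : 0 < K) : Impl K (unifNat K) fun R => (R % K, R / K) := by
  intro L hL
  have : NeZero K := ⟨hK.ne'⟩
  have : NeZero L := ⟨hL.ne'⟩
  have h : (PMF.uniformOfFintype (Fin (K * L))).map (fun R => (R.val % K, R.val / K))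
      = (PMF.uniformOfFintype (Fin K × Fin L)).map fun x => (x.1.val, x.2.val) := by
    rw [← uniform_map_bijective (((Equiv.prodComm _ _).trans finProdFinEquiv).trans
      (finCongr (Nat.mul_comm L K)) : Fin K × Fin L ≃ Fin (K * L)).bijective, PMF.map_comp]
    congr 1
    funext x
    have := x.1.2
    simp [Nat.mod_eq_of_lt this, Nat.add_mul_div_left _ _ hK, Nat.div_eq_of_lt this]
  rw [unifNat_eq, PMF.map_comp]
  refine h.trans ?_
  rw [← uniform_prod, PMF.map_bind, unifNat_eq, unifNat_eq, PMF.bind_map]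
  refine congrArg _ (funext fun a => ?_)
  simp only [Function.comp, PMF.map_comp]
  rfl

theorem Impl.bind {β γ : Type} {K₁ K₂ : ℕ} {E₁ : PMF β} {E₂ : β → PMF γ} {D₁ : ℕ → β × ℕ}
    {D₂ : β → ℕ → γ × ℕ} (h₁ : Impl K₁ E₁ D₁) (h₂ : ∀ b, Impl K₂ (E₂ b) (D₂ b)) (hK : 0 < K₂) :
    Impl (K₁ * K₂) (E₁.bind E₂) fun R => D₂ (D₁ R).1 (D₁ R).2 := by
  intro L hL
  have e : (fun R => D₂ (D₁ R).1 (D₁ R).2) = (fun x : β × ℕ => D₂ x.1 x.2) ∘ D₁ := rfl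
  rw [e, ← PMF.map_comp, mul_assoc, h₁ _ (Nat.mul_pos hK hL), PMF.map_bind, PMF.bind_bind]
  refine congrArg _ (funext fun b => ?_)
  rw [PMF.map_comp, ← h₂ b L hL]
  rfl

theorem Impl.sim_bind {β γ : Type} {K₁ K₂ : ℕ} {E₁ : PMF β} {E₂ : β → PMF γ} {D₁ : ℕ → β × ℕ}
    {f₂ : β → ℕ → γ} (h₁ : Impl K₁ E₁ D₁) (h₂ : ∀ b, Sim K₂ (E₂ b) (f₂ b)) (hK : 0 < K₂) :
    Sim (K₁ * K₂) (E₁.bind E₂) fun R => f₂ (D₁ R).1 (D₁ R).2 := by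
  intro L hL
  have e : (fun R => f₂ (D₁ R).1 (D₁ R).2) = (fun x : β × ℕ => f₂ x.1 x.2) ∘ D₁ := rfl
  rw [e, ← PMF.map_comp, mul_assoc, h₁ _ (Nat.mul_pos hK hL), PMF.map_bind]
  refine congrArg _ (funext fun b => ?_)
  rw [PMF.map_comp, ← h₂ b L hL]
  rfl

theorem Impl.map {β γ : Type} {K : ℕ} {E : PMF β} {D : ℕ → β × ℕ} (h : Impl K E D) (f : β → γ) :
    Impl K (E.map f) fun R => (f (D R).1, (D R).2) := by
  intro L hL
  have e : (fun R => (f (D R).1, (D R).2)) = (fun x : β × ℕ => (f x.1, x.2)) ∘ D := rfl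
  rw [e, ← PMF.map_comp, h L hL, PMF.map_bind, PMF.bind_map]
  refine congrArg _ (funext fun b => ?_)
  rw [PMF.map_comp]
  rfl

theorem Impl.pure {β : Type} (b : β) : Impl 1 (PMF.pure b) fun R => (b, R) := by
  intro L hL
  rw [one_mul, PMF.pure_bind]

/-- Random coins may be skipped. -/
theorem Impl.skip {β : Type} (K : ℕ) (hK : 0 < K) (b : β) :
    Impl K (PMF.pure b) fun R => (b, R / K) := by
  have := (Impl.divMod K hK).map fun _ => b
  rwa [show (unifNat K).map (fun _ => b) = PMF.pure b from PMF.map_const _ _] at this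

theorem Impl.sim {β : Type} {K : ℕ} {E : PMF β} {D : ℕ → β × ℕ} (h : Impl K E D) :
    Sim K E fun R => (D R).1 := by
  intro L hL
  have h1 := congrArg (PMF.map Prod.fst) (h L hL)
  rw [PMF.map_comp, PMF.map_bind] at h1
  refine h1.trans ?_
  conv_rhs => rw [← PMF.bind_pure E]
  refine congrArg _ (funext fun b => ?_)
  rw [PMF.map_comp]
  exact PMF.map_const _ _

theorem digit_mod_pow {n i : ℕ} (R K : ℕ) (h : i < n) : R % K ^ n / K ^ i % K = R / K ^ i % K := by
  have : K ^ n = K ^ i * (K * K ^ (n - i - 1)) := by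
    rw [← pow_succ', ← pow_add]; congr 1; omega
  rw [this, Nat.mod_mul_right_div_self, Nat.mod_mul_right_mod]

theorem Sim.pure {β : Type} (K : ℕ) (b : β) : Sim K (PMF.pure b) fun _ => b :=
  fun _ _ => PMF.map_const _ _

/-- `d` reads a sample of `μ` off a uniform number below `K`. -/
def Decodes {β : Type} (K : ℕ) (μ : PMF β) (d : ℕ → β) : Prop := (unifNat K).map d = μ

theorem Decodes.impl {β : Type} {K : ℕ} {μ : PMF β} {d : ℕ → β} (h : Decodes K μ d) (hK : 0 < K) :
    Impl K μ fun R => (d (R % K), R / K) := by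
  unfold Decodes at h
  rw [← h]
  exact (Impl.divMod K hK).map d

theorem decodes_fin (K : ℕ) [NeZero K] :
    Decodes K (PMF.uniformOfFintype (Fin K)) (Fin.ofNat K) := by
  rw [Decodes, unifNat_eq, PMF.map_comp]
  convert PMF.map_id _
  ext x
  simp

theorem decodes_of_bijective {β : Type} [Fintype β] [Nonempty β] (K : ℕ) [NeZero K] (d : ℕ → β)
    (h : Function.Bijective fun i : Fin K => d i) : Decodes K (PMF.uniformOfFintype β) d := by
  rw [Decodes, unifNat_eq, PMF.map_comp]
  exact uniform_map_bijective h

theorem decodes_zmod (N : ℕ) [NeZero N] :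
    Decodes N (PMF.uniformOfFintype (ZMod N)) (Nat.cast : ℕ → ZMod N) := by
  refine decodes_of_bijective N _ ((Fintype.bijective_iff_injective_and_card _).2 ⟨?_, by simp⟩)
  intro a b h
  have := congrArg ZMod.val h
  simpa [ZMod.val_natCast, Nat.mod_eq_of_lt, Fin.ext_iff] using this

theorem decodes_bool : Decodes 2 (PMF.uniformOfFintype Bool) fun R => decide (R = 1) := by
  refine decodes_of_bijective 2 _ ?_
  decide

theorem uniform_eq_bind_cons {β : Type} [Fintype β] [Nonempty β] (n : ℕ) :
    PMF.uniformOfFintype (Fin (n + 1) → β) = (PMF.uniformOfFintype β).bind fun b =>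
      (PMF.uniformOfFintype (Fin n → β)).map (Fin.cons b) := by
  rw [← uniform_map_bijective (Fin.consEquiv fun _ : Fin (n + 1) => β).bijective, ← uniform_prod,
    PMF.map_bind]
  refine congrArg _ (funext fun b => ?_)
  rw [PMF.map_comp]
  rfl

/-- Digits: a vector of independent samples is read off in base `K`. -/
theorem Decodes.pi {β : Type} [Fintype β] [Nonempty β] {K : ℕ} {d : ℕ → β} (hK : 0 < K)
    (h : Decodes K (PMF.uniformOfFintype β) d) (n : ℕ) :
    Decodes (K ^ n) (PMF.uniformOfFintype (Fin n → β)) fun R i => d (R / K ^ (i : ℕ) % K) := by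
  induction n with
  | zero =>
    have : Unique (Fin 0 → β) := ⟨⟨Fin.elim0⟩, fun f => funext fun i => i.elim0⟩
    have e : (fun (R : ℕ) (i : Fin 0) => d (R / K ^ (i : ℕ) % K)) = fun _ => Fin.elim0 := by
      funext R i; exact i.elim0
    unfold Decodes
    rw [e]
    refine (PMF.map_const _ _).trans ?_
    ext f
    simp [PMF.pure_apply, eq_iff_true_of_subsingleton]
  | succ n ih =>
    have h1 := (h.impl hK).sim_bind (E₂ := fun b => (PMF.uniformOfFintype (Fin n → β)).map
      (Fin.cons b)) (f₂ := fun b R => (Fin.cons b fun i : Fin n => d (R / K ^ (i : ℕ) % K) :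
        Fin (n + 1) → β)) (K₂ := K ^ n) ?_ (by positivity)
    · rw [← uniform_eq_bind_cons] at h1
      have h2 := h1 1 one_pos
      rw [mul_one, ← pow_succ'] at h2
      rw [Decodes, ← h2]
      congr 1
      funext R i
      refine Fin.cases ?_ (fun i => ?_) i
      · simp
      · simp [pow_succ', Nat.div_div_eq_div_mul]
    · intro b
      have h3 := ((ih.impl (by positivity)).map (Fin.cons (α := fun _ => β) b)).sim
      convert h3 using 2 with R
      refine congrArg (Fin.cons (α := fun _ => β) b) (funext fun i => congrArg d ?_)
      rw [digit_mod_pow _ _ i.2]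

theorem prTrue_map_unifNat (M : ℕ) (hM : 0 < M) (f : ℕ → Bool) :
    prTrue ((unifNat M).map f) = (((Finset.range M).filter fun i => f i = true).card : ℝ) / M := by
  have : NeZero M := ⟨hM.ne'⟩
  rw [unifNat_eq, PMF.map_comp, ← PMF.bind_pure_comp, prTrue_uniform_bind]
  simp only [Function.comp, prTrue_pure, Fintype.card_fin]
  rw [Fin.sum_univ_eq_sum_range (fun i => if f i = true then (1 : ℝ) else 0) M, Finset.sum_boole]

/-- A number that is uniform below `M` instead of a multiple of `K` causes an error of at most
`K / M`. -/
theorem Sim.abs_prTrue_sub_le {K M : ℕ} {E : PMF Bool} {f : ℕ → Bool} (h : Sim K E f) (hK : 0 < K)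
    (hKM : K ≤ M) : |prTrue ((unifNat M).map f) - prTrue E| ≤ (K : ℝ) / M := by
  have hL : 0 < M / K := Nat.div_pos hKM hK
  have hm : 0 < K * (M / K) := Nat.mul_pos hK hL
  have hM : 0 < M := hK.trans_le hKM
  rw [← h _ hL, prTrue_map_unifNat _ hM, prTrue_map_unifNat _ hm]
  set m := K * (M / K) with hmdef
  have hmM : m ≤ M := Nat.mul_div_le M K
  have hlt : M < m + K := by
    have := Nat.div_add_mod M K
    have := Nat.mod_lt M hK
    omega
  set S := ((Finset.range M).filter fun i => f i = true).card
  set S' := ((Finset.range m).filter fun i => f i = true).card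
  have h1 : S' ≤ S := Finset.card_le_card (Finset.filter_subset_filter _
    (Finset.range_subset_range.2 hmM))
  have h2 : S ≤ S' + (M - m) := by
    have : (Finset.range M).filter (fun i => f i = true) ⊆
        (Finset.range m).filter (fun i => f i = true) ∪ Finset.Ico m M := by
      intro i hi
      simp only [Finset.mem_filter, Finset.mem_range, Finset.mem_union, Finset.mem_Ico] at hi ⊢
      rcases lt_or_ge i m with h | h
      · exact .inl ⟨h, hi.2⟩
      · exact .inr ⟨h, hi.1⟩
    refine (Finset.card_le_card this).trans ((Finset.card_union_le _ _).trans ?_)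
    simp [S']
  have h3 : S' ≤ m := (Finset.card_filter_le _ _).trans (by simp)
  have r1 : (S' : ℝ) ≤ S := by exact_mod_cast h1
  have r2 : (S : ℝ) + m ≤ S' + M := by exact_mod_cast (by omega : S + m ≤ S' + M)
  have r3 : (S' : ℝ) ≤ m := by exact_mod_cast h3
  have r4 : (M : ℝ) ≤ m + K := by exact_mod_cast hlt.le
  have r5 : (m : ℝ) ≤ M := by exact_mod_cast hmM
  have p1 : (0 : ℝ) < M := by exact_mod_cast hM
  have p2 : (0 : ℝ) < m := by exact_mod_cast hm
  have p3 : (0 : ℝ) ≤ S' := by positivity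
  have e : (S' : ℝ) / m * M = S' + S' / m * (M - m) := by field_simp; ring
  have h6 : (S' : ℝ) / m ≤ 1 := (div_le_one p2).2 r3
  have h7 : 0 ≤ (S' : ℝ) / m := by positivity
  have h8 : (S' : ℝ) / m * (M - m) ≤ M - m := mul_le_of_le_one_left (by linarith) h6
  have h9 : 0 ≤ (S' : ℝ) / m * (M - m) := mul_nonneg h7 (by linarith)
  rw [show (S : ℝ) / M - S' / m = (S - S' / m * M) / M by field_simp, abs_div, abs_of_pos p1]
  gcongr
  rw [e]
  exact abs_le.2 ⟨by linarith, by linarith⟩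

/-! ### Trilinear maps in exponents -/

namespace TrilinearInstance

variable (Γ : TrilinearInstance)

theorem N_pos : 0 < Γ.N := Nat.pos_of_ne_zero (NeZero.ne _)

theorem orderOf_g (i : Fin 3) : orderOf (Γ.g i) = Γ.N := by
  rw [orderOf_eq_card_of_forall_mem_zpowers (Γ.g_gen i), Nat.card_eq_fintype_card, Γ.card_G, N]

theorem card_G' (i : Fin 3) : Fintype.card (Γ.G i) = Γ.N := Γ.card_G i

theorem exists_pow_eq {i : Fin 3} (x : Γ.G i) : ∃ a : ℕ, x = Γ.g i ^ a := by
  obtain ⟨a, h⟩ := (Submonoid.mem_powers_iff x (Γ.g i)).1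
    (mem_powers_iff_mem_zpowers.2 (Γ.g_gen i x))
  exact ⟨a, h.symm⟩

theorem g_pow_eq_iff {i : Fin 3} {a b : ℕ} : Γ.g i ^ a = Γ.g i ^ b ↔ a ≡ b [MOD Γ.N] := by
  rw [pow_eq_pow_iff_modEq, orderOf_g]

theorem pow_N {i : Fin 3} (x : Γ.G i) : x ^ Γ.N = 1 := by
  rw [← Γ.card_G' i, pow_card_eq_one]

section Pairing

variable {Γ} {i j k : Fin 3} (h : (i : ℕ) + 1 + ((j : ℕ) + 1) = (k : ℕ) + 1)

theorem e_pow_left (x : Γ.G i) (y : Γ.G j) (n : ℕ) : Γ.e h (x ^ n) y = Γ.e h x y ^ n := by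
  obtain ⟨a, rfl⟩ := Γ.exists_pow_eq x
  obtain ⟨b, rfl⟩ := Γ.exists_pow_eq y
  rw [← pow_mul, Γ.e_pow, Γ.e_pow, ← pow_mul]
  congr 1; ring

theorem e_pow_right (x : Γ.G i) (y : Γ.G j) (n : ℕ) : Γ.e h x (y ^ n) = Γ.e h x y ^ n := by
  obtain ⟨a, rfl⟩ := Γ.exists_pow_eq x
  obtain ⟨b, rfl⟩ := Γ.exists_pow_eq y
  rw [← pow_mul, Γ.e_pow, Γ.e_pow, ← pow_mul]
  congr 1; ring

theorem e_mul_left (x x' : Γ.G i) (y : Γ.G j) : Γ.e h (x * x') y = Γ.e h x y * Γ.e h x' y := by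
  obtain ⟨a, rfl⟩ := Γ.exists_pow_eq x
  obtain ⟨a', rfl⟩ := Γ.exists_pow_eq x'
  obtain ⟨b, rfl⟩ := Γ.exists_pow_eq y
  rw [← pow_add, Γ.e_pow, Γ.e_pow, Γ.e_pow, ← pow_add]
  congr 1; ring

theorem e_one_left (y : Γ.G j) : Γ.e h 1 y = 1 := by simpa using e_pow_left h 1 y 0

theorem e_prod_left {ι : Type} (s : Finset ι) (x : ι → Γ.G i) (y : Γ.G j) :
    Γ.e h (∏ l ∈ s, x l) y = ∏ l ∈ s, Γ.e h (x l) y :=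
  map_prod (⟨⟨fun x => Γ.e h x y, e_one_left h y⟩, fun a b => e_mul_left h a b y⟩ :
    Γ.G i →* Γ.G k) x s

theorem e_g_right (x : ℕ) : Γ.e h (Γ.g i ^ x) (Γ.g j) = Γ.g k ^ x := by
  simpa using Γ.e_pow h x 1

end Pairing

/-- Powers of `g^p` only depend on the exponent modulo `q`. -/
theorem g_pow_p_eq_iff {i : Fin 3} {a b : ℕ} :
    (Γ.g i ^ Γ.p) ^ a = (Γ.g i ^ Γ.p) ^ b ↔ (a : ZMod Γ.q) = b := by
  rw [← pow_mul, ← pow_mul, g_pow_eq_iff, N, ZMod.natCast_eq_natCast_iff]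
  exact ⟨fun h => Nat.ModEq.mul_left_cancel' Γ.prime_p.ne_zero h, Nat.ModEq.mul_left' _⟩

/-- The test of `Verify` takes place in `G₃`; it can equivalently be done in `G₂`. -/
theorem check_iff (a m : ℕ) (w : Γ.G 0) (z : Γ.G 1) :
    Γ.e₂₁ z (Γ.g 0 ^ Γ.p) = (Γ.g 2 ^ (Γ.p ^ 2 * a)) ^ (Γ.p * m) * Γ.e₁₂ w (Γ.g 1 ^ Γ.p) ↔
      z ^ Γ.p = Γ.g 1 ^ (Γ.p ^ 3 * a * m) * Γ.e₁₁ w (Γ.g 0) ^ Γ.p := by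
  obtain ⟨s, rfl⟩ := Γ.exists_pow_eq z
  obtain ⟨t, rfl⟩ := Γ.exists_pow_eq w
  rw [e₂₁, e₁₂, e₁₁, e_pow_right, e_pow_right, e_g_right, e_g_right, e_g_right]
  simp only [← pow_mul, ← pow_add, g_pow_eq_iff]
  rw [show Γ.p ^ 2 * a * (Γ.p * m) = Γ.p ^ 3 * a * m by ring]

end TrilinearInstance

/-! ### Correctness and cost -/

open Classical in
theorem decryptC_val {Γ : TrilinearInstance} (msgs : List ℕ) (c : Γ.G 0) :
    (decryptC msgs c).val = msgs.find? fun m => decide (c ^ Γ.p = (Γ.g 0 ^ Γ.p) ^ m) := rfl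

open Classical in
theorem verifyC_val_eq_some_iff {Γ : TrilinearInstance} {n : ℕ} (msgs : List ℕ)
    (sk : SecretKey Γ n) (τ : Fin n → Γ.G 2) (ρ : Fin n → Γ.G 0) (π : Fin n → Γ.G 1)
    (y : Fin n → ZMod Γ.q) :
    (verifyC msgs sk τ ρ π).val = some y ↔ ∀ i, ∃ m, (decryptC msgs (ρ i)).val = some m ∧
      Γ.e₂₁ (π i) (Γ.g 0 ^ Γ.p) = sk.η ^ (Γ.p * m) * τ i ∧ y i = m := by
  let z : Fin n → Option (ZMod Γ.q) := fun i =>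
    match (decryptC msgs (ρ i)).val with
    | none => none
    | some m =>
      if decide (Γ.e₂₁ (π i) (Γ.g 0 ^ Γ.p) = sk.η ^ (Γ.p * m) * τ i) then some (m : ZMod Γ.q)
      else none
  have hv : (verifyC msgs sk τ ρ π).val
      = if ∀ i, (z i).isSome then some (fun i => (z i).getD 0) else none := by
    have hz : ∀ i, z i = (do
      match (← decryptC msgs (ρ i)) with
      | none => pure none
      | some m => do
        let gp ← Counted.op (Γ.g 0 ^ Γ.p)
        let l ← Counted.op (Γ.e₂₁ (π i) gp)
        let t ← Counted.op (sk.η ^ (Γ.p * m))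
        let r ← Counted.op (t * τ i)
        let ok ← Counted.op (decide (l = r))
        pure (if ok then some (m : ZMod Γ.q) else none) : Counted (Option (ZMod Γ.q))).val := by
      intro i
      simp only [z, bind]
      cases (decryptC msgs (ρ i)).val <;> rfl
    simp only [hz]
    rfl
  have hi : ∀ i b, z i = some b ↔ ∃ m, (decryptC msgs (ρ i)).val = some m ∧
      Γ.e₂₁ (π i) (Γ.g 0 ^ Γ.p) = sk.η ^ (Γ.p * m) * τ i ∧ b = m := by
    intro i b
    simp only [z]
    cases (decryptC msgs (ρ i)).val with
    | none => simp
    | some m =>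
      simp only [decide_eq_true_eq, Option.ite_none_right_eq_some, Option.some.injEq]
      constructor
      · rintro ⟨h, rfl⟩; exact ⟨m, rfl, h, rfl⟩
      · rintro ⟨_, rfl, h, rfl⟩; exact ⟨h, rfl⟩
  simp only [← hi]
  rw [hv]
  split_ifs with h
  · simp only [Option.some.injEq, funext_iff]
    refine forall_congr' fun i => ?_
    obtain ⟨b, hb⟩ := Option.isSome_iff_exists.1 (h i)
    simp [hb]
  · simp only [false_iff]
    exact fun h' => h fun i => by simp [h' i]

theorem probGenWith_val {Γ : TrilinearInstance} {n : ℕ} (pk : PublicKey Γ n) (sk : SecretKey Γ n)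
    (x : Fin n → ℕ) (r : Fin n → ZMod Γ.N) :
    (probGenWith pk sk x r).val = (fun j => Γ.g 0 ^ x j * pk.h ^ (r j).val,
      fun i => Γ.e₁₂ ((∏ j, sk.K.A j ^ x j) ^ (sk.K.α i).val *
        (∏ j, sk.K.B j ^ x j) ^ (sk.K.β i).val) (Γ.g 1 ^ Γ.p)) := rfl

/-- Of the `13 * n` operations, `ProbGen` spends `4 * n` on `σ`, `4 * n` on the two products and
`5 * n` on `τ`; `Verify` takes at most `7` for each entry. -/
theorem clientCostLE (𝒢 : TrilinearGenerator) (F : MatrixFamily 𝒢) : ClientCostLE 𝒢 F 13 := by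
  intro κ s pk sk
  refine ⟨fun x r => ?_, fun τ ρ π => ?_⟩
  · simp only [probGenWith, bind, pure, Counted.forEach, Counted.op, Counted.prod,
      Finset.sum_const, Finset.card_univ, Fintype.card_fin, smul_eq_mul]
    constructor <;> omega
  · have key : ∀ i, (do
        match (← decryptC (F.msgs κ) (ρ i)) with
        | none => pure none
        | some m => do
          let gp ← Counted.op ((𝒢.inst κ s).g 0 ^ (𝒢.inst κ s).p)
          let l ← Counted.op ((𝒢.inst κ s).e₂₁ (π i) gp)
          let t ← Counted.op (sk.η ^ ((𝒢.inst κ s).p * m))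
          let r ← Counted.op (t * τ i)
          let ok ← Counted.op (@decide (l = r) (Classical.propDecidable _))
          pure (if ok then some (m : ZMod (𝒢.inst κ s).q) else none) :
            Counted (Option (ZMod (𝒢.inst κ s).q))).ops ≤ 7 ∧ (do
        match (← decryptC (F.msgs κ) (ρ i)) with
        | none => pure none
        | some m => do
          let gp ← Counted.op ((𝒢.inst κ s).g 0 ^ (𝒢.inst κ s).p)
          let l ← Counted.op ((𝒢.inst κ s).e₂₁ (π i) gp)
          let t ← Counted.op (sk.η ^ ((𝒢.inst κ s).p * m))
          let r ← Counted.op (t * τ i)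
          let ok ← Counted.op (@decide (l = r) (Classical.propDecidable _))
          pure (if ok then some (m : ZMod (𝒢.inst κ s).q) else none) :
            Counted (Option (ZMod (𝒢.inst κ s).q))).trials ≤ (F.msgs κ).length := by
      intro i
      have h1 : (decryptC (F.msgs κ) (ρ i)).ops = 2 := rfl
      have h2 : (decryptC (F.msgs κ) (ρ i)).trials = (F.msgs κ).length := by
        simp [decryptC, bind, Counted.op, Counted.search]
      simp only [bind]
      cases (decryptC (F.msgs κ) (ρ i)).val <;>
        simp [h1, h2, Counted.op, pure]
    have h : ∀ {f : Fin (F.n κ) → ℕ} {c : ℕ}, (∀ i, f i ≤ c) → ∑ i, f i ≤ F.n κ * c :=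
      fun hf => (Finset.sum_le_card_nsmul _ _ _ fun i _ => hf i).trans_eq (by simp)
    constructor
    · exact (h fun i => (key i).1).trans (by omega)
    · exact h fun i => (key i).2

theorem natCast_sum_eq_evalFun (Γ : TrilinearInstance) {n : ℕ} (M : Matrix (Fin n) (Fin n) ℕ)
    (x : Fin n → ℕ) (i : Fin n) : ((∑ j, M i j * x j : ℕ) : ZMod Γ.q) = evalFun Γ M x i := by
  simp [evalFun, Matrix.mulVec, dotProduct]

theorem prod_F_pow {Γ : TrilinearInstance} {n : ℕ} (K : PRFKey Γ n) (x : Fin n → ℕ) (i : Fin n) :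
    (∏ j, K.A j ^ x j) ^ (K.α i).val * (∏ j, K.B j ^ x j) ^ (K.β i).val = ∏ j, K.F i j ^ x j := by
  rw [← Finset.prod_pow, ← Finset.prod_pow, ← Finset.prod_mul_distrib]
  refine Finset.prod_congr rfl fun j _ => ?_
  rw [PRFKey.F, mul_pow, pow_right_comm, pow_right_comm (K.B j)]

/-- The honest answer of the server passes the test of the client in `G₂`: raising to the power `p`
removes the blinding by the elements `h^(r_j)` of order `p`. -/
theorem honest_pow {Γ : TrilinearInstance} {n : ℕ} (u : Γ.G 0) (a : ℕ) (M x r : Fin n → ℕ)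
    (W : Fin n → Γ.G 0) :
    (∏ j, Γ.e₁₁ (Γ.g 0 ^ (Γ.p ^ 2 * a * M j) * W j) (Γ.g 0 ^ x j * (u ^ Γ.q) ^ r j)) ^ Γ.p
      = Γ.g 1 ^ (Γ.p ^ 3 * a * ∑ j, M j * x j) * Γ.e₁₁ (∏ j, W j ^ x j) (Γ.g 0) ^ Γ.p := by
  have hh : ∀ j, (Γ.g 0 ^ x j * (u ^ Γ.q) ^ r j) ^ Γ.p = Γ.g 0 ^ (Γ.p * x j) := by
    intro j
    have : ((u ^ Γ.q) ^ r j) ^ Γ.p = 1 := by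
      rw [← pow_mul, ← pow_mul, show Γ.q * (r j * Γ.p) = Γ.N * r j by
        rw [TrilinearInstance.N]; ring, pow_mul, Γ.pow_N, one_pow]
    rw [mul_pow, this, mul_one, ← pow_mul, mul_comm]
  rw [Finset.mul_sum, ← Finset.prod_pow_eq_pow_sum, TrilinearInstance.e₁₁,
    TrilinearInstance.e_prod_left, ← Finset.prod_pow, ← Finset.prod_pow, ← Finset.prod_mul_distrib]
  refine Finset.prod_congr rfl fun j _ => ?_
  rw [← TrilinearInstance.e_pow_right, hh, TrilinearInstance.e_mul_left, Γ.e_pow,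
    TrilinearInstance.e_pow_left, TrilinearInstance.e_pow_right, ← pow_mul, mul_comm (x j)]
  congr 2
  ring

theorem mem_support_keyGen {Γ : TrilinearInstance} {n : ℕ} {M : Matrix (Fin n) (Fin n) ℕ}
    {key : PublicKey Γ n × SecretKey Γ n} (h : key ∈ (keyGen Γ M).support) :
    ∃ (K : PRFKey Γ n) (a : ZMod Γ.N) (u : Γ.G 0),
      key = (⟨u ^ Γ.q, M, fun i j => Γ.g 0 ^ (Γ.p ^ 2 * a.val * M i j) * K.F i j⟩,
        ⟨K, a, Γ.g 2 ^ (Γ.p ^ 2 * a.val)⟩) := by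
  simp only [keyGen, bind, pure, PMF.mem_support_bind_iff, PMF.mem_support_pure_iff] at h
  obtain ⟨α, -, β, -, A, -, B, -, a, -, u, -, rfl⟩ := h
  exact ⟨_, _, _, rfl⟩

theorem verifyC_honest {Γ : TrilinearInstance} {n : ℕ} (msgs : List ℕ) (K : PRFKey Γ n)
    (a : ZMod Γ.N) (u : Γ.G 0) (M : Matrix (Fin n) (Fin n) ℕ) (x : Fin n → ℕ) (r : Fin n → ℕ)
    (i : Fin n) (hm : ∃ m ∈ msgs, (m : ZMod Γ.q) = evalFun Γ M x i) :
    ∃ m, (decryptC msgs (∏ j, (Γ.g 0 ^ x j * (u ^ Γ.q) ^ r j) ^ M i j)).val = some m ∧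
      Γ.e₂₁ (∏ j, Γ.e₁₁ (Γ.g 0 ^ (Γ.p ^ 2 * a.val * M i j) * K.F i j)
        (Γ.g 0 ^ x j * (u ^ Γ.q) ^ r j)) (Γ.g 0 ^ Γ.p) = (Γ.g 2 ^ (Γ.p ^ 2 * a.val)) ^ (Γ.p * m) *
          Γ.e₁₂ (∏ j, K.F i j ^ x j) (Γ.g 1 ^ Γ.p) ∧ evalFun Γ M x i = m := by
  obtain ⟨m₀, hm₀, hm₀'⟩ := hm
  rw [← natCast_sum_eq_evalFun] at hm₀' ⊢
  have hρ : (∏ j, (Γ.g 0 ^ x j * (u ^ Γ.q) ^ r j) ^ M i j) ^ Γ.p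
      = (Γ.g 0 ^ Γ.p) ^ ∑ j, M i j * x j := by
    rw [← Finset.prod_pow, ← Finset.prod_pow_eq_pow_sum]
    refine Finset.prod_congr rfl fun j _ => ?_
    have : (((u ^ Γ.q) ^ r j) ^ M i j) ^ Γ.p = 1 := by
      rw [← pow_mul, ← pow_mul, ← pow_mul,
        show Γ.q * (r j * (M i j * Γ.p)) = Γ.N * (r j * M i j) by
          rw [TrilinearInstance.N]; ring, pow_mul, Γ.pow_N, one_pow]
    rw [mul_pow, mul_pow, this, mul_one, ← pow_mul, ← pow_mul, ← pow_mul]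
    congr 1; ring
  rw [decryptC_val, hρ]
  cases hf : msgs.find? fun m => @decide
      ((Γ.g 0 ^ Γ.p) ^ ∑ j, M i j * x j = (Γ.g 0 ^ Γ.p) ^ m) (Classical.propDecidable _) with
  | none =>
    have := List.find?_eq_none.1 hf m₀ hm₀
    simp only [decide_eq_true_eq] at this
    exact absurd (Γ.g_pow_p_eq_iff.2 hm₀'.symm) this
  | some m =>
    have hm := List.find?_some hf
    simp only [decide_eq_true_eq] at hm
    have hmq := Γ.g_pow_p_eq_iff.1 hm
    refine ⟨m, rfl, ?_, hmq⟩
    rw [Γ.check_iff, honest_pow]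
    congr 1
    have he : ∀ k : ℕ, Γ.g 1 ^ (Γ.p ^ 3 * a.val * k)
        = (Γ.g 1 ^ Γ.p) ^ (k * (Γ.p ^ 2 * a.val)) := fun k => by
      rw [← pow_mul]; congr 1; ring
    rw [he, he, Γ.g_pow_p_eq_iff, Nat.cast_mul, hmq, ← Nat.cast_mul]

theorem isCorrect (𝒢 : TrilinearGenerator) (F : MatrixFamily 𝒢) : IsCorrect 𝒢 F := by
  intro κ s hs key hkey x hx o ho
  obtain ⟨K, a, u, rfl⟩ := mem_support_keyGen hkey
  simp only [probGen, bind, pure, PMF.mem_support_bind_iff, PMF.mem_support_pure_iff] at ho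
  obtain ⟨r, -, rfl⟩ := ho
  rw [verifyC_val_eq_some_iff]
  intro i
  simp only [probGenWith_val, prod_F_pow]
  exact verifyC_honest (F.msgs κ) K a u (F.M κ) x (fun j => (r j).val) i (F.result_mem κ s hs x hx i)

/-! ### Generators of the source group -/

namespace TrilinearInstance

variable (Γ : TrilinearInstance)

/-- The elements of a group of the instance that generate it. -/
def gens (i : Fin 3) : Finset (Γ.G i) := Finset.univ.filter fun x => orderOf x = Γ.N

theorem mem_gens {i : Fin 3} {x : Γ.G i} : x ∈ Γ.gens i ↔ orderOf x = Γ.N := by simp [gens]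

theorem isCyclic (i : Fin 3) : IsCyclic (Γ.G i) := ⟨⟨Γ.g i, Γ.g_gen i⟩⟩

/-- All but a fraction of at most `1 / p + 1 / q` of the elements are generators. -/
theorem card_compl_gens_div_le (i : Fin 3) [DecidableEq (Γ.G i)] :
    (((Γ.gens i)ᶜ.card : ℕ) : ℝ) / Fintype.card (Γ.G i) ≤ 1 / Γ.p + 1 / Γ.q := by
  have := Γ.isCyclic i
  have h1 : (Γ.gens i).card = (Γ.p - 1) * (Γ.q - 1) := by
    rw [gens, IsCyclic.card_orderOf_eq_totient (by rw [Γ.card_G']), N,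
      Nat.totient_mul ((Nat.coprime_primes Γ.prime_p Γ.prime_q).2 Γ.p_ne_q),
      Nat.totient_prime Γ.prime_p, Nat.totient_prime Γ.prime_q]
  have hp := Γ.prime_p.pos
  have hq := Γ.prime_q.pos
  rw [Finset.card_compl, h1, Γ.card_G]
  have h2 : Γ.p * Γ.q - (Γ.p - 1) * (Γ.q - 1) ≤ Γ.p + Γ.q := by
    obtain ⟨a, ha⟩ : ∃ a, Γ.p = a + 1 := ⟨Γ.p - 1, by omega⟩
    obtain ⟨b, hb⟩ : ∃ b, Γ.q = b + 1 := ⟨Γ.q - 1, by omega⟩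
    rw [ha, hb]
    simp only [Nat.add_sub_cancel]
    have : (a + 1) * (b + 1) = a * b + a + b + 1 := by ring
    omega
  have hp' : (0 : ℝ) < Γ.p := by exact_mod_cast hp
  have hq' : (0 : ℝ) < Γ.q := by exact_mod_cast hq
  rw [show (1 : ℝ) / Γ.p + 1 / Γ.q = (Γ.p + Γ.q) / (Γ.p * Γ.q : ℕ) by
    push_cast; field_simp; ring]
  gcongr
  exact_mod_cast h2

theorem bijective_pow_val {i : Fin 3} {x : Γ.G i} (h : x ∈ Γ.gens i) :
    Function.Bijective fun a : ZMod Γ.N => x ^ a.val := by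
  rw [mem_gens] at h
  refine (Fintype.bijective_iff_injective_and_card _).2 ⟨fun a b hab => ?_, by
    rw [ZMod.card, Γ.card_G']⟩
  refine ZMod.val_injective _ (pow_injOn_Iio_orderOf (x := x) ?_ ?_ hab) <;>
    simp [h, ZMod.val_lt]

theorem g_mem_gens (i : Fin 3) : Γ.g i ∈ Γ.gens i := Γ.mem_gens.2 (Γ.orderOf_g i)

instance (i : Fin 3) : Nonempty (Γ.G i) := ⟨1⟩

theorem decodes_G (i : Fin 3) :
    Decodes Γ.N (PMF.uniformOfFintype (Γ.G i)) fun R => Γ.g i ^ R := by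
  have h := congrArg (PMF.map fun a : ZMod Γ.N => Γ.g i ^ a.val) (decodes_zmod Γ.N)
  rw [uniform_map_bijective (Γ.bijective_pow_val (Γ.g_mem_gens i)), PMF.map_comp] at h
  rw [Decodes, ← h]
  congr 1
  funext R
  simp only [Function.comp, ZMod.val_natCast]
  rw [← Γ.orderOf_g i, pow_mod_orderOf]

end TrilinearInstance

/-! ### Negligible functions -/

namespace Negligible

theorem add {f g : ℕ → ℝ} (hf : Negligible f) (hg : Negligible g) :
    Negligible fun κ => f κ + g κ := Asymptotics.SuperpolynomialDecay.add hf hg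

theorem polynomial_mul {f : ℕ → ℝ} (hf : Negligible f) (P : Polynomial ℕ) :
    Negligible fun κ => ((P.eval κ : ℕ) : ℝ) * f κ := by
  have := Asymptotics.SuperpolynomialDecay.polynomial_mul hf (P.map (Nat.castRingHom ℝ))
  refine this.congr fun κ => ?_
  simp [Polynomial.eval_natCast_map]

theorem const_mul {f : ℕ → ℝ} (hf : Negligible f) (c : ℝ) : Negligible fun κ => c * f κ :=
  Asymptotics.SuperpolynomialDecay.const_mul hf c

theorem of_abs_le {f g : ℕ → ℝ} (hg : Negligible g) (h : ∀ κ, 2 ≤ κ → |f κ| ≤ g κ) :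
    Negligible f := by
  refine Asymptotics.SuperpolynomialDecay.trans_eventually_abs_le hg ?_
  filter_upwards [Filter.eventually_ge_atTop 2] with κ hκ
  exact (h κ hκ).trans (le_abs_self _)

theorem half_pow : Negligible fun κ => (1 / 2 : ℝ) ^ κ := by
  intro k
  have := tendsto_pow_const_div_const_pow_of_one_lt k (one_lt_two : (1 : ℝ) < 2)
  refine this.congr fun κ => ?_
  simp [div_eq_mul_inv]

end Negligible

/-! ### Programs for the operations of the scheme -/

theorem PT.exists_ppt {f : Val → Val} (hf : PT f) (C : Polynomial ℕ) :
    ∃ D : PPT, D.coins = C ∧ ∀ κ ω x, D.run κ ω x = f (Val.list [Val.unary κ, .num ω, x]) := by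
  obtain ⟨P, hP, h⟩ := hf
  exact ⟨⟨P, hP, C⟩, rfl, fun κ ω x => h _⟩

/-- A program with numerical output `f`, run on uniform coins, samples the experiment `E` up to an
error of `2^(-κ)` if it does so exactly for coins that are uniform below multiples of `K`. -/
theorem exists_ppt_of_sim {f : Val → ℕ} (hf : PTN f) (C : Polynomial ℕ) :
    ∃ D : PPT, ∀ (κ : ℕ) (X : Val) (K : ℕ) (E : PMF Bool) (g : ℕ → Bool), 0 < K →
      K * 2 ^ κ ≤ 2 ^ C.eval κ → Sim K E g →
      (∀ R < 2 ^ C.eval κ, f (Val.list [Val.unary κ, .num R, X]) = 1 ↔ g R = true) →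
      |prTrue ((D.coinDist κ).bind fun ω => PMF.pure (decide (D.run κ ω X = .num 1))) - prTrue E|
        ≤ (1 / 2) ^ κ := by
  obtain ⟨D, rfl, hD⟩ := PT.exists_ppt (PT.num hf) C
  refine ⟨D, fun κ X K E g hK hC hE hg => ?_⟩
  have hKC : K ≤ 2 ^ D.coins.eval κ := (Nat.le_mul_of_pos_right _ (by positivity)).trans hC
  have e : ((D.coinDist κ).bind fun ω => PMF.pure (decide (D.run κ ω X = .num 1)))
      = (unifNat (2 ^ D.coins.eval κ)).map g := by
    rw [unifNat_eq, PMF.map_comp, ← PMF.bind_pure_comp]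
    refine congrArg _ (funext fun ω => ?_)
    have := hg ω ω.2
    rw [hD]
    simp only [Function.comp, Val.num.injEq, this, Bool.decide_eq_true]
  rw [e]
  refine (hE.abs_prTrue_sub_le hK hKC).trans ?_
  have : (K : ℝ) * 2 ^ κ ≤ 2 ^ D.coins.eval κ := by exact_mod_cast hC
  rw [div_pow, one_pow, div_le_div_iff₀ (by positivity) (by positivity)]
  push_cast
  linarith

theorem size_two_pow_sub_one (κ : ℕ) : (2 ^ κ - 1).size = κ := by
  refine le_antisymm (Nat.size_le.2 (Nat.sub_lt (by positivity) one_pos)) ?_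
  cases κ with
  | zero => simp
  | succ κ =>
    rw [Nat.succ_le_iff, Nat.lt_size, pow_succ]
    have : 0 < 2 ^ κ := by positivity
    omega

/-- The number `κ` that is encoded by the datum `1^κ`. -/
def secpar (κu : Val) : ℕ := κu.size - 1

@[simp] theorem secpar_unary (κ : ℕ) : secpar (Val.unary κ) = κ := by
  simp [secpar, Val.unary, Val.size, size_two_pow_sub_one]

theorem PTS.secpar {κu : Val → Val} (h : PT κu) : PTS fun x => secpar (κu x) :=
  .sub (.size h) (.const 1)

namespace TrilinearGenerator

variable (𝒢 : TrilinearGenerator)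

/-- Multiplication in the group of index `i`, on encodings, from the public data `c`. -/
def gmul (i : Fin 3) (c a b : Val) : Val :=
  𝒢.mulAlg.choose.eval (Val.list [c, .num (i : ℕ), a, b])

/-- Exponentiation in the group of index `i`, on encodings, from the public data `c`. -/
def gpow (i : Fin 3) (c a : Val) (n : ℕ) : Val :=
  𝒢.powAlg.choose.eval (Val.list [c, .num (i : ℕ), a, .num n])

/-- The pairing `G₁ × G₁ → G₂`, on encodings, from the public data `c`. -/
def gpair (c a b : Val) : Val := 𝒢.pairAlg.choose.eval (Val.list [c, a, b])

@[fun_prop]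
theorem pt_gmul (i : Fin 3) {c a b : Val → Val} (hc : PT c) (ha : PT a) (hb : PT b) :
    PT fun x => 𝒢.gmul i (c x) (a x) (b x) :=
  PT.comp (.of_prog 𝒢.mulAlg.choose_spec.1) (by simp only [Val.list]; fun_prop)

@[fun_prop]
theorem pt_gpow (i : Fin 3) {c a : Val → Val} {n : Val → ℕ} (hc : PT c) (ha : PT a)
    (hn : PTN n) : PT fun x => 𝒢.gpow i (c x) (a x) (n x) :=
  PT.comp (.of_prog 𝒢.powAlg.choose_spec.1) (by simp only [Val.list]; fun_prop)

@[fun_prop]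
theorem pt_gpair {c a b : Val → Val} (hc : PT c) (ha : PT a) (hb : PT b) :
    PT fun x => 𝒢.gpair (c x) (a x) (b x) :=
  PT.comp (.of_prog 𝒢.pairAlg.choose_spec.1) (by simp only [Val.list]; fun_prop)

variable {κ : ℕ} (s : 𝒢.Seed κ)

@[simp]
theorem gmul_enc (i : Fin 3) (x y : (𝒢.inst κ s).G i) :
    𝒢.gmul i (𝒢.inst κ s).code ((𝒢.inst κ s).enc i x) ((𝒢.inst κ s).enc i y)
      = (𝒢.inst κ s).enc i (x * y) := 𝒢.mulAlg.choose_spec.2 κ s i x y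

@[simp]
theorem gpow_enc (i : Fin 3) (x : (𝒢.inst κ s).G i) (n : ℕ) :
    𝒢.gpow i (𝒢.inst κ s).code ((𝒢.inst κ s).enc i x) n = (𝒢.inst κ s).enc i (x ^ n) :=
  𝒢.powAlg.choose_spec.2 κ s i x n

@[simp]
theorem gpair_enc (x y : (𝒢.inst κ s).G 0) :
    𝒢.gpair (𝒢.inst κ s).code ((𝒢.inst κ s).enc 0 x) ((𝒢.inst κ s).enc 0 y)
      = (𝒢.inst κ s).enc 1 ((𝒢.inst κ s).e₁₁ x y) := 𝒢.pairAlg.choose_spec.2 κ s x y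

/-- A polynomial that bounds the length of the public data and of the encodings. -/
def lenPoly : Polynomial ℕ := 𝒢.length.choose

theorem size_enc_le (i : Fin 3) (x : (𝒢.inst κ s).G i) :
    ((𝒢.inst κ s).enc i x).size ≤ 𝒢.lenPoly.eval κ :=
  (𝒢.length.choose_spec κ s).2 i x

theorem N_lt (hκ : 2 ≤ κ) : (𝒢.inst κ s).N < 2 ^ (2 * κ) := by
  obtain ⟨hp, hq⟩ := 𝒢.bits κ hκ s
  rw [TrilinearInstance.N, two_mul, pow_add]
  exact Nat.mul_lt_mul'' (Nat.size_le.1 hp.le) (Nat.size_le.1 hq.le)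

theorem inv_p_add_inv_q_le (hκ : 2 ≤ κ) :
    1 / ((𝒢.inst κ s).p : ℝ) + 1 / ((𝒢.inst κ s).q : ℝ) ≤ 4 * (1 / 2) ^ κ := by
  obtain ⟨hp, hq⟩ := 𝒢.bits κ hκ s
  have key : ∀ m : ℕ, m.size = κ → 1 / (m : ℝ) ≤ 2 * (1 / 2) ^ κ := by
    intro m hm
    have h1 : 2 ^ (κ - 1) ≤ m := Nat.lt_size.1 (by omega)
    have h2 : (2 : ℝ) ^ κ ≤ 2 * m := by
      have : 2 ^ κ ≤ 2 * m := by
        calc 2 ^ κ = 2 * 2 ^ (κ - 1) := by rw [← pow_succ']; congr 1; omega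
          _ ≤ 2 * m := by omega
      exact_mod_cast this
    have h3 : (0 : ℝ) < 2 ^ κ := by positivity
    have h4 : (0 : ℝ) < m := by linarith
    rw [div_pow, one_pow, mul_one_div, div_le_div_iff₀ h4 h3]
    linarith
  have := key _ hp
  have := key _ hq
  linarith

@[simp] theorem _root_.MatVC.TrilinearInstance.code_nth_one (Γ : TrilinearInstance) :
    Γ.code.nth 1 = .num Γ.N := rfl

@[simp] theorem _root_.MatVC.TrilinearInstance.code_nth_two (Γ : TrilinearInstance) :
    Γ.code.nth 2 = Γ.enc 0 (Γ.g 0) := rfl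

@[simp] theorem _root_.MatVC.TrilinearInstance.code_nth_three (Γ : TrilinearInstance) :
    Γ.code.nth 3 = Γ.enc 1 (Γ.g 1) := rfl

/-- The product of `k` elements of `G₁`, on encodings; intermediate results are truncated at length
`B`, which keeps the program polynomial-time on data that encode no elements. -/
def gprod (B k : ℕ) (c : Val) (f : ℕ → Val) : Val :=
  cfold B k (fun i t => 𝒢.gmul 0 c t (f i)) (𝒢.gpow 0 c (c.nth 2) 0)

theorem pt_gprod {B k : Val → ℕ} {c : Val → Val} {f : Val → ℕ → Val} (hB : PTS B) (hk : PTS k)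
    (hc : PT c) (hf : PT fun z => f z.fst z.snd.toNat) :
    PT fun x => 𝒢.gprod (B x) (k x) (c x) (f x) := by
  refine PT.cfold hB hk (f := fun x i t => 𝒢.gmul 0 (c x) t (f x i)) ?_ (by fun_prop)
  exact 𝒢.pt_gmul 0 (by fun_prop) (by fun_prop)
    (PT.comp (g := fun z => .pair z.fst z.snd.fst) hf (by fun_prop))

theorem gprod_eq {n B : ℕ} {f : ℕ → Val} (y : Fin n → (𝒢.inst κ s).G 0)
    (hf : ∀ i : Fin n, f i = (𝒢.inst κ s).enc 0 (y i)) (hB : 𝒢.lenPoly.eval κ + n + 2 ≤ B) :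
    𝒢.gprod B n (𝒢.inst κ s).code f = (𝒢.inst κ s).enc 0 (∏ i, y i) := by
  let y' : ℕ → (𝒢.inst κ s).G 0 := fun i => if h : i < n then y ⟨i, h⟩ else 1
  have h := cfold_eq (B := B) (k := n) (f := fun i t => 𝒢.gmul 0 (𝒢.inst κ s).code t (f i))
    (fun i => (𝒢.inst κ s).enc 0 (∏ j ∈ Finset.range i, y' j)) (fun i hi => by
      simp only [Finset.prod_range_succ, ← gmul_enc, hf ⟨i, hi⟩, y', hi, dif_pos]) (fun i hi => by
      have := 𝒢.size_enc_le s 0 (∏ j ∈ Finset.range i, y' j)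
      omega)
  rw [gprod]
  simp only [TrilinearInstance.code_nth_two, gpow_enc, pow_zero]
  rw [Finset.prod_range_zero] at h
  rw [h, Finset.prod_range]
  simp [y']

end TrilinearGenerator

namespace MatrixFamily

variable {𝒢 : TrilinearGenerator} (F : MatrixFamily 𝒢)

/-- The data `n κ`, `M κ`, `msgs κ` of the family, from `1^κ`. -/
def gen (κu : Val) : Val := F.genAlg.choose.eval κu

/-- Membership in the domain, from `1^κ`: `1` if the datum encodes an element and `0` if not. -/
def mem (κu v : Val) : ℕ := (F.memAlg.choose.eval (Val.list [κu, v])).toNat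

/-- The dimension `n κ`, from `1^κ`.  The minimum keeps it small on inputs not of the form `1^κ`. -/
def dim (κu : Val) : ℕ := min (F.gen κu).fst.toNat (F.gen κu).size

@[fun_prop]
theorem pt_gen {κu : Val → Val} (h : PT κu) : PT fun x => F.gen (κu x) :=
  PT.comp (.of_prog F.genAlg.choose_spec.1) h

@[fun_prop]
theorem ptn_mem {κu v : Val → Val} (h : PT κu) (hv : PT v) : PTN fun x => F.mem (κu x) (v x) :=
  PTN.toNat (PT.comp (.of_prog F.memAlg.choose_spec.1) (by simp only [Val.list]; fun_prop))

theorem pts_dim {κu : Val → Val} (h : PT κu) : PTS fun x => F.dim (κu x) :=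
  .min_left (by fun_prop) (.size (by fun_prop))

@[fun_prop]
theorem ptn_dim {κu : Val → Val} (h : PT κu) : PTN fun x => F.dim (κu x) := (F.pts_dim h).ptn

theorem gen_unary (κ : ℕ) : F.gen (Val.unary κ) = Val.list [.num (F.n κ),
    Val.vec fun i => Val.natVec fun j => F.M κ i j, Val.list ((F.msgs κ).map .num)] :=
  F.genAlg.choose_spec.2 κ

theorem exists_size_gen_le : ∃ P : Polynomial ℕ, ∀ κ, (F.gen (Val.unary κ)).size ≤ P.eval κ := by
  obtain ⟨P, hP⟩ := PT.polyBdd_size (F.pt_gen PT.id)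
  refine ⟨P.comp (Polynomial.X + 1), fun κ => (hP _).trans_eq ?_⟩
  simp [Val.unary, Val.size, size_two_pow_sub_one]

/-- A polynomial that bounds the size of the family. -/
def sizePoly : Polynomial ℕ := F.exists_size_gen_le.choose

theorem size_gen_le (κ : ℕ) : (F.gen (Val.unary κ)).size ≤ F.sizePoly.eval κ :=
  F.exists_size_gen_le.choose_spec κ

theorem length_le_size_list (l : List Val) : l.length ≤ (Val.list l).size := by
  induction l with
  | nil => simp
  | cons a l ih =>
    simp only [List.length_cons, Val.list, Val.size]
    omega

theorem n_le_size_gen (κ : ℕ) : F.n κ ≤ (F.gen (Val.unary κ)).size := by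
  have := length_le_size_list (List.ofFn fun i => Val.natVec fun j => F.M κ i j)
  rw [List.length_ofFn] at this
  rw [gen_unary]
  simp only [Val.list, Val.size, Val.vec] at this ⊢
  omega

@[simp] theorem dim_unary (κ : ℕ) : F.dim (Val.unary κ) = F.n κ := by
  rw [dim, min_eq_left]
  · simp [gen_unary, Val.list]
  · have := F.n_le_size_gen κ
    simpa [gen_unary, Val.list] using this

theorem n_le (κ : ℕ) : F.n κ ≤ F.sizePoly.eval κ := (F.n_le_size_gen κ).trans (F.size_gen_le κ)

theorem natVec_injective (n : ℕ) : Function.Injective (Val.natVec : (Fin n → ℕ) → Val) := by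
  intro x y h
  funext i
  have := congrArg (fun v => (v.nth i).toNat) h
  simpa [Val.natVec] using this

theorem parse_eq_some_iff {α : Type} {enc : α → Val} (h : Function.Injective enc) {v : Val} {a : α} :
    parse enc v = some a ↔ enc a = v := by
  unfold parse
  split_ifs with h'
  · rw [Option.some.injEq]
    exact ⟨fun e => e ▸ h'.choose_spec, fun e => h (h'.choose_spec.trans e.symm)⟩
  · simp only [false_iff]
    exact fun e => h' ⟨a, e⟩

theorem input_eq_some_iff {κ : ℕ} {v : Val} {x : F.D κ} :
    F.input κ v = some x ↔ Val.natVec x.1 = v :=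
  parse_eq_some_iff fun _ _ h => Subtype.ext (natVec_injective _ h)

theorem mem_of_input_eq_some {κ : ℕ} {v : Val} {x : F.D κ} (h : F.input κ v = some x) :
    F.mem (Val.unary κ) v = 1 := by
  rw [mem, (F.memAlg.choose_spec.2 κ v).1 ⟨x.1, x.2, F.input_eq_some_iff.1 h⟩, Val.toNat_num]

theorem mem_of_input_eq_none {κ : ℕ} {v : Val} (h : F.input κ v = none) :
    F.mem (Val.unary κ) v = 0 := by
  rw [mem, (F.memAlg.choose_spec.2 κ v).2, Val.toNat_num]
  rintro ⟨x, hx, e⟩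
  have := (F.input_eq_some_iff (x := ⟨x, hx⟩)).2 e
  simp [h] at this

/-- `N^n` for the group order `N` in the public data `c`: the number of vectors of exponents. -/
def vecCard (κu c : Val) : ℕ := (c.nth 1).toNat ^ F.dim κu

/-- `N^(n^2)`: the number of matrices of exponents. -/
def matCard (κu c : Val) : ℕ := F.vecCard κu c ^ F.dim κu

/-- `2^(P κ)`, from `1^κ`: the number of coin strings of length `P κ`. -/
def _root_.MatVC.coinCard (P : Polynomial ℕ) (κu : Val) : ℕ := 2 ^ P.eval (secpar κu)

@[fun_prop]
theorem _root_.MatVC.PTN.coinCard (P : Polynomial ℕ) {κu : Val → Val} (h : PT κu) :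
    PTN fun x => coinCard P (κu x) := .pow (.const 2) ((PTS.secpar h).polynomial P)

@[simp] theorem _root_.MatVC.coinCard_unary (P : Polynomial ℕ) (κ : ℕ) :
    coinCard P (Val.unary κ) = 2 ^ P.eval κ := by simp [coinCard]

/-- The exponent of index `j` in a number that encodes a vector of exponents. -/
def digit (κu c : Val) (R j : ℕ) : ℕ :=
  R / (c.nth 1).toNat ^ min j (F.dim κu) % (c.nth 1).toNat

/-- The row of index `i` in a number that encodes a matrix of exponents. -/
def rowDigit (κu c : Val) (R i : ℕ) : ℕ :=
  R / F.vecCard κu c ^ min i (F.dim κu) % F.vecCard κu c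

section

variable {κu c : Val → Val} {R j : Val → ℕ}

@[fun_prop]
theorem ptn_vecCard (h : PT κu) (hc : PT c) : PTN fun x => F.vecCard (κu x) (c x) :=
  .pow (by fun_prop) (F.pts_dim h)

@[fun_prop]
theorem ptn_matCard (h : PT κu) (hc : PT c) : PTN fun x => F.matCard (κu x) (c x) :=
  .pow (by fun_prop) (F.pts_dim h)

@[fun_prop]
theorem ptn_digit (h : PT κu) (hc : PT c) (hR : PTN R) (hj : PTN j) :
    PTN fun x => F.digit (κu x) (c x) (R x) (j x) := by
  have := PTN.pow (b := fun x => ((c x).nth 1).toNat) (by fun_prop) (.min_left hj (F.pts_dim h))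
  unfold digit
  fun_prop

@[fun_prop]
theorem ptn_rowDigit (h : PT κu) (hc : PT c) (hR : PTN R) (hj : PTN j) :
    PTN fun x => F.rowDigit (κu x) (c x) (R x) (j x) := by
  have := PTN.pow (F.ptn_vecCard h hc) (.min_left hj (F.pts_dim h))
  unfold rowDigit
  fun_prop

end

variable {κ : ℕ} (s : 𝒢.Seed κ)

theorem N_pow_le (hκ : 2 ≤ κ) :
    (𝒢.inst κ s).N ^ F.n κ ≤ 2 ^ (2 * κ * F.sizePoly.eval κ) := by
  rw [pow_mul]
  exact (Nat.pow_le_pow_left (𝒢.N_lt s hκ).le _).trans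
    (Nat.pow_le_pow_right (by positivity) (F.n_le κ))

@[simp] theorem vecCard_code :
    F.vecCard (Val.unary κ) (𝒢.inst κ s).code = (𝒢.inst κ s).N ^ F.n κ := by simp [vecCard]

@[simp] theorem matCard_code :
    F.matCard (Val.unary κ) (𝒢.inst κ s).code = ((𝒢.inst κ s).N ^ F.n κ) ^ F.n κ := by
  simp [matCard]

@[simp] theorem digit_code (R : ℕ) (j : Fin (F.n κ)) :
    F.digit (Val.unary κ) (𝒢.inst κ s).code R j
      = R / (𝒢.inst κ s).N ^ (j : ℕ) % (𝒢.inst κ s).N := by simp [digit]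

@[simp] theorem rowDigit_code (R : ℕ) (j : Fin (F.n κ)) :
    F.rowDigit (Val.unary κ) (𝒢.inst κ s).code R j
      = R / ((𝒢.inst κ s).N ^ F.n κ) ^ (j : ℕ) % (𝒢.inst κ s).N ^ F.n κ := by simp [rowDigit]

end MatrixFamily

/-! ### Pseudorandomness of the matrix of blinding factors -/

theorem uniform_bind_update {β γ : Type} [Fintype β] [Nonempty β] {n : ℕ} (i : Fin n)
    (k : (Fin n → β) → PMF γ) :
    ((PMF.uniformOfFintype β).bind fun b => (PMF.uniformOfFintype (Fin n → β)).bind fun f =>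
      k (Function.update f i b)) = (PMF.uniformOfFintype (Fin n → β)).bind k := by
  have h : ∀ k' : (Fin n → β) → PMF γ, (PMF.uniformOfFintype (Fin n → β)).bind k' =
      (PMF.uniformOfFintype β).bind fun b =>
        (PMF.uniformOfFintype ({j // j ≠ i} → β)).bind fun g =>
          k' ((Equiv.funSplitAt i β).symm (b, g)) := by
    intro k'
    rw [← uniform_bind_bijective (Equiv.funSplitAt i β).symm.bijective, ← uniform_prod,
      PMF.bind_bind]
    refine congrArg _ (funext fun b => ?_)
    rw [PMF.bind_map]
    rfl
  rw [h k]
  refine congrArg _ (funext fun b => ?_)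
  rw [h fun f => k (Function.update f i b)]
  have e : ∀ b' g, Function.update ((Equiv.funSplitAt i β).symm (b', g)) i b
      = (Equiv.funSplitAt i β).symm (b, g) := by
    intro b' g
    funext j
    by_cases hj : j = i
    · subst hj; simp
    · simp [hj]
  simp only [e, PMF.bind_const]

section

variable {Γ : TrilinearInstance} {n : ℕ}

/-- The `k`-th hybrid between a pseudorandom and a random matrix: the rows of index below `k` are
those of `W`, the others are given by `A_j^(α_i) * B_j^(β_i)`. -/
def hybrid (k : ℕ) (W : Fin n → Fin n → Γ.G 0) (α β : Fin n → ZMod Γ.N) (A B : Fin n → Γ.G 0) :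
    Fin n → Fin n → Γ.G 0 :=
  fun i j => if (i : ℕ) < k then W i j else A j ^ (α i).val * B j ^ (β i).val

/-- The matrix that agrees with the `k`-th hybrid except in the row of index `k`, which is `R`. -/
def hybridRow (k : ℕ) (W : Fin n → Fin n → Γ.G 0) (α β : Fin n → ZMod Γ.N) (A B R : Fin n → Γ.G 0) :
    Fin n → Fin n → Γ.G 0 :=
  fun i j => if (i : ℕ) < k then W i j else if k < (i : ℕ) then
    A j ^ (α i).val * B j ^ (β i).val else R j

theorem hybridRow_prf (k : Fin n) (W : Fin n → Fin n → Γ.G 0) (α β : Fin n → ZMod Γ.N)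
    (A B : Fin n → Γ.G 0) (a b : ZMod Γ.N) :
    hybridRow k W α β A B (fun j => A j ^ a.val * B j ^ b.val)
      = hybrid k W (Function.update α k a) (Function.update β k b) A B := by
  funext i j
  unfold hybridRow hybrid
  rcases lt_trichotomy i k with h | rfl | h
  · rw [if_pos (by exact_mod_cast h), if_pos (by exact_mod_cast h)]
  · simp
  · have h' : ¬ (i : ℕ) < k := by have : (k : ℕ) < i := h; omega
    rw [if_neg h', if_pos (by exact_mod_cast h), if_neg h', Function.update_of_ne h.ne',
      Function.update_of_ne h.ne']

theorem hybridRow_random (k : Fin n) (W : Fin n → Fin n → Γ.G 0) (α β : Fin n → ZMod Γ.N)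
    (A B R : Fin n → Γ.G 0) :
    hybridRow k W α β A B R = hybrid (k + 1) (Function.update W k R) α β A B := by
  funext i j
  unfold hybridRow hybrid
  rcases lt_trichotomy i k with h | rfl | h
  · have h' : (i : ℕ) < k := h
    rw [if_pos h', if_pos (by omega), Function.update_of_ne h.ne]
  · simp
  · have h' : (k : ℕ) < i := h
    rw [if_neg (by omega), if_pos h', if_neg (by omega)]

/-- A uniform choice of all the ingredients of the `k`-th hybrid, passed on to `f`. -/
def hybridExp (f : (Fin n → Fin n → Γ.G 0) → PMF Bool) (k : ℕ) : PMF Bool :=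
  (PMF.uniformOfFintype (Fin n → Fin n → Γ.G 0)).bind fun W =>
  (PMF.uniformOfFintype (Fin n → ZMod Γ.N)).bind fun α =>
  (PMF.uniformOfFintype (Fin n → ZMod Γ.N)).bind fun β =>
  (PMF.uniformOfFintype (Fin n → Γ.G 0)).bind fun A =>
  (PMF.uniformOfFintype (Fin n → Γ.G 0)).bind fun B => f (hybrid k W α β A B)

/-- The matrix that the reduction to the decision linear assumption builds from a challenge
`(u, v, w, U, V, Z)` in the step from the `k`-th hybrid to the next, passed on to `f`. -/
def dlinHybridExp (f : (Fin n → Fin n → Γ.G 0) → PMF Bool) (u v w U V Z : Γ.G 0) (k : ℕ) :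
    PMF Bool :=
  (PMF.uniformOfFintype (Fin n → Fin n → Γ.G 0)).bind fun W =>
  (PMF.uniformOfFintype (Fin n → ZMod Γ.N)).bind fun α =>
  (PMF.uniformOfFintype (Fin n → ZMod Γ.N)).bind fun β =>
  (PMF.uniformOfFintype (Fin n → ZMod Γ.N)).bind fun x =>
  (PMF.uniformOfFintype (Fin n → ZMod Γ.N)).bind fun y =>
  (PMF.uniformOfFintype (Fin n → ZMod Γ.N)).bind fun z =>
    f (hybridRow k W α β (fun j => u ^ (x j).val * w ^ (z j).val)
      (fun j => v ^ (y j).val * w ^ (z j).val)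
      fun j => U ^ (x j).val * V ^ (y j).val * Z ^ (z j).val)

theorem bijective_pow_mul {u : Γ.G 0} (hu : u ∈ Γ.gens 0) (t : Fin n → Γ.G 0) :
    Function.Bijective fun (x : Fin n → ZMod Γ.N) j => u ^ (x j).val * t j :=
  ((Equiv.arrowCongr (Equiv.refl (Fin n)) (Equiv.ofBijective _ (Γ.bijective_pow_val hu))).trans
    (Equiv.mulRight t)).bijective

/-- For generators `u` and `v` the vectors `A` and `B` built by the reduction are uniform and
independent of the exponents `z`. -/
theorem uniform_bind_xyz {u v : Γ.G 0} (hu : u ∈ Γ.gens 0) (hv : v ∈ Γ.gens 0) (w : Γ.G 0)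
    (f : (Fin n → Γ.G 0) → (Fin n → Γ.G 0) → (Fin n → ZMod Γ.N) → PMF Bool) :
    ((PMF.uniformOfFintype (Fin n → ZMod Γ.N)).bind fun x =>
      (PMF.uniformOfFintype (Fin n → ZMod Γ.N)).bind fun y =>
      (PMF.uniformOfFintype (Fin n → ZMod Γ.N)).bind fun z =>
        f (fun j => u ^ (x j).val * w ^ (z j).val) (fun j => v ^ (y j).val * w ^ (z j).val) z)
    = (PMF.uniformOfFintype (Fin n → Γ.G 0)).bind fun A =>
      (PMF.uniformOfFintype (Fin n → Γ.G 0)).bind fun B =>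
      (PMF.uniformOfFintype (Fin n → ZMod Γ.N)).bind fun z => f A B z := by
  have h1 : ∀ z : Fin n → ZMod Γ.N, ((PMF.uniformOfFintype (Fin n → ZMod Γ.N)).bind fun x =>
      (PMF.uniformOfFintype (Fin n → ZMod Γ.N)).bind fun y =>
        f (fun j => u ^ (x j).val * w ^ (z j).val) (fun j => v ^ (y j).val * w ^ (z j).val) z)
      = (PMF.uniformOfFintype (Fin n → Γ.G 0)).bind fun A =>
      (PMF.uniformOfFintype (Fin n → Γ.G 0)).bind fun B => f A B z := by
    intro z
    rw [← uniform_bind_bijective (bijective_pow_mul hu fun j => w ^ (z j).val)]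
    refine congrArg _ (funext fun x => ?_)
    rw [← uniform_bind_bijective (bijective_pow_mul hv fun j => w ^ (z j).val)]
  have h2 : ∀ {ι : Type} [Fintype ι] [Nonempty ι] (g : ι → ι → (Fin n → ZMod Γ.N) → PMF Bool),
      ((PMF.uniformOfFintype ι).bind fun x => (PMF.uniformOfFintype ι).bind fun y =>
        (PMF.uniformOfFintype (Fin n → ZMod Γ.N)).bind fun z => g x y z)
      = (PMF.uniformOfFintype (Fin n → ZMod Γ.N)).bind fun z =>
        (PMF.uniformOfFintype ι).bind fun x => (PMF.uniformOfFintype ι).bind fun y => g x y z := by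
    intro ι _ _ g
    rw [PMF.bind_comm (PMF.uniformOfFintype (Fin n → ZMod Γ.N))]
    refine congrArg _ (funext fun x => ?_)
    rw [PMF.bind_comm (PMF.uniformOfFintype (Fin n → ZMod Γ.N))]
  exact (h2 _).trans ((congrArg _ (funext h1)).trans (h2 _).symm)

/-- On a linear tuple the reduction produces the `k`-th hybrid. -/
theorem dlinHybridExp_real (f : (Fin n → Fin n → Γ.G 0) → PMF Bool) {u v : Γ.G 0}
    (hu : u ∈ Γ.gens 0) (hv : v ∈ Γ.gens 0) (w : Γ.G 0) (k : Fin n) :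
    ((PMF.uniformOfFintype (ZMod Γ.N)).bind fun a => (PMF.uniformOfFintype (ZMod Γ.N)).bind fun b =>
      dlinHybridExp f u v w (u ^ a.val) (v ^ b.val) (w ^ (a.val + b.val)) k) = hybridExp f k := by
  have h1 : ∀ a b : ZMod Γ.N,
      dlinHybridExp f u v w (u ^ a.val) (v ^ b.val) (w ^ (a.val + b.val)) k =
      (PMF.uniformOfFintype (Fin n → Fin n → Γ.G 0)).bind fun W =>
      (PMF.uniformOfFintype (Fin n → ZMod Γ.N)).bind fun α =>
      (PMF.uniformOfFintype (Fin n → ZMod Γ.N)).bind fun β =>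
      (PMF.uniformOfFintype (Fin n → Γ.G 0)).bind fun A =>
      (PMF.uniformOfFintype (Fin n → Γ.G 0)).bind fun B =>
        f (hybrid k W (Function.update α k a) (Function.update β k b) A B) := by
    intro a b
    unfold dlinHybridExp
    refine congrArg _ (funext fun W => congrArg _ (funext fun α => congrArg _ (funext fun β => ?_)))
    have := uniform_bind_xyz (n := n) hu hv w fun A B _ =>
      f (hybrid k W (Function.update α k a) (Function.update β k b) A B)
    simp only [PMF.bind_const] at this
    rw [← this]
    refine congrArg _ (funext fun x => congrArg _ (funext fun y => congrArg _ (funext fun z => ?_)))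
    rw [← hybridRow_prf]
    congr 2
    funext j
    simp only [mul_pow, ← pow_mul, pow_add, mul_comm a.val, mul_comm b.val]
    ac_rfl
  simp only [h1]
  unfold hybridExp
  -- the new exponents `a` and `b` take the places of those of index `k` in `α` and `β`
  have h2 : ∀ {ι : Type} (μ : PMF ι) (g : ZMod Γ.N → ZMod Γ.N → ι → PMF Bool),
      ((PMF.uniformOfFintype (ZMod Γ.N)).bind fun a =>
        (PMF.uniformOfFintype (ZMod Γ.N)).bind fun b => μ.bind fun W => g a b W)
      = μ.bind fun W => (PMF.uniformOfFintype (ZMod Γ.N)).bind fun a =>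
        (PMF.uniformOfFintype (ZMod Γ.N)).bind fun b => g a b W := by
    intro ι μ g
    rw [PMF.bind_comm μ]
    refine congrArg _ (funext fun x => ?_)
    rw [PMF.bind_comm μ]
  rw [h2]
  refine congrArg _ (funext fun W => ?_)
  rw [← uniform_bind_update k fun α => (PMF.uniformOfFintype (Fin n → ZMod Γ.N)).bind fun β => _]
  refine congrArg _ (funext fun a => ?_)
  rw [PMF.bind_comm (PMF.uniformOfFintype (ZMod Γ.N))]
  refine congrArg _ (funext fun α => ?_)
  rw [← uniform_bind_update k]

/-- On a random tuple the reduction produces the next hybrid. -/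
theorem dlinHybridExp_random (f : (Fin n → Fin n → Γ.G 0) → PMF Bool) {u v : Γ.G 0}
    (hu : u ∈ Γ.gens 0) (hv : v ∈ Γ.gens 0) (w : Γ.G 0) {θ : Γ.G 0} (hθ : θ ∈ Γ.gens 0)
    (a b : ℕ) (k : Fin n) :
    dlinHybridExp f u v w (u ^ a) (v ^ b) (θ * w ^ (a + b)) k = hybridExp f (k + 1) := by
  have h1 : dlinHybridExp f u v w (u ^ a) (v ^ b) (θ * w ^ (a + b)) k =
      (PMF.uniformOfFintype (Fin n → Fin n → Γ.G 0)).bind fun W =>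
      (PMF.uniformOfFintype (Fin n → ZMod Γ.N)).bind fun α =>
      (PMF.uniformOfFintype (Fin n → ZMod Γ.N)).bind fun β =>
      (PMF.uniformOfFintype (Fin n → Γ.G 0)).bind fun A =>
      (PMF.uniformOfFintype (Fin n → Γ.G 0)).bind fun B =>
      (PMF.uniformOfFintype (Fin n → Γ.G 0)).bind fun R =>
        f (hybrid (k + 1) (Function.update W k R) α β A B) := by
    unfold dlinHybridExp
    refine congrArg _ (funext fun W => congrArg _ (funext fun α => congrArg _ (funext fun β => ?_)))
    have := uniform_bind_xyz (n := n) hu hv w fun A B z =>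
      f (hybridRow k W α β A B fun j => θ ^ (z j).val * (A j ^ a * B j ^ b))
    refine Eq.trans ?_ (this.trans ?_)
    · refine congrArg _ (funext fun x => congrArg _ (funext fun y => congrArg _
        (funext fun z => ?_)))
      congr 2
      funext j
      simp only [mul_pow, ← pow_mul, pow_add, mul_comm a, mul_comm b]
      rw [mul_mul_mul_comm (u ^ _) (w ^ _), mul_left_comm]
    · refine congrArg _ (funext fun A => congrArg _ (funext fun B => ?_))
      rw [← uniform_bind_bijective (bijective_pow_mul hθ fun j => A j ^ a * B j ^ b)]
      simp only [hybridRow_random]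
  rw [h1]
  unfold hybridExp
  -- the row `R` takes the place of the row of index `k` of `W`
  have h2 : ∀ {ι₁ ι₂ ι₃ ι₄ : Type} (μ₁ : PMF ι₁) (μ₂ : PMF ι₂) (μ₃ : PMF ι₃) (μ₄ : PMF ι₄)
      (g : ι₁ → ι₂ → ι₃ → ι₄ → (Fin n → Γ.G 0) → PMF Bool),
      (μ₁.bind fun α => μ₂.bind fun β => μ₃.bind fun A => μ₄.bind fun B =>
        (PMF.uniformOfFintype (Fin n → Γ.G 0)).bind fun R => g α β A B R)
      = (PMF.uniformOfFintype (Fin n → Γ.G 0)).bind fun R =>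
        μ₁.bind fun α => μ₂.bind fun β => μ₃.bind fun A => μ₄.bind fun B => g α β A B R := by
    intro ι₁ ι₂ ι₃ ι₄ μ₁ μ₂ μ₃ μ₄ g
    rw [PMF.bind_comm (PMF.uniformOfFintype (Fin n → Γ.G 0))]
    refine congrArg _ (funext fun _ => ?_)
    rw [PMF.bind_comm (PMF.uniformOfFintype (Fin n → Γ.G 0))]
    refine congrArg _ (funext fun _ => ?_)
    rw [PMF.bind_comm (PMF.uniformOfFintype (Fin n → Γ.G 0))]
    refine congrArg _ (funext fun _ => ?_)
    rw [PMF.bind_comm (PMF.uniformOfFintype (Fin n → Γ.G 0))]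
  refine (congrArg _ (funext fun W => h2 _ _ _ _ _)).trans ?_
  rw [PMF.bind_comm]
  exact uniform_bind_update k fun W : Fin n → Fin n → Γ.G 0 =>
    (PMF.uniformOfFintype (Fin n → ZMod Γ.N)).bind fun α =>
    (PMF.uniformOfFintype (Fin n → ZMod Γ.N)).bind fun β =>
    (PMF.uniformOfFintype (Fin n → Γ.G 0)).bind fun A =>
    (PMF.uniformOfFintype (Fin n → Γ.G 0)).bind fun B => f (hybrid (k + 1) W α β A B)

/-- The quality of the simulation of the `k`-th hybrid, for all linear tuples together. -/
theorem abs_dlinHybrid_real_sub_le (f : (Fin n → Fin n → Γ.G 0) → PMF Bool) (k : Fin n) {ε : ℝ}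
    (hε : 1 / (Γ.p : ℝ) + 1 / (Γ.q : ℝ) ≤ ε) :
    |prTrue ((PMF.uniformOfFintype (Γ.G 0)).bind fun u => (PMF.uniformOfFintype (Γ.G 0)).bind fun v =>
      (PMF.uniformOfFintype (Γ.G 0)).bind fun w => (PMF.uniformOfFintype (ZMod Γ.N)).bind fun a =>
      (PMF.uniformOfFintype (ZMod Γ.N)).bind fun b => (PMF.uniformOfFintype (ZMod Γ.N)).bind fun _ =>
        dlinHybridExp f u v w (u ^ a.val) (v ^ b.val) (w ^ (a.val + b.val)) k)
      - prTrue (hybridExp f k)| ≤ 4 * ε := by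
  classical
  have h0 : 0 ≤ ε := le_trans (by positivity) hε
  have hbad := (Γ.card_compl_gens_div_le 0).trans hε
  simp only [PMF.bind_const]
  rw [← PMF.bind_const (PMF.uniformOfFintype (Γ.G 0)) (hybridExp f k)]
  refine (abs_prTrue_uniform_bind_sub_le (δ := ε) h0 _ hbad fun u hu => ?_).trans (by linarith)
  rw [← PMF.bind_const (PMF.uniformOfFintype (Γ.G 0)) (hybridExp f k)]
  refine (abs_prTrue_uniform_bind_sub_le le_rfl _ hbad fun v hv => ?_).trans (by linarith)
  simp only [Finset.mem_compl, not_not] at hu hv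
  simp only [dlinHybridExp_real f hu hv, PMF.bind_const]
  simp

/-- The quality of the simulation of the next hybrid, for all random tuples together. -/
theorem abs_dlinHybrid_random_sub_le (f : (Fin n → Fin n → Γ.G 0) → PMF Bool) (k : Fin n) {ε : ℝ}
    (hε : 1 / (Γ.p : ℝ) + 1 / (Γ.q : ℝ) ≤ ε) :
    |prTrue ((PMF.uniformOfFintype (Γ.G 0)).bind fun u => (PMF.uniformOfFintype (Γ.G 0)).bind fun v =>
      (PMF.uniformOfFintype (Γ.G 0)).bind fun w => (PMF.uniformOfFintype (ZMod Γ.N)).bind fun a =>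
      (PMF.uniformOfFintype (ZMod Γ.N)).bind fun b => (PMF.uniformOfFintype (ZMod Γ.N)).bind fun c =>
        dlinHybridExp f u v w (u ^ a.val) (v ^ b.val) (w ^ c.val) k)
      - prTrue (hybridExp f (k + 1))| ≤ 4 * ε := by
  classical
  have h0 : 0 ≤ ε := le_trans (by positivity) hε
  have hbad := (Γ.card_compl_gens_div_le 0).trans hε
  rw [← PMF.bind_const (PMF.uniformOfFintype (Γ.G 0)) (hybridExp f _)]
  refine (abs_prTrue_uniform_bind_sub_le (δ := 3 * ε) (by linarith) _ hbad fun u hu => ?_).trans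
    (by linarith)
  rw [← PMF.bind_const (PMF.uniformOfFintype (Γ.G 0)) (hybridExp f _)]
  refine (abs_prTrue_uniform_bind_sub_le (δ := 2 * ε) (by linarith) _ hbad fun v hv => ?_).trans
    (by linarith)
  rw [← PMF.bind_const (PMF.uniformOfFintype (Γ.G 0)) (hybridExp f _)]
  refine (abs_prTrue_uniform_bind_sub_le (δ := ε) h0 _ hbad fun w hw => ?_).trans (by linarith)
  simp only [Finset.mem_compl, not_not] at hu hv hw
  rw [← PMF.bind_const (PMF.uniformOfFintype (ZMod Γ.N)) (hybridExp f _)]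
  refine abs_prTrue_bind_sub_le _ fun a => ?_
  rw [← PMF.bind_const (PMF.uniformOfFintype (ZMod Γ.N)) (hybridExp f _)]
  refine abs_prTrue_bind_sub_le _ fun b => ?_
  -- `w^c = θ * w^(a+b)` for a uniform `θ`
  have e : ((PMF.uniformOfFintype (ZMod Γ.N)).bind fun c =>
      dlinHybridExp f u v w (u ^ a.val) (v ^ b.val) (w ^ c.val) k)
      = (PMF.uniformOfFintype (Γ.G 0)).bind fun θ =>
        dlinHybridExp f u v w (u ^ a.val) (v ^ b.val) (θ * w ^ (a.val + b.val)) k := by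
    rw [uniform_bind_bijective (Γ.bijective_pow_val hw) fun Z =>
      dlinHybridExp f u v w (u ^ a.val) (v ^ b.val) Z k]
    exact (uniform_bind_bijective (Group.mulRight_bijective (w ^ (a.val + b.val))) fun Z =>
      dlinHybridExp f u v w (u ^ a.val) (v ^ b.val) Z k).symm
  rw [e, ← PMF.bind_const (PMF.uniformOfFintype (Γ.G 0)) (hybridExp f _)]
  refine (abs_prTrue_uniform_bind_sub_le le_rfl _ hbad fun θ hθ => ?_).trans
    (by linarith : ε + 0 ≤ ε)
  simp only [Finset.mem_compl, not_not] at hθ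
  rw [dlinHybridExp_random f hu hv w hθ]
  simp

end

/-! ### The reduction to the decision linear assumption -/

/-- The output bit of `A` on input `X`. -/
def PPT.bit (A : PPT) (κ : ℕ) (X : Val) : PMF Bool :=
  (A.coinDist κ).bind fun ω => PMF.pure (decide (A.run κ ω X = .num 1))

theorem impl_coinDist (A : PPT) (κ : ℕ) : Impl (2 ^ A.coins.eval κ) (A.coinDist κ)
    fun R => (Fin.ofNat _ (R % 2 ^ A.coins.eval κ), R / 2 ^ A.coins.eval κ) :=
  (decodes_fin _).impl (by positivity)

/-- The output of `A` on `1^κ`, the number `ω` that encodes the coins, and the input `X`. -/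
def PPT.out (A : PPT) (κu : Val) (ω : ℕ) (X : Val) : Val := A.prog.eval (Val.list [κu, .num ω, X])

theorem PPT.run_eq_out (A : PPT) (κ : ℕ) (ω : Fin (2 ^ A.coins.eval κ)) (X : Val) :
    A.run κ ω X = A.out (Val.unary κ) ω X := rfl

@[fun_prop]
theorem PPT.pt_out (A : PPT) {κu X : Val → Val} {ω : Val → ℕ} (hκ : PT κu) (hω : PTN ω)
    (hX : PT X) : PT fun x => A.out (κu x) (ω x) (X x) :=
  PT.comp (.of_prog A.polyTime) (by simp only [Val.list]; fun_prop)

@[simp] theorem PPT.run_ofNat (A : PPT) (κ R : ℕ) (X : Val) :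
    A.run κ (Fin.ofNat (2 ^ A.coins.eval κ) (R % 2 ^ A.coins.eval κ)) X
      = A.out (Val.unary κ) (R % 2 ^ A.coins.eval κ) X := by
  simp [PPT.run_eq_out]

theorem PPT.sim_bit (A : PPT) (κ : ℕ) (X : Val) : Sim (2 ^ A.coins.eval κ * 1) (A.bit κ X)
    fun R => decide (A.out (Val.unary κ) (R % 2 ^ A.coins.eval κ) X = .num 1) := by
  have := (impl_coinDist A κ).sim_bind (K₂ := 1)
    (f₂ := fun ω _ => decide (A.run κ ω X = .num 1)) (fun ω => Sim.pure 1 _) one_pos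
  simpa only [PPT.run_ofNat, PPT.bit] using this

@[simp] theorem eqv_eq_one_iff {a b : Val} : eqv a b = 1 ↔ a = b := by simp [eqv]

@[simp] theorem Val.cond_zero (a b : Val) : Val.cond 0 a b = b := rfl

theorem Val.cond_of_ne {c : ℕ} (h : c ≠ 0) (a b : Val) : Val.cond c a b = a := if_neg h

/-- Decoding of a vector of exponents. -/
theorem decodes_zmodVec (Γ : TrilinearInstance) (n : ℕ) :
    Decodes (Γ.N ^ n) (PMF.uniformOfFintype (Fin n → ZMod Γ.N))
      fun R j => ((R / Γ.N ^ (j : ℕ) % Γ.N : ℕ) : ZMod Γ.N) := (decodes_zmod Γ.N).pi Γ.N_pos n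

/-- Decoding of a matrix of group elements. -/
theorem decodes_mat (Γ : TrilinearInstance) (n : ℕ) :
    Decodes ((Γ.N ^ n) ^ n) (PMF.uniformOfFintype (Fin n → Fin n → Γ.G 0))
      fun R i j => Γ.g 0 ^ (R / (Γ.N ^ n) ^ (i : ℕ) % Γ.N ^ n / Γ.N ^ (j : ℕ) % Γ.N) :=
  ((Γ.decodes_G 0).pi Γ.N_pos n).pi (pow_pos Γ.N_pos n) n

/-- The input of a distinguisher for matrices `W` over `G₁`. -/
def matInput (Γ : TrilinearInstance) {n : ℕ} (W : Fin n → Fin n → Γ.G 0) : Val :=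
  Val.list [.num Γ.p, .num Γ.q, Γ.code, Val.vec fun i => Val.vec fun j => Γ.enc 0 (W i j)]

section

variable {𝒢 : TrilinearGenerator} (F : MatrixFamily 𝒢)

/-- The entry `(i, j)` of the matrix built by the reduction from the challenge `u, v, w, U, V, Z`,
the entries of index `3` to `8` of `I`. -/
def dlinEntry (κu I : Val) (k RW Rα Rβ Rx Ry Rz i j : ℕ) : Val :=
  let c := I.nth 2
  let x := F.digit κu c Rx j
  let y := F.digit κu c Ry j
  let z := F.digit κu c Rz j
  Val.cond (k - i) (𝒢.gpow 0 c (c.nth 2) (F.digit κu c (F.rowDigit κu c RW i) j))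
    (Val.cond (i - k)
      (𝒢.gmul 0 c
        (𝒢.gpow 0 c (𝒢.gmul 0 c (𝒢.gpow 0 c (I.nth 3) x) (𝒢.gpow 0 c (I.nth 5) z))
          (F.digit κu c Rα i))
        (𝒢.gpow 0 c (𝒢.gmul 0 c (𝒢.gpow 0 c (I.nth 4) y) (𝒢.gpow 0 c (I.nth 5) z))
          (F.digit κu c Rβ i)))
      (𝒢.gmul 0 c (𝒢.gmul 0 c (𝒢.gpow 0 c (I.nth 6) x) (𝒢.gpow 0 c (I.nth 7) y))
        (𝒢.gpow 0 c (I.nth 8) z)))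

/-- The matrix built by the reduction. -/
def dlinMatrix (κu I : Val) (k RW Rα Rβ Rx Ry Rz : ℕ) : Val :=
  tab (F.dim κu) fun i => tab (F.dim κu) fun j => dlinEntry F κu I k RW Rα Rβ Rx Ry Rz i j

@[fun_prop]
theorem pt_dlinMatrix {κu I : Val → Val} {k RW Rα Rβ Rx Ry Rz : Val → ℕ} (hκ : PT κu) (hI : PT I)
    (hk : PTN k) (hW : PTN RW) (hα : PTN Rα) (hβ : PTN Rβ) (hx : PTN Rx) (hy : PTN Ry)
    (hz : PTN Rz) : PT fun X =>
      dlinMatrix F (κu X) (I X) (k X) (RW X) (Rα X) (Rβ X) (Rx X) (Ry X) (Rz X) := by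
  refine PT.tab (F.pts_dim hκ) (PT.tab (F.pts_dim (hκ.comp (.fst .id))) ?_)
  dsimp only [dlinEntry]
  fun_prop

/-- The reduction: it draws the index `k` of a hybrid and the ingredients of `dlinHybridExp` from
its coins and runs the distinguisher `D` on the resulting matrix. -/
def dlinReduction (D : PPT) (X : Val) : ℕ :=
  let κu := X.nth 0
  let I := X.nth 2
  let c := I.nth 2
  let v := F.vecCard κu c
  let R₁ := (X.nth 1).toNat / F.dim κu
  let R₂ := R₁ / F.matCard κu c
  let R₃ := R₂ / v
  let R₄ := R₃ / v
  let R₅ := R₄ / v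
  let R₆ := R₅ / v
  let R₇ := R₆ / v
  eqv (D.out κu (R₇ % coinCard D.coins κu) (Val.list [I.nth 0, I.nth 1, c,
    dlinMatrix F κu I ((X.nth 1).toNat % F.dim κu) (R₁ % F.matCard κu c) (R₂ % v) (R₃ % v)
      (R₄ % v) (R₅ % v) (R₆ % v)])) (.num 1)

theorem ptn_dlinReduction (D : PPT) : PTN (dlinReduction F D) := by
  unfold dlinReduction
  simp only [Val.list]
  fun_prop

variable {κ : ℕ} (s : 𝒢.Seed κ)

theorem dlinMatrix_eq (p q : Val) (u v w U V Z : (𝒢.inst κ s).G 0) (k RW Rα Rβ Rx Ry Rz : ℕ) :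
    dlinMatrix F (Val.unary κ) (Val.list [p, q, (𝒢.inst κ s).code,
      (𝒢.inst κ s).enc 0 u, (𝒢.inst κ s).enc 0 v, (𝒢.inst κ s).enc 0 w,
      (𝒢.inst κ s).enc 0 U, (𝒢.inst κ s).enc 0 V, (𝒢.inst κ s).enc 0 Z]) k RW Rα Rβ Rx Ry Rz
    = Val.vec fun i : Fin (F.n κ) => Val.vec fun j : Fin (F.n κ) => (𝒢.inst κ s).enc 0
      (hybridRow k (fun i j => (𝒢.inst κ s).g 0 ^ (RW / ((𝒢.inst κ s).N ^ F.n κ) ^ (i : ℕ)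
          % (𝒢.inst κ s).N ^ F.n κ / (𝒢.inst κ s).N ^ (j : ℕ) % (𝒢.inst κ s).N))
        (fun i => ((Rα / (𝒢.inst κ s).N ^ (i : ℕ) % (𝒢.inst κ s).N : ℕ) : ZMod (𝒢.inst κ s).N))
        (fun i => ((Rβ / (𝒢.inst κ s).N ^ (i : ℕ) % (𝒢.inst κ s).N : ℕ) : ZMod (𝒢.inst κ s).N))
        (fun j => u ^ (Rx / (𝒢.inst κ s).N ^ (j : ℕ) % (𝒢.inst κ s).N)
          * w ^ (Rz / (𝒢.inst κ s).N ^ (j : ℕ) % (𝒢.inst κ s).N))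
        (fun j => v ^ (Ry / (𝒢.inst κ s).N ^ (j : ℕ) % (𝒢.inst κ s).N)
          * w ^ (Rz / (𝒢.inst κ s).N ^ (j : ℕ) % (𝒢.inst κ s).N))
        (fun j => U ^ (Rx / (𝒢.inst κ s).N ^ (j : ℕ) % (𝒢.inst κ s).N)
          * V ^ (Ry / (𝒢.inst κ s).N ^ (j : ℕ) % (𝒢.inst κ s).N)
          * Z ^ (Rz / (𝒢.inst κ s).N ^ (j : ℕ) % (𝒢.inst κ s).N)) i j) := by
  rw [dlinMatrix, F.dim_unary]
  refine tab_eq_vec fun i => tab_eq_vec fun j => ?_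
  simp only [dlinEntry, Val.list, Val.nth_pair_zero, Val.nth_pair_succ, MatrixFamily.digit_code,
    MatrixFamily.rowDigit_code, TrilinearInstance.code_nth_two, TrilinearGenerator.gpow_enc,
    TrilinearGenerator.gmul_enc, hybridRow, ZMod.val_natCast, Nat.mod_mod]
  rcases lt_trichotomy (i : ℕ) k with h | h | h
  · rw [if_pos h, Val.cond_of_ne (by omega)]
  · rw [if_neg (by omega), if_neg (by omega), Nat.sub_eq_zero_of_le h.ge, Nat.sub_eq_zero_of_le h.le]
    rfl
  · rw [if_neg (by omega), if_pos h, Nat.sub_eq_zero_of_le h.le, Val.cond_zero,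
      Val.cond_of_ne (by omega)]

/-- The reduction samples `dlinHybridExp` for a random `k`, up to an exponentially small error. -/
theorem exists_dlinReduction (D : PPT) : ∃ B : PPT, ∀ (κ : ℕ) (_ : 2 ≤ κ) (_ : NeZero (F.n κ))
    (s : 𝒢.Seed κ) (u v w U V Z : (𝒢.inst κ s).G 0),
    |prTrue (B.bit κ (Val.list [.num (𝒢.inst κ s).p, .num (𝒢.inst κ s).q, (𝒢.inst κ s).code,
        (𝒢.inst κ s).enc 0 u, (𝒢.inst κ s).enc 0 v, (𝒢.inst κ s).enc 0 w,
        (𝒢.inst κ s).enc 0 U, (𝒢.inst κ s).enc 0 V, (𝒢.inst κ s).enc 0 Z]))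
      - prTrue ((PMF.uniformOfFintype (Fin (F.n κ))).bind fun k =>
          dlinHybridExp (n := F.n κ) (fun W => D.bit κ (matInput (𝒢.inst κ s) W))
            u v w U V Z k)|
      ≤ (1 / 2) ^ κ := by
  let X : Polynomial ℕ := Polynomial.X
  let S := F.sizePoly
  obtain ⟨B, hB⟩ := exists_ppt_of_sim (ptn_dlinReduction F D)
    (S + 2 * X * S * S + 5 * (2 * X * S) + D.coins + X)
  refine ⟨B, fun κ hκ hn s u v w U V Z => ?_⟩
  have hn0 : 0 < F.n κ := Nat.pos_of_ne_zero (NeZero.ne _)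
  have hN := (𝒢.inst κ s).N_pos
  have hv : 0 < (𝒢.inst κ s).N ^ F.n κ := pow_pos hN _
  have hv' := fun α : Fin (F.n κ) → ZMod (𝒢.inst κ s).N => hv
  have hvec := (decodes_zmodVec (𝒢.inst κ s) (F.n κ)).impl hv
  have hsim := ((decodes_fin (F.n κ)).impl hn0).sim_bind
    (fun k => ((decodes_mat (𝒢.inst κ s) (F.n κ)).impl (pow_pos hv _)).sim_bind
    (fun W => hvec.sim_bind (fun α => hvec.sim_bind (fun β => hvec.sim_bind (fun x =>
    hvec.sim_bind (fun y => hvec.sim_bind (fun z => D.sim_bit κ (matInput (𝒢.inst κ s)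
      (hybridRow k W α β (fun j => u ^ (x j).val * w ^ (z j).val)
      (fun j => v ^ (y j).val * w ^ (z j).val)
      fun j => U ^ (x j).val * V ^ (y j).val * Z ^ (z j).val))) (by positivity)) (by positivity))
      (by positivity)) (by positivity)) (by positivity)) (by positivity)) (by positivity)
  refine hB κ _ _ _ _ (by positivity) ?_ hsim fun R _ => ?_
  · have h1 := F.n_le κ
    have h3 := F.N_pow_le s hκ
    have h4 : ((𝒢.inst κ s).N ^ F.n κ) ^ F.n κ ≤ 2 ^ (2 * κ * S.eval κ * S.eval κ) := by
      rw [pow_mul]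
      exact (Nat.pow_le_pow_left h3 _).trans (Nat.pow_le_pow_right (by positivity) h1)
    have h5 : F.n κ ≤ 2 ^ S.eval κ := h1.trans Nat.lt_two_pow_self.le
    calc _ ≤ 2 ^ S.eval κ * (2 ^ (2 * κ * S.eval κ * S.eval κ) * (2 ^ (2 * κ * S.eval κ) *
          (2 ^ (2 * κ * S.eval κ) * (2 ^ (2 * κ * S.eval κ) * (2 ^ (2 * κ * S.eval κ) *
          (2 ^ (2 * κ * S.eval κ) * (2 ^ D.coins.eval κ * 1))))))) * 2 ^ κ := by gcongr
      _ = _ := by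
        simp only [mul_one, ← pow_add, Polynomial.eval_add, Polynomial.eval_mul, X,
          Polynomial.eval_X, Polynomial.eval_ofNat]
        congr 1; ring
  · have hI : (Val.list [Val.unary κ, .num R, Val.list [.num (𝒢.inst κ s).p, .num (𝒢.inst κ s).q,
        (𝒢.inst κ s).code, (𝒢.inst κ s).enc 0 u, (𝒢.inst κ s).enc 0 v, (𝒢.inst κ s).enc 0 w,
        (𝒢.inst κ s).enc 0 U, (𝒢.inst κ s).enc 0 V, (𝒢.inst κ s).enc 0 Z]]).nth 2 =
        Val.list [.num (𝒢.inst κ s).p, .num (𝒢.inst κ s).q,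
        (𝒢.inst κ s).code, (𝒢.inst κ s).enc 0 u, (𝒢.inst κ s).enc 0 v, (𝒢.inst κ s).enc 0 w,
        (𝒢.inst κ s).enc 0 U, (𝒢.inst κ s).enc 0 V, (𝒢.inst κ s).enc 0 Z] := rfl
    have h0 : ∀ a b c : Val, (Val.list [a, b, c]).nth 0 = a := fun _ _ _ => rfl
    have h1 : ∀ a b c : Val, (Val.list [a, b, c]).nth 1 = b := fun _ _ _ => rfl
    have hc : ∀ a b c d e f g h i : Val, (Val.list [a, b, c, d, e, f, g, h, i]).nth 2 = c :=
      fun _ _ _ _ _ _ _ _ _ => rfl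
    have hp : ∀ a b c d e f g h i : Val, (Val.list [a, b, c, d, e, f, g, h, i]).nth 0 = a :=
      fun _ _ _ _ _ _ _ _ _ => rfl
    have hq : ∀ a b c d e f g h i : Val, (Val.list [a, b, c, d, e, f, g, h, i]).nth 1 = b :=
      fun _ _ _ _ _ _ _ _ _ => rfl
    simp only [dlinReduction, hI, h0, h1, hc, hp, hq, eqv_eq_one_iff, decide_eq_true_eq,
      dlinMatrix_eq, Val.toNat_num, F.dim_unary, F.vecCard_code, F.matCard_code, coinCard_unary,
      matInput, ZMod.val_natCast, Nat.mod_mod, Fin.val_ofNat]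

/-- The output bit of `D` on the pseudorandom matrix of a random key, if `real = true`, and on a
uniform matrix otherwise. -/
def matrixExp (D : PPT) (real : Bool) (κ : ℕ) : PMF Bool :=
  (𝒢.sample κ).bind fun s => hybridExp (n := F.n κ)
    (fun W => D.bit κ (matInput (𝒢.inst κ s) W)) (if real then 0 else F.n κ)

theorem dlinExp_eq (B : PPT) (real : Bool) (κ : ℕ) : dlinExp 𝒢 B real κ =
    (𝒢.sample κ).bind fun s =>
    (PMF.uniformOfFintype ((𝒢.inst κ s).G 0)).bind fun u =>
    (PMF.uniformOfFintype ((𝒢.inst κ s).G 0)).bind fun v =>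
    (PMF.uniformOfFintype ((𝒢.inst κ s).G 0)).bind fun w =>
    (PMF.uniformOfFintype (ZMod (𝒢.inst κ s).N)).bind fun a =>
    (PMF.uniformOfFintype (ZMod (𝒢.inst κ s).N)).bind fun b =>
    (PMF.uniformOfFintype (ZMod (𝒢.inst κ s).N)).bind fun c =>
      B.bit κ (Val.list [.num (𝒢.inst κ s).p, .num (𝒢.inst κ s).q, (𝒢.inst κ s).code,
        (𝒢.inst κ s).enc 0 u, (𝒢.inst κ s).enc 0 v, (𝒢.inst κ s).enc 0 w,
        (𝒢.inst κ s).enc 0 (u ^ a.val), (𝒢.inst κ s).enc 0 (v ^ b.val),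
        (𝒢.inst κ s).enc 0 (if real then w ^ (a.val + b.val) else w ^ c.val)]) := by
  refine congrArg _ (funext fun s => ?_)
  simp only [bind, pure]
  rw [PMF.bind_comm (B.coinDist κ)]
  refine congrArg _ (funext fun u => ?_)
  rw [PMF.bind_comm (B.coinDist κ)]
  refine congrArg _ (funext fun v => ?_)
  rw [PMF.bind_comm (B.coinDist κ)]
  refine congrArg _ (funext fun w => ?_)
  rw [PMF.bind_comm (B.coinDist κ)]
  refine congrArg _ (funext fun a => ?_)
  rw [PMF.bind_comm (B.coinDist κ)]
  refine congrArg _ (funext fun b => ?_)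
  rw [PMF.bind_comm (B.coinDist κ)]
  rfl

theorem abs_dlinExp_sub_le {B D : PPT} {κ : ℕ} (hκ : 2 ≤ κ) [NeZero (F.n κ)]
    (hB : ∀ (s : 𝒢.Seed κ) (u v w U V Z : (𝒢.inst κ s).G 0),
    |prTrue (B.bit κ (Val.list [.num (𝒢.inst κ s).p, .num (𝒢.inst κ s).q, (𝒢.inst κ s).code,
        (𝒢.inst κ s).enc 0 u, (𝒢.inst κ s).enc 0 v, (𝒢.inst κ s).enc 0 w,
        (𝒢.inst κ s).enc 0 U, (𝒢.inst κ s).enc 0 V, (𝒢.inst κ s).enc 0 Z]))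
      - prTrue ((PMF.uniformOfFintype (Fin (F.n κ))).bind fun k =>
          dlinHybridExp (n := F.n κ) (fun W => D.bit κ (matInput (𝒢.inst κ s) W)) u v w U V Z k)|
      ≤ (1 / 2) ^ κ) (real : Bool) :
    |prTrue (dlinExp 𝒢 B real κ) - prTrue ((PMF.uniformOfFintype (Fin (F.n κ))).bind fun k =>
      (𝒢.sample κ).bind fun s => hybridExp (n := F.n κ)
        (fun W => D.bit κ (matInput (𝒢.inst κ s) W)) (if real then k else k + 1))|
      ≤ 17 * (1 / 2) ^ κ := by
  let X : Fin (F.n κ) → PMF Bool := fun k => (𝒢.sample κ).bind fun s =>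
    (PMF.uniformOfFintype ((𝒢.inst κ s).G 0)).bind fun u =>
    (PMF.uniformOfFintype ((𝒢.inst κ s).G 0)).bind fun v =>
    (PMF.uniformOfFintype ((𝒢.inst κ s).G 0)).bind fun w =>
    (PMF.uniformOfFintype (ZMod (𝒢.inst κ s).N)).bind fun a =>
    (PMF.uniformOfFintype (ZMod (𝒢.inst κ s).N)).bind fun b =>
    (PMF.uniformOfFintype (ZMod (𝒢.inst κ s).N)).bind fun c =>
      dlinHybridExp (n := F.n κ) (fun W => D.bit κ (matInput (𝒢.inst κ s) W)) u v w
        (u ^ a.val) (v ^ b.val) (if real then w ^ (a.val + b.val) else w ^ c.val) k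
  have h1 : |prTrue (dlinExp 𝒢 B real κ)
      - prTrue ((PMF.uniformOfFintype (Fin (F.n κ))).bind X)| ≤ (1 / 2) ^ κ := by
    rw [dlinExp_eq, PMF.bind_comm (PMF.uniformOfFintype (Fin (F.n κ)))]
    refine abs_prTrue_bind_sub_le _ fun s => ?_
    rw [PMF.bind_comm (PMF.uniformOfFintype (Fin (F.n κ)))]
    refine abs_prTrue_bind_sub_le _ fun u => ?_
    rw [PMF.bind_comm (PMF.uniformOfFintype (Fin (F.n κ)))]
    refine abs_prTrue_bind_sub_le _ fun v => ?_
    rw [PMF.bind_comm (PMF.uniformOfFintype (Fin (F.n κ)))]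
    refine abs_prTrue_bind_sub_le _ fun w => ?_
    rw [PMF.bind_comm (PMF.uniformOfFintype (Fin (F.n κ)))]
    refine abs_prTrue_bind_sub_le _ fun a => ?_
    rw [PMF.bind_comm (PMF.uniformOfFintype (Fin (F.n κ)))]
    refine abs_prTrue_bind_sub_le _ fun b => ?_
    rw [PMF.bind_comm (PMF.uniformOfFintype (Fin (F.n κ)))]
    exact abs_prTrue_bind_sub_le _ fun c => hB s _ _ _ _ _ _
  have h2 : |prTrue ((PMF.uniformOfFintype (Fin (F.n κ))).bind X)
      - prTrue ((PMF.uniformOfFintype (Fin (F.n κ))).bind fun k =>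
        (𝒢.sample κ).bind fun s => hybridExp (n := F.n κ)
          (fun W => D.bit κ (matInput (𝒢.inst κ s) W)) (if real then k else k + 1))|
      ≤ 4 * (4 * (1 / 2) ^ κ) := by
    refine abs_prTrue_bind_sub_le _ fun k => abs_prTrue_bind_sub_le _ fun s => ?_
    cases real
    · exact abs_dlinHybrid_random_sub_le _ k (𝒢.inv_p_add_inv_q_le s hκ)
    · exact abs_dlinHybrid_real_sub_le _ k (𝒢.inv_p_add_inv_q_le s hκ)
  have := abs_sub_le (prTrue (dlinExp 𝒢 B real κ))
    (prTrue ((PMF.uniformOfFintype (Fin (F.n κ))).bind X))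
    (prTrue ((PMF.uniformOfFintype (Fin (F.n κ))).bind fun k =>
        (𝒢.sample κ).bind fun s => hybridExp (n := F.n κ)
          (fun W => D.bit κ (matInput (𝒢.inst κ s) W)) (if real then k else k + 1)))
  linarith

/-- Under the decision linear assumption the matrix of the elements `F_K(i, j)` is indistinguishable
from a uniform matrix over `G₁`, even if `p` and `q` are known.  The proof sums over the hybrids. -/
theorem matrix_pseudorandom (h : DLIN 𝒢) (D : PPT) :
    Negligible fun κ => |prTrue (matrixExp F D true κ) - prTrue (matrixExp F D false κ)| := by
  obtain ⟨B, hB⟩ := exists_dlinReduction F D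
  refine Negligible.of_abs_le (((h B).add (Negligible.half_pow.const_mul 34)).polynomial_mul
    F.sizePoly) fun κ hκ => ?_
  have hle : (F.n κ : ℝ) ≤ (F.sizePoly.eval κ : ℕ) := by exact_mod_cast F.n_le κ
  rw [abs_abs]
  have hnn : 0 ≤ |prTrue (dlinExp 𝒢 B true κ) - prTrue (dlinExp 𝒢 B false κ)|
    + 34 * (1 / 2) ^ κ := by positivity
  refine le_trans ?_ (mul_le_mul_of_nonneg_right hle hnn)
  let P : ℕ → ℝ := fun k => prTrue ((𝒢.sample κ).bind fun s => hybridExp (n := F.n κ)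
    (fun W => D.bit κ (matInput (𝒢.inst κ s) W)) k)
  change |P 0 - P (F.n κ)| ≤ _
  rcases Nat.eq_zero_or_pos (F.n κ) with h0 | h0
  · rw [h0]; simp
  have : NeZero (F.n κ) := ⟨h0.ne'⟩
  have hn : (0 : ℝ) < F.n κ := by exact_mod_cast h0
  have h1 := abs_dlinExp_sub_le F (D := D) hκ (hB κ hκ this) true
  have h2 := abs_dlinExp_sub_le F (D := D) hκ (hB κ hκ this) false
  rw [prTrue_uniform_bind, Fintype.card_fin] at h1 h2
  simp only [if_true, Bool.false_eq_true, if_false] at h1 h2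
  change |_ - (∑ k : Fin (F.n κ), P k) / _| ≤ _ at h1
  change |_ - (∑ k : Fin (F.n κ), P (k + 1)) / _| ≤ _ at h2
  rw [Fin.sum_univ_eq_sum_range] at h1
  rw [Fin.sum_univ_eq_sum_range (fun k => P (k + 1))] at h2
  have h3 : P 0 - P (F.n κ) = F.n κ * ((∑ k ∈ Finset.range (F.n κ), P k) / F.n κ
      - (∑ k ∈ Finset.range (F.n κ), P (k + 1)) / F.n κ) := by
    rw [mul_sub, mul_div_cancel₀ _ hn.ne', mul_div_cancel₀ _ hn.ne', ← Finset.sum_sub_distrib,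
      Finset.sum_range_sub']
  rw [h3, abs_mul, abs_of_pos hn]
  refine mul_le_mul_of_nonneg_left ?_ hn.le
  have h4 := abs_le.1 h1
  have h5 := abs_le.1 h2
  have h6 := le_abs_self (prTrue (dlinExp 𝒢 B true κ) - prTrue (dlinExp 𝒢 B false κ))
  have h7 := neg_abs_le (prTrue (dlinExp 𝒢 B true κ) - prTrue (dlinExp 𝒢 B false κ))
  exact abs_le.2 ⟨by linarith, by linarith⟩

end

/-! ### Simulation of the encoding oracle -/

/-- One query in a state that consists of a transcript and a number with the coins that are left:
`ask` chooses the query, `a` answers it, using coins below `K`. -/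
def queryStep (ask : Val → Val) (a : Val → ℕ → Val) (K : ℕ) (st : Val) : Val :=
  .pair (.pair (a (ask st.fst) st.snd.toNat) st.fst) (.num (st.snd.toNat / K))

theorem impl_queryPhase {ask : Val → Val} {ans : Val → PMF Val} {a : Val → ℕ → Val} {K : ℕ}
    (hK : 0 < K) (h : ∀ v, Impl K (ans v) fun R => (a v R, R / K)) (l : ℕ) (t : Val) :
    Impl (K ^ l) (queryPhase ask ans l t) fun R =>
      (((queryStep ask a K)^[l] (.pair t (.num R))).fst,
        ((queryStep ask a K)^[l] (.pair t (.num R))).snd.toNat) := by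
  induction l generalizing t with
  | zero => exact Impl.pure t
  | succ l ih =>
    have := (h (ask t)).bind (fun b => ih (.pair b t)) (by positivity)
    rw [pow_succ']
    exact this

theorem size_queryStep_iterate_le {ask : Val → Val} {a : Val → ℕ → Val} {K b : ℕ}
    (h : ∀ v R, (a v R).size ≤ b) (i R : ℕ) :
    ((queryStep ask a K)^[i] (.pair (.num 0) (.num R))).size ≤ i * (b + 1) + R.size + 3 := by
  have key : ((queryStep ask a K)^[i] (.pair (.num 0) (.num R))).fst.size ≤ i * (b + 1) + 1 ∧
      ∃ R' ≤ R, (queryStep ask a K)^[i] (.pair (.num 0) (.num R))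
        = .pair ((queryStep ask a K)^[i] (.pair (.num 0) (.num R))).fst (.num R') := by
    induction i with
    | zero => exact ⟨by simp [Val.size], R, le_rfl, rfl⟩
    | succ i ih =>
      rw [Function.iterate_succ_apply']
      obtain ⟨h1, R', hR', h2⟩ := ih
      refine ⟨?_, R' / K, (Nat.div_le_self _ _).trans hR', ?_⟩
      · simp only [queryStep, Val.fst_pair, Val.size]
        have := h (ask ((queryStep ask a K)^[i] (.pair (.num 0) (.num R))).fst)
          ((queryStep ask a K)^[i] (.pair (.num 0) (.num R))).snd.toNat
        rw [add_mul]
        omega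
      · rw [queryStep, h2]
        rfl
  obtain ⟨h1, R', hR', h2⟩ := key
  rw [h2]
  have := Nat.size_le_size hR'
  simp only [Val.size]
  omega

section

variable {𝒢 : TrilinearGenerator} (F : MatrixFamily 𝒢)

/-- The encoding `σ` of the input vector `xs`, for the element `h` of the public key and the number
`R` of a vector of exponents. -/
def sigmaV (κu c h xs : Val) (R : ℕ) : Val :=
  tab (F.dim κu) fun j => 𝒢.gmul 0 c (𝒢.gpow 0 c (c.nth 2) (xs.nth j).toNat)
    (𝒢.gpow 0 c h (F.digit κu c R j))

@[fun_prop]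
theorem pt_sigmaV {κu c h xs : Val → Val} {R : Val → ℕ} (hκ : PT κu) (hc : PT c) (hh : PT h)
    (hx : PT xs) (hR : PTN R) : PT fun X => sigmaV F (κu X) (c X) (h X) (xs X) (R X) := by
  refine PT.tab (F.pts_dim hκ) ?_
  fun_prop

/-- The answer of the encoding oracle to the query `v`. -/
def ansV (κu c h v : Val) (R : ℕ) : Val :=
  Val.cond (F.mem κu v) (.pair v (sigmaV F κu c h v (R % F.vecCard κu c))) (.num 0)

/-- The query phase of `A` in stage `i` of the experiment, on the input `view`.  The result is a
transcript together with a number with the coins that are left. -/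
def queryV (A : PPT) (B Q : Polynomial ℕ) (κu c h : Val) (ω i : ℕ) (view : Val) (R : ℕ) : Val :=
  citer (B.eval (secpar κu)) (Q.eval (secpar κu))
    (queryStep (fun t => A.out κu ω (Val.list [.num i, view, t]))
      (ansV F κu c h) (F.vecCard κu c)) (.pair (.num 0) (.num R))

@[fun_prop]
theorem pt_queryV (A : PPT) (B Q : Polynomial ℕ) (i : ℕ) {κu c h view : Val → Val} {ω R : Val → ℕ}
    (hκ : PT κu) (hc : PT c) (hh : PT h) (hv : PT view) (hω : PTN ω) (hR : PTN R) :
    PT fun X => queryV F A B Q (κu X) (c X) (h X) (ω X) i (view X) (R X) := by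
  refine PT.citer ((PTS.secpar hκ).polynomial B) ((PTS.secpar hκ).polynomial Q) ?_ (by fun_prop)
  simp only [queryStep, ansV, Val.list]
  fun_prop

variable {κ : ℕ} (s : 𝒢.Seed κ)

/-- The encoding of `x` with coins `r`, as a datum. -/
def encVec (h : (𝒢.inst κ s).G 0) (x : Fin (F.n κ) → ℕ)
    (r : Fin (F.n κ) → ZMod (𝒢.inst κ s).N) : Val :=
  Val.vec fun j => (𝒢.inst κ s).enc 0 ((𝒢.inst κ s).g 0 ^ x j * h ^ (r j).val)

/-- The encoding oracle; of the keys it only depends on the element `h` of the public key. -/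
def pubEnc (h : (𝒢.inst κ s).G 0) (v : Val) : PMF Val :=
  match F.input κ v with
  | none => PMF.pure (.num 0)
  | some x => (PMF.uniformOfFintype (Fin (F.n κ) → ZMod (𝒢.inst κ s).N)).bind fun r =>
      PMF.pure (.pair (Val.natVec x.1) (encVec F s h x.1 r))

theorem pubProbGen_eq (pk : PublicKey (𝒢.inst κ s) (F.n κ)) (sk : SecretKey (𝒢.inst κ s) (F.n κ)) :
    pubProbGen 𝒢 F pk sk = pubEnc F s pk.h := by
  funext v
  unfold pubProbGen pubEnc
  cases F.input κ v with
  | none => rfl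
  | some x =>
    simp only [probGen, bind, pure, PMF.bind_bind, PMF.pure_bind, probGenWith_val]
    rfl

theorem sigmaV_natVec (h : (𝒢.inst κ s).G 0) (x : Fin (F.n κ) → ℕ) (R : ℕ) :
    sigmaV F (Val.unary κ) (𝒢.inst κ s).code ((𝒢.inst κ s).enc 0 h) (Val.natVec x) R
      = encVec F s h x fun j =>
        ((R / (𝒢.inst κ s).N ^ (j : ℕ) % (𝒢.inst κ s).N : ℕ) : ZMod (𝒢.inst κ s).N) := by
  rw [sigmaV, F.dim_unary]
  refine tab_eq_vec fun j => ?_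
  simp [Val.natVec]

theorem impl_pubEnc (h : (𝒢.inst κ s).G 0) (v : Val) :
    Impl ((𝒢.inst κ s).N ^ F.n κ) (pubEnc F s h v) fun R =>
      (ansV F (Val.unary κ) (𝒢.inst κ s).code ((𝒢.inst κ s).enc 0 h) v R,
        R / (𝒢.inst κ s).N ^ F.n κ) := by
  have hK : 0 < (𝒢.inst κ s).N ^ F.n κ := pow_pos (𝒢.inst κ s).N_pos _
  unfold pubEnc ansV
  cases hv : F.input κ v with
  | none =>
    simp only [F.mem_of_input_eq_none hv, Val.cond_zero]
    exact Impl.skip _ hK _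
  | some x =>
    simp only [F.mem_of_input_eq_some hv, Val.cond_of_ne one_ne_zero]
    rw [← F.input_eq_some_iff.1 hv]
    simp only [sigmaV_natVec, F.vecCard_code]
    exact ((decodes_zmodVec (𝒢.inst κ s) (F.n κ)).impl hK).map fun r =>
      Val.pair (Val.natVec x.1) (encVec F s h x.1 r)

/-- A polynomial bound for the length of an answer of the oracle. -/
def ansPoly : Polynomial ℕ :=
  F.sizePoly * (Polynomial.X + 2) + F.sizePoly * (𝒢.lenPoly + 1) + 3

theorem size_ansV_le (h : (𝒢.inst κ s).G 0) (v : Val) (R : ℕ) :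
    (ansV F (Val.unary κ) (𝒢.inst κ s).code ((𝒢.inst κ s).enc 0 h) v R).size
      ≤ (ansPoly F).eval κ := by
  have hn := F.n_le κ
  unfold ansV
  cases hv : F.input κ v with
  | none =>
    simp only [F.mem_of_input_eq_none hv, Val.cond_zero, ansPoly, Val.size, Nat.size_zero,
      Polynomial.eval_add, Polynomial.eval_ofNat]
    omega
  | some x =>
    simp only [F.mem_of_input_eq_some hv, Val.cond_of_ne one_ne_zero]
    rw [← F.input_eq_some_iff.1 hv, sigmaV_natVec]
    have h1 : (Val.natVec x.1).size ≤ F.n κ * (κ + 2) + 1 := by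
      refine size_vec_le (b := κ + 1) fun j => ?_
      simp only [Val.size]
      exact Nat.succ_le_succ (Nat.size_le.2 (F.lt_two_pow κ x.1 x.2 j))
    have h2 : ∀ r, (encVec F s h x.1 r).size ≤ F.n κ * (𝒢.lenPoly.eval κ + 1) + 1 := fun r =>
      size_vec_le fun j => 𝒢.size_enc_le s 0 _
    have h2' := h2 fun j => ((R % F.vecCard (Val.unary κ) (𝒢.inst κ s).code
      / (𝒢.inst κ s).N ^ (j : ℕ) % (𝒢.inst κ s).N : ℕ) : ZMod (𝒢.inst κ s).N)
    have h3 := Nat.mul_le_mul_right (κ + 2) hn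
    have h4 := Nat.mul_le_mul_right (𝒢.lenPoly.eval κ + 1) hn
    simp only [Val.size, ansPoly, Polynomial.eval_add, Polynomial.eval_mul, Polynomial.eval_X,
      Polynomial.eval_ofNat, Polynomial.eval_one]
    omega

/-- A polynomial bound for the length of the state during `Q` queries with `C` coins. -/
def queryPoly (Q C : Polynomial ℕ) : Polynomial ℕ := Q * (ansPoly F + 1) + C + 3

/-- With this bound no truncation occurs. -/
theorem queryV_eq (A : PPT) (Q C : Polynomial ℕ) (h : (𝒢.inst κ s).G 0) (ω i : ℕ) (view : Val)
    {R : ℕ} (hR : R < 2 ^ C.eval κ) :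
    queryV F A (queryPoly F Q C) Q (Val.unary κ) (𝒢.inst κ s).code ((𝒢.inst κ s).enc 0 h) ω i view R
      = (queryStep (fun t => A.out (Val.unary κ) ω (Val.list [.num i, view, t]))
        (ansV F (Val.unary κ) (𝒢.inst κ s).code ((𝒢.inst κ s).enc 0 h))
        ((𝒢.inst κ s).N ^ F.n κ))^[Q.eval κ] (.pair (.num 0) (.num R)) := by
  rw [queryV, secpar_unary, F.vecCard_code, citer_eq_iterate]
  intro l hl
  have h1 := size_queryStep_iterate_le (ask := fun t =>
    A.out (Val.unary κ) ω (Val.list [.num i, view, t])) (K := (𝒢.inst κ s).N ^ F.n κ)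
    (size_ansV_le F s h) l R
  have h2 := Nat.mul_le_mul_right ((ansPoly F).eval κ + 1) hl
  have h3 := Nat.size_le.2 hR
  simp only [queryPoly, Polynomial.eval_add, Polynomial.eval_mul, Polynomial.eval_ofNat,
    Polynomial.eval_one]
  omega

end

/-- A number that remains after the query phase is not larger than the initial one. -/
theorem queryStep_iterate_le {ask : Val → Val} {a : Val → ℕ → Val} {K : ℕ} (i : ℕ) (t : Val)
    (R : ℕ) : ((queryStep ask a K)^[i] (.pair t (.num R))).snd.toNat ≤ R := by
  induction i with
  | zero => rfl
  | succ i ih =>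
    rw [Function.iterate_succ_apply']
    exact (Nat.div_le_self _ _).trans ih

/-! ### Simulation of the security experiment -/

/-- Whether some `f i` with `i < k` is nonzero: `1` if so and `0` if not. -/
def anyV (k : ℕ) (f : ℕ → ℕ) : ℕ := 1 - eqv (tab k fun i => .num (f i)) (tab k fun _ => .num 0)

theorem anyV_eq_one_iff {k : ℕ} {f : ℕ → ℕ} : anyV k f = 1 ↔ ∃ i < k, f i ≠ 0 := by
  have h : (tab k fun i => .num (f i)) = (tab k fun _ => .num 0) ↔ ∀ i < k, f i = 0 := by
    constructor
    · intro h i hi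
      have h' := congrArg (fun v => v.nth i) h
      simpa [tab, Val.nth_list, hi] using h'
    · intro h
      rw [tab, tab]
      congr 1
      exact List.map_congr_left fun i hi => by rw [h i (List.mem_range.1 hi)]
  unfold anyV eqv
  split_ifs with h'
  · rw [h] at h'
    simpa using h'
  · rw [h] at h'
    simpa using h'

theorem anyV_ne_zero_iff {k : ℕ} {f : ℕ → ℕ} : anyV k f ≠ 0 ↔ ∃ i < k, f i ≠ 0 := by
  rw [← anyV_eq_one_iff]
  have : anyV k f ≤ 1 := Nat.sub_le _ _
  omega

theorem ptn_anyV {k : Val → ℕ} {f : Val → ℕ → ℕ} (hk : PTS k)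
    (hf : PTN fun z => f z.fst z.snd.toNat) : PTN fun x => anyV (k x) (f x) := by
  have h1 := PT.tab (f := fun x i => .num (f x i)) hk hf
  have h2 := PT.tab (f := fun _ _ => .num 0) hk (.const _)
  exact .sub (.const 1) (.eqv h1 h2)

theorem eqv_ne_zero_iff {a b : Val} : eqv a b ≠ 0 ↔ a = b := by simp [eqv]

theorem one_sub_eqv_ne_zero_iff {a b : Val} : 1 - eqv a b ≠ 0 ↔ a ≠ b := by
  unfold eqv
  split_ifs with h <;> simp [h]

section

variable {𝒢 : TrilinearGenerator} (F : MatrixFamily 𝒢)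

/-- The matrix `T` of the public key, from `p`, the exponent `a` and the matrix `W` of blinding
factors. -/
def keyMatrixV (κu c : Val) (p a : ℕ) (W : Val) : Val :=
  tab (F.dim κu) fun i => tab (F.dim κu) fun j => 𝒢.gmul 0 c
    (𝒢.gpow 0 c (c.nth 2) (p * p * a * ((((F.gen κu).nth 1).nth i).nth j).toNat)) ((W.nth i).nth j)

@[fun_prop]
theorem pt_keyMatrixV {κu c W : Val → Val} {p a : Val → ℕ} (hκ : PT κu) (hc : PT c) (hp : PTN p)
    (ha : PTN a) (hW : PT W) : PT fun X => keyMatrixV F (κu X) (c X) (p X) (a X) (W X) := by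
  refine PT.tab (F.pts_dim hκ) (PT.tab (F.pts_dim (hκ.comp (.fst .id))) ?_)
  fun_prop

/-- The code of a public key. -/
def pkV (κu c h T : Val) : Val := Val.list [c, h, (F.gen κu).nth 1, T]

@[fun_prop]
theorem pt_pkV {κu c h T : Val → Val} (hκ : PT κu) (hc : PT c) (hh : PT h) (hT : PT T) :
    PT fun X => pkV F (κu X) (c X) (h X) (T X) := by
  simp only [pkV, Val.list]
  fun_prop

/-- The test for the plaintext `m` at index `i`, with value `1` if it is passed: `m` is not the
correct value, and the proof for the index `i` is valid for `m`. -/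
def forgeryEntry (κu c : Val) (p : ℕ) (W : Val) (a : ℕ) (x π : Val) (i m : ℕ) : ℕ :=
  let B := (𝒢.lenPoly + F.sizePoly + 2).eval (secpar κu)
  (1 - eqv (𝒢.gpow 0 c (𝒢.gpow 0 c (c.nth 2) p) m)
    (𝒢.gprod B (F.dim κu) c fun j => 𝒢.gpow 0 c (𝒢.gpow 0 c (c.nth 2) p)
      (((((F.gen κu).nth 1).nth i).nth j).toNat * (x.nth j).toNat))) *
  eqv (𝒢.gpow 1 c (π.nth i) p)
    (𝒢.gmul 1 c (𝒢.gpow 1 c (c.nth 3) (p * p * p * a * m))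
      (𝒢.gpow 1 c (𝒢.gpair c (𝒢.gprod B (F.dim κu) c fun j =>
        𝒢.gpow 0 c ((W.nth i).nth j) (x.nth j).toNat) (c.nth 2)) p))

/-- The test whether the proof `π` is a forgery for the input `x`. -/
def forgeryV (κu c : Val) (p : ℕ) (W : Val) (a : ℕ) (x π : Val) : ℕ :=
  anyV (F.dim κu) fun i => anyV ((F.gen κu).nth 2).size fun l =>
    forgeryEntry F κu c p W a x π i (((F.gen κu).nth 2).nth l).toNat

@[fun_prop]
theorem ptn_forgeryV {κu c W x π : Val → Val} {p a : Val → ℕ} (hκ : PT κu) (hc : PT c)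
    (hp : PTN p) (hW : PT W) (ha : PTN a) (hx : PT x) (hπ : PT π) :
    PTN fun X => forgeryV F (κu X) (c X) (p X) (W X) (a X) (x X) (π X) := by
  refine ptn_anyV (F.pts_dim hκ) (ptn_anyV (.size (by fun_prop)) ?_)
  have hB : PTS fun z => (𝒢.lenPoly + F.sizePoly + 2).eval (secpar (κu z.fst.fst)) :=
    (PTS.secpar (by fun_prop)).polynomial _
  have h1 := 𝒢.pt_gprod hB (F.pts_dim (κu := fun z => κu z.fst.fst) (by fun_prop))
    (c := fun z => c z.fst.fst) (f := fun z j => 𝒢.gpow 0 (c z.fst.fst)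
      (𝒢.gpow 0 (c z.fst.fst) ((c z.fst.fst).nth 2) (p z.fst.fst))
      (((((F.gen (κu z.fst.fst)).nth 1).nth z.fst.snd.toNat).nth j).toNat
        * ((x z.fst.fst).nth j).toNat)) (by fun_prop) (by fun_prop)
  have h2 := 𝒢.pt_gprod hB (F.pts_dim (κu := fun z => κu z.fst.fst) (by fun_prop))
    (c := fun z => c z.fst.fst) (f := fun z j => 𝒢.gpow 0 (c z.fst.fst)
      (((W z.fst.fst).nth z.fst.snd.toNat).nth j) ((x z.fst.fst).nth j).toNat)
      (by fun_prop) (by fun_prop)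
  exact .mul (.sub (.const 1) (.eqv (by fun_prop) h1)) (.eqv (by fun_prop)
    (𝒢.pt_gmul 1 (by fun_prop) (by fun_prop) (𝒢.pt_gpow 1 (by fun_prop)
      (𝒢.pt_gpair (by fun_prop) h2 (by fun_prop)) (by fun_prop))))

/-- The security experiment after the query phase, with transcript `t` and remaining coins `R`. -/
def secFinalV (A : PPT) (κu c : Val) (p : ℕ) (W h pk : Val) (a ω : ℕ) (t : Val) (R : ℕ) : ℕ :=
  let x := A.out κu ω (Val.list [.num 1, pk, t])
  F.mem κu x * forgeryV F κu c p W a x (A.out κu ω (Val.list [.num 2, pk, t,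
    sigmaV F κu c h x (R % F.vecCard κu c)])).snd

/-- The distinguisher that runs the security experiment with a given matrix of blinding factors and
tests whether the adversary `A` wins. -/
def secV (A : PPT) (B Q : Polynomial ℕ) (X : Val) : ℕ :=
  let κu := X.nth 0
  let R := (X.nth 1).toNat
  let p := ((X.nth 2).nth 0).toNat
  let q := ((X.nth 2).nth 1).toNat
  let c := (X.nth 2).nth 2
  let W := (X.nth 2).nth 3
  let N := (c.nth 1).toNat
  let ω := R % coinCard A.coins κu
  let R₁ := R / coinCard A.coins κu
  let a := R₁ % N
  let R₂ := R₁ / N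
  let h := 𝒢.gpow 0 c (𝒢.gpow 0 c (c.nth 2) (R₂ % N)) q
  let pk := pkV F κu c h (keyMatrixV F κu c p a W)
  let st := queryV F A B Q κu c h ω 0 pk (R₂ / N)
  secFinalV F A κu c p W h pk a ω st.fst st.snd.toNat

theorem ptn_secV (A : PPT) (B Q : Polynomial ℕ) : PTN (secV F A B Q) := by
  unfold secV secFinalV
  simp only [Val.list]
  fun_prop

variable {κ : ℕ} (s : 𝒢.Seed κ)

/-- The candidates for plaintexts that are tried in the test for a forgery; they include the
message space. -/
def candidates (κ : ℕ) : Finset ℕ :=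
  (Finset.range ((F.gen (Val.unary κ)).nth 2).size).image fun l =>
    (((F.gen (Val.unary κ)).nth 2).nth l).toNat

theorem gen_nth_two (κ : ℕ) :
    (F.gen (Val.unary κ)).nth 2 = Val.list ((F.msgs κ).map .num) := by rw [F.gen_unary]; rfl

theorem gen_nth_one (κ : ℕ) : (F.gen (Val.unary κ)).nth 1
    = Val.vec fun i => Val.natVec fun j => F.M κ i j := by rw [F.gen_unary]; rfl

theorem card_candidates_le (κ : ℕ) : (candidates F κ).card ≤ F.sizePoly.eval κ := by
  refine Finset.card_image_le.trans ?_
  rw [Finset.card_range]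
  refine le_trans ?_ (F.size_gen_le κ)
  exact (Val.size_fst_le _).trans (Val.size_snd_iterate_le _ _)

theorem msgs_subset_candidates {κ m : ℕ} (hm : m ∈ F.msgs κ) : m ∈ candidates F κ := by
  obtain ⟨l, hl, rfl⟩ := List.getElem_of_mem hm
  refine Finset.mem_image.2 ⟨l, Finset.mem_range.2 ?_, ?_⟩
  · rw [gen_nth_two]
    refine lt_of_lt_of_le hl ?_
    have := MatrixFamily.length_le_size_list ((F.msgs κ).map Val.num)
    rwa [List.length_map] at this
  · rw [gen_nth_two, Val.nth_list _ _ (by simpa using hl)]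
    simp

/-- The proof `π` is a forgery for the input `x`, with respect to the matrix `W` of blinding factors
and the exponent `a`: for some index it is accepted together with a wrong plaintext.  The data `π`
need not encode group elements; what counts is the result of the algorithm for exponentiation. -/
def IsForgery (W : Fin (F.n κ) → Fin (F.n κ) → (𝒢.inst κ s).G 0) (a : ℕ) (x : Fin (F.n κ) → ℕ)
    (π : Val) : Prop :=
  ∃ i : Fin (F.n κ), ∃ m ∈ candidates F κ,
    ((𝒢.inst κ s).g 0 ^ (𝒢.inst κ s).p) ^ m
      ≠ ((𝒢.inst κ s).g 0 ^ (𝒢.inst κ s).p) ^ (∑ j, F.M κ i j * x j) ∧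
    𝒢.gpow 1 (𝒢.inst κ s).code (π.nth i) (𝒢.inst κ s).p
      = (𝒢.inst κ s).enc 1 ((𝒢.inst κ s).g 1 ^ ((𝒢.inst κ s).p ^ 3 * a * m)
        * (𝒢.inst κ s).e₁₁ (∏ j, W i j ^ x j) ((𝒢.inst κ s).g 0) ^ (𝒢.inst κ s).p)

theorem forgeryV_eq_one_iff (W : Fin (F.n κ) → Fin (F.n κ) → (𝒢.inst κ s).G 0) (a : ℕ)
    (x : Fin (F.n κ) → ℕ) (π : Val) :
    forgeryV F (Val.unary κ) (𝒢.inst κ s).code (𝒢.inst κ s).p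
      (Val.vec fun i => Val.vec fun j => (𝒢.inst κ s).enc 0 (W i j)) a (Val.natVec x) π = 1
      ↔ IsForgery F s W a x π := by
  have hB : 𝒢.lenPoly.eval κ + F.n κ + 2 ≤ (𝒢.lenPoly + F.sizePoly + 2).eval κ := by
    have := F.n_le κ
    simp only [Polynomial.eval_add, Polynomial.eval_ofNat]
    omega
  have key : ∀ (i : Fin (F.n κ)) (m : ℕ),
      forgeryEntry F (Val.unary κ) (𝒢.inst κ s).code (𝒢.inst κ s).p
        (Val.vec fun i => Val.vec fun j => (𝒢.inst κ s).enc 0 (W i j)) a (Val.natVec x) π i m ≠ 0 ↔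
      ((𝒢.inst κ s).g 0 ^ (𝒢.inst κ s).p) ^ m
        ≠ ((𝒢.inst κ s).g 0 ^ (𝒢.inst κ s).p) ^ (∑ j, F.M κ i j * x j) ∧
      𝒢.gpow 1 (𝒢.inst κ s).code (π.nth i) (𝒢.inst κ s).p
        = (𝒢.inst κ s).enc 1 ((𝒢.inst κ s).g 1 ^ ((𝒢.inst κ s).p ^ 3 * a * m)
          * (𝒢.inst κ s).e₁₁ (∏ j, W i j ^ x j) ((𝒢.inst κ s).g 0) ^ (𝒢.inst κ s).p) := by
    intro i m
    have h1 := 𝒢.gprod_eq s (B := (𝒢.lenPoly + F.sizePoly + 2).eval κ)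
      (f := fun j => 𝒢.gpow 0 (𝒢.inst κ s).code (𝒢.gpow 0 (𝒢.inst κ s).code
        ((𝒢.inst κ s).code.nth 2) (𝒢.inst κ s).p)
        (((((F.gen (Val.unary κ)).nth 1).nth i).nth j).toNat * ((Val.natVec x).nth j).toNat))
      (fun j : Fin (F.n κ) =>
        ((𝒢.inst κ s).g 0 ^ (𝒢.inst κ s).p) ^ (F.M κ i j * x j)) (fun j => by
        simp [gen_nth_one, Val.natVec]) hB
    have h2 := 𝒢.gprod_eq s (B := (𝒢.lenPoly + F.sizePoly + 2).eval κ)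
      (f := fun j => 𝒢.gpow 0 (𝒢.inst κ s).code
        (((Val.vec fun i => Val.vec fun j => (𝒢.inst κ s).enc 0 (W i j)).nth i).nth j)
        ((Val.natVec x).nth j).toNat)
      (fun j : Fin (F.n κ) => W i j ^ x j) (fun j => by simp [Val.natVec]) hB
    rw [Finset.prod_pow_eq_pow_sum] at h1
    simp only [forgeryEntry, secpar_unary, F.dim_unary, h1, h2]
    simp only [TrilinearInstance.code_nth_two, TrilinearInstance.code_nth_three,
      TrilinearGenerator.gpow_enc, TrilinearGenerator.gmul_enc, TrilinearGenerator.gpair_enc,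
      one_sub_eqv_ne_zero_iff, eqv_ne_zero_iff, ((𝒢.inst κ s).enc_inj 0).ne_iff, ← pow_three',
      mul_ne_zero_iff]
  simp only [forgeryV, anyV_eq_one_iff, anyV_ne_zero_iff, F.dim_unary, IsForgery, candidates,
    Finset.mem_image, Finset.mem_range]
  constructor
  · rintro ⟨i, hi, l, hl, h⟩
    exact ⟨⟨i, hi⟩, _, ⟨l, hl, rfl⟩, (key ⟨i, hi⟩ _).1 h⟩
  · rintro ⟨i, m, ⟨l, hl, rfl⟩, h⟩
    exact ⟨i, i.2, l, hl, (key i _).2 h⟩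

open Classical in
/-- The query phase and the final phase of the security experiment for given coins `ω` of the
adversary, the element `h` and the code `pk` of a public key; the adversary wins if its output
passes `test`. -/
def secTail (A : VerAdversary) (ω : Fin (2 ^ A.coins.eval κ)) (h : (𝒢.inst κ s).G 0) (pk : Val)
    (test : (Fin (F.n κ) → ℕ) → Val → Prop) : PMF Bool :=
  (queryPhase (fun t => A.run κ ω (Val.list [.num 0, pk, t])) (pubEnc F s h)
    (A.queries.eval κ) (.num 0)).bind fun t =>
  match F.input κ (A.run κ ω (Val.list [.num 1, pk, t])) with
  | none => PMF.pure false
  | some x => (PMF.uniformOfFintype (Fin (F.n κ) → ZMod (𝒢.inst κ s).N)).bind fun r =>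
    PMF.pure (decide (test x.1
      (A.run κ ω (Val.list [.num 2, pk, t, encVec F s h x.1 r]))))

/-- The code of the public key with element `h` and matrix `T`. -/
def pkCode (h : (𝒢.inst κ s).G 0) (T : Fin (F.n κ) → Fin (F.n κ) → (𝒢.inst κ s).G 0) : Val :=
  PublicKey.code ⟨h, F.M κ, T⟩

/-- The matrix `T` for the exponent `a` and the matrix `W` of blinding factors. -/
def keyMatrix (a : ℕ) (W : Fin (F.n κ) → Fin (F.n κ) → (𝒢.inst κ s).G 0) :
    Fin (F.n κ) → Fin (F.n κ) → (𝒢.inst κ s).G 0 :=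
  fun i j => (𝒢.inst κ s).g 0 ^ ((𝒢.inst κ s).p ^ 2 * a * F.M κ i j) * W i j

/-- The security experiment with a given matrix `W` of blinding factors; the adversary wins if it
produces a forgery. -/
def secExp (A : VerAdversary) (W : Fin (F.n κ) → Fin (F.n κ) → (𝒢.inst κ s).G 0) : PMF Bool :=
  (A.coinDist κ).bind fun ω =>
  (PMF.uniformOfFintype (ZMod (𝒢.inst κ s).N)).bind fun a =>
  (PMF.uniformOfFintype ((𝒢.inst κ s).G 0)).bind fun u =>
    secTail F s A ω (u ^ (𝒢.inst κ s).q)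
      (pkCode F s (u ^ (𝒢.inst κ s).q) (keyMatrix F s a.val W))
      fun x forged => IsForgery F s W a.val x forged.snd

theorem keyMatrixV_eq (a : ℕ) (W : Fin (F.n κ) → Fin (F.n κ) → (𝒢.inst κ s).G 0) :
    keyMatrixV F (Val.unary κ) (𝒢.inst κ s).code (𝒢.inst κ s).p a
      (Val.vec fun i => Val.vec fun j => (𝒢.inst κ s).enc 0 (W i j))
      = Val.vec fun i => Val.vec fun j => (𝒢.inst κ s).enc 0 (keyMatrix F s a W i j) := by
  rw [keyMatrixV, F.dim_unary]
  refine tab_eq_vec fun i => tab_eq_vec fun j => ?_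
  simp only [gen_nth_one, Val.natVec, Val.nth_vec, Val.toNat_num, TrilinearInstance.code_nth_two,
    TrilinearGenerator.gpow_enc, TrilinearGenerator.gmul_enc, keyMatrix, ← pow_two]

theorem pkV_eq (h : (𝒢.inst κ s).G 0) (T : Fin (F.n κ) → Fin (F.n κ) → (𝒢.inst κ s).G 0) :
    pkV F (Val.unary κ) (𝒢.inst κ s).code ((𝒢.inst κ s).enc 0 h)
      (Val.vec fun i => Val.vec fun j => (𝒢.inst κ s).enc 0 (T i j)) = pkCode F s h T := by
  rw [pkV, gen_nth_one]
  rfl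

theorem sim_secTail (A : VerAdversary) (ω : Fin (2 ^ A.coins.eval κ)) (h : (𝒢.inst κ s).G 0)
    (pk : Val) (W : Fin (F.n κ) → Fin (F.n κ) → (𝒢.inst κ s).G 0) (a : ℕ) :
    Sim (((𝒢.inst κ s).N ^ F.n κ) ^ A.queries.eval κ * ((𝒢.inst κ s).N ^ F.n κ * 1))
      (secTail F s A ω h pk fun x forged => IsForgery F s W a x forged.snd) fun R =>
      let st := (queryStep (fun t => A.out (Val.unary κ) ω (Val.list [.num 0, pk, t]))
        (ansV F (Val.unary κ) (𝒢.inst κ s).code ((𝒢.inst κ s).enc 0 h))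
        ((𝒢.inst κ s).N ^ F.n κ))^[A.queries.eval κ] (.pair (.num 0) (.num R))
      decide (secFinalV F A.toPPT (Val.unary κ) (𝒢.inst κ s).code (𝒢.inst κ s).p
        (Val.vec fun i => Val.vec fun j => (𝒢.inst κ s).enc 0 (W i j)) ((𝒢.inst κ s).enc 0 h) pk a ω
        st.fst st.snd.toNat = 1) := by
  have hK : 0 < (𝒢.inst κ s).N ^ F.n κ := pow_pos (𝒢.inst κ s).N_pos _
  refine (impl_queryPhase hK (impl_pubEnc F s h) _ _).sim_bind (f₂ := fun t R =>
    decide (secFinalV F A.toPPT (Val.unary κ) (𝒢.inst κ s).code (𝒢.inst κ s).p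
        (Val.vec fun i => Val.vec fun j => (𝒢.inst κ s).enc 0 (W i j)) ((𝒢.inst κ s).enc 0 h) pk a ω
        t R = 1)) (fun t => ?_) (by positivity)
  simp only [PPT.run_eq_out]
  cases hx : F.input κ (A.out (Val.unary κ) ω (Val.list [.num 1, pk, t])) with
  | none =>
    simp only [secFinalV, F.mem_of_input_eq_none hx, zero_mul, zero_ne_one, decide_false]
    exact Sim.pure _ _
  | some x =>
    have h1 := F.mem_of_input_eq_some hx
    rw [← F.input_eq_some_iff.1 hx] at h1
    have h2 := ((decodes_zmodVec (𝒢.inst κ s) (F.n κ)).impl hK).sim_bind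
      (f₂ := fun r _ => @decide (IsForgery F s W a x.1 (A.out (Val.unary κ) ω
        (Val.list [.num 2, pk, t, encVec F s h x.1 r])).snd) (Classical.propDecidable _))
      (fun r => Sim.pure 1 _) one_pos
    refine Eq.mp (congrArg _ (funext fun R => ?_)) h2
    rw [decide_eq_decide]
    simp only [secFinalV, ← F.input_eq_some_iff.1 hx, h1, one_mul, sigmaV_natVec,
      forgeryV_eq_one_iff, F.vecCard_code]

/-- The security experiment for a given matrix of blinding factors can be run in polynomial time. -/
theorem exists_secDistinguisher (A : VerAdversary) : ∃ D : PPT, ∀ (κ : ℕ) (_ : 2 ≤ κ)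
    (s : 𝒢.Seed κ) (W : Fin (F.n κ) → Fin (F.n κ) → (𝒢.inst κ s).G 0),
    |prTrue (D.bit κ (matInput (𝒢.inst κ s) W)) - prTrue (secExp F s A W)| ≤ (1 / 2) ^ κ := by
  let X : Polynomial ℕ := Polynomial.X
  let S := F.sizePoly
  let C := A.coins + 4 * X + 2 * X * S * (A.queries + 1) + X
  obtain ⟨D, hD⟩ := exists_ppt_of_sim
    (ptn_secV F A.toPPT (queryPoly F A.queries C) A.queries) C
  refine ⟨D, fun κ hκ s W => ?_⟩
  have hN := (𝒢.inst κ s).N_pos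
  have hv : 0 < (𝒢.inst κ s).N ^ F.n κ := pow_pos hN _
  have hsim := (impl_coinDist A.toPPT κ).sim_bind (fun ω =>
    ((decodes_zmod (𝒢.inst κ s).N).impl hN).sim_bind (fun a =>
    (((𝒢.inst κ s).decodes_G 0).impl hN).sim_bind (fun u => sim_secTail F s A ω
      (u ^ (𝒢.inst κ s).q) (pkCode F s (u ^ (𝒢.inst κ s).q) (keyMatrix F s a.val W)) W a.val)
      (by positivity)) (by positivity)) (by positivity)
  refine hD κ _ _ _ _ (by positivity) ?_ hsim fun R hR => ?_
  · have h2 := (𝒢.N_lt s hκ).le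
    have h3 := F.N_pow_le s hκ
    calc _ ≤ 2 ^ A.coins.eval κ * (2 ^ (2 * κ) * (2 ^ (2 * κ) *
          ((2 ^ (2 * κ * S.eval κ)) ^ A.queries.eval κ * (2 ^ (2 * κ * S.eval κ) * 1)))) * 2 ^ κ := by
          gcongr
      _ = _ := by
        simp only [mul_one, ← pow_add, ← pow_mul, Polynomial.eval_add, Polynomial.eval_mul, X, C,
          Polynomial.eval_X, Polynomial.eval_ofNat, Polynomial.eval_one]
        congr 1; ring
  · have hR' : R / 2 ^ A.coins.eval κ / (𝒢.inst κ s).N / (𝒢.inst κ s).N < 2 ^ C.eval κ :=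
      (((Nat.div_le_self _ _).trans (Nat.div_le_self _ _)).trans (Nat.div_le_self _ _)).trans_lt hR
    have hX : ∀ a b c : Val, (Val.list [a, b, c]).nth 0 = a ∧ (Val.list [a, b, c]).nth 1 = b ∧
      (Val.list [a, b, c]).nth 2 = c := fun _ _ _ => ⟨rfl, rfl, rfl⟩
    have hI : ∀ a b c d : Val, (Val.list [a, b, c, d]).nth 0 = a ∧
      (Val.list [a, b, c, d]).nth 1 = b ∧ (Val.list [a, b, c, d]).nth 2 = c ∧
      (Val.list [a, b, c, d]).nth 3 = d := fun _ _ _ _ => ⟨rfl, rfl, rfl, rfl⟩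
    simp only [secV, matInput, hX, hI, Val.toNat_num, coinCard_unary,
      TrilinearInstance.code_nth_one, TrilinearInstance.code_nth_two, TrilinearGenerator.gpow_enc,
      keyMatrixV_eq, pkV_eq, queryV_eq F s A.toPPT A.queries C _ _ _ _ hR', decide_eq_true_eq,
      ZMod.val_natCast, Nat.mod_mod, Fin.val_ofNat]

end

/-! ### Security -/

theorem hybridExp_zero {Γ : TrilinearInstance} {n : ℕ} (f : (Fin n → Fin n → Γ.G 0) → PMF Bool) :
    hybridExp f 0 = (PMF.uniformOfFintype (Fin n → ZMod Γ.N)).bind fun α =>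
      (PMF.uniformOfFintype (Fin n → ZMod Γ.N)).bind fun β =>
      (PMF.uniformOfFintype (Fin n → Γ.G 0)).bind fun A =>
      (PMF.uniformOfFintype (Fin n → Γ.G 0)).bind fun B => f (PRFKey.F ⟨α, β, A, B⟩) := by
  have h : ∀ (W : Fin n → Fin n → Γ.G 0) α β A B, hybrid 0 W α β A B = PRFKey.F ⟨α, β, A, B⟩ :=
    fun _ _ _ _ _ => rfl
  simp only [hybridExp, h, PMF.bind_const]

theorem hybridExp_self {Γ : TrilinearInstance} {n : ℕ} (f : (Fin n → Fin n → Γ.G 0) → PMF Bool) :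
    hybridExp f n = (PMF.uniformOfFintype (Fin n → Fin n → Γ.G 0)).bind f := by
  have h : ∀ (W : Fin n → Fin n → Γ.G 0) α β A B, hybrid n W α β A B = W := by
    intro W α β A B
    funext i j
    exact if_pos i.2
  simp only [hybridExp, h, PMF.bind_const]

theorem prTrue_pure_mono {b c : Bool} (h : b = true → c = true) :
    prTrue (PMF.pure b) ≤ prTrue (PMF.pure c) := by
  cases b
  · simpa [prTrue_pure] using prTrue_nonneg (PMF.pure c)
  · rw [h rfl]

open Classical in
/-- The probability that a uniform element satisfies a predicate. -/
theorem prTrue_uniform_bind_decide {α : Type} [Fintype α] [Nonempty α] (P : α → Prop) :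
    prTrue ((PMF.uniformOfFintype α).bind fun a => PMF.pure (decide (P a)))
      = ((Finset.univ.filter P).card : ℝ) / Fintype.card α := by
  rw [prTrue_uniform_bind]
  simp [prTrue_pure]

theorem mul_eq_mul_of_cross {G : Type} [CommGroup G] {x x' y y' z z' w : G} (h : x * z = x' * z')
    (hz : z * y = w) (hz' : z' * y' = w) : x * y' = x' * y := by
  refine mul_right_cancel (b := w) ?_
  calc x * y' * w = x * z * (y * y') := by rw [← hz]; ac_rfl
    _ = x' * y * w := by rw [h, ← hz']; ac_rfl

/-- A residue class modulo `q` has at most `p` elements modulo `p * q`. -/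
theorem card_le_of_modEq {N p q : ℕ} [NeZero N] (hN : N = p * q) (S : Finset (ZMod N))
    (h : ∀ a ∈ S, ∀ b ∈ S, a.val ≡ b.val [MOD q]) : S.card ≤ p := by
  rw [← Finset.card_range p]
  refine Finset.card_le_card_of_injOn (fun a => a.val / q) (fun a _ => ?_) fun a ha b hb hab => ?_
  · exact Finset.mem_coe.2 (Finset.mem_range.2 (Nat.div_lt_of_lt_mul
      ((ZMod.val_lt a).trans_eq (hN.trans (mul_comm _ _)))))
  · refine ZMod.val_injective _ ?_
    rw [← Nat.div_add_mod a.val q, ← Nat.div_add_mod b.val q]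
    exact congrArg₂ _ (congrArg _ hab) (h a ha b hb)

section

variable {𝒢 : TrilinearGenerator} (F : MatrixFamily 𝒢) {κ : ℕ} (s : 𝒢.Seed κ)

theorem msg_mem_candidates_of_decryptC {c : (𝒢.inst κ s).G 0} {m : ℕ}
    (h : (decryptC (F.msgs κ) c).val = some m) : m ∈ candidates F κ := by
  rw [decryptC_val] at h
  exact msgs_subset_candidates F (List.mem_of_find?_eq_some h)

/-- If `Verify` accepts a wrong result, then the answer contains a forgery. -/
theorem isForgery_of_verifyC {pk : PublicKey (𝒢.inst κ s) (F.n κ)}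
    {sk : SecretKey (𝒢.inst κ s) (F.n κ)}
    (hη : sk.η = (𝒢.inst κ s).g 2 ^ ((𝒢.inst κ s).p ^ 2 * sk.a.val))
    {x : Fin (F.n κ) → ℕ} {r : Fin (F.n κ) → ZMod (𝒢.inst κ s).N}
    {ρ : Fin (F.n κ) → (𝒢.inst κ s).G 0} {π : Fin (F.n κ) → (𝒢.inst κ s).G 1}
    {y : Fin (F.n κ) → ZMod (𝒢.inst κ s).q}
    (h : (verifyC (F.msgs κ) sk (probGenWith pk sk x r).val.2 ρ π).val = some y)
    (hy : y ≠ evalFun (𝒢.inst κ s) (F.M κ) x) :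
    IsForgery F s sk.K.F sk.a.val x (Val.vec fun i => (𝒢.inst κ s).enc 1 (π i)) := by
  rw [verifyC_val_eq_some_iff] at h
  obtain ⟨i, hi⟩ := Function.ne_iff.1 hy
  obtain ⟨m, hm, hv, hym⟩ := h i
  refine ⟨i, m, msg_mem_candidates_of_decryptC F s hm, ?_, ?_⟩
  · rw [Ne, TrilinearInstance.g_pow_p_eq_iff, natCast_sum_eq_evalFun, ← hym]
    exact hi
  · simp only [probGenWith_val, prod_F_pow] at hv
    rw [hη, TrilinearInstance.check_iff] at hv
    rw [Val.nth_vec, TrilinearGenerator.gpow_enc, hv]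

open Classical in
/-- The security experiment is the one of `secExp` for the pseudorandom matrix. -/
theorem prTrue_verExp_le (A : VerAdversary) (κ : ℕ) : prTrue (verExp 𝒢 F A κ) ≤
    prTrue ((𝒢.sample κ).bind fun s => hybridExp (n := F.n κ) (fun W => secExp F s A W) 0) := by
  unfold verExp
  simp only [bind, pure, keyGen, PMF.bind_bind, PMF.pure_bind]
  refine prTrue_bind_mono _ fun s _ => ?_
  rw [hybridExp_zero]
  rw [PMF.bind_comm (A.coinDist κ)]
  refine prTrue_bind_mono _ fun α _ => ?_
  rw [PMF.bind_comm (A.coinDist κ)]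
  refine prTrue_bind_mono _ fun β _ => ?_
  rw [PMF.bind_comm (A.coinDist κ)]
  refine prTrue_bind_mono _ fun A' _ => ?_
  rw [PMF.bind_comm (A.coinDist κ)]
  refine prTrue_bind_mono _ fun B' _ => prTrue_bind_mono _ fun ω _ => prTrue_bind_mono _ fun a _ =>
    prTrue_bind_mono _ fun u _ => ?_
  rw [pubProbGen_eq]
  refine prTrue_bind_mono _ fun t _ => ?_
  change prTrue (match F.input κ (A.run κ ω (Val.list [.num 1, pkCode F s
    (u ^ (𝒢.inst κ s).q) (keyMatrix F s a.val (PRFKey.F ⟨α, β, A', B'⟩)), t])) with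
    | none => _
    | some x => _) ≤ _
  cases F.input κ (A.run κ ω (Val.list [.num 1, pkCode F s
    (u ^ (𝒢.inst κ s).q) (keyMatrix F s a.val (PRFKey.F ⟨α, β, A', B'⟩)), t])) with
  | none => exact le_rfl
  | some x =>
    simp only [probGen, bind, pure, PMF.bind_bind, PMF.pure_bind]
    refine prTrue_bind_mono _ fun r _ => ?_
    split
    · rw [prTrue_pure]
      exact prTrue_nonneg _
    · rename_i ρ π hparse
      rw [MatrixFamily.parse_eq_some_iff] at hparse
      · refine prTrue_pure_mono fun h1 => ?_
        rw [decide_eq_true_eq] at h1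
        refine @decide_eq_true _ _ ?_
        obtain ⟨y, hy⟩ := Option.ne_none_iff_exists'.1 h1.2
        have := isForgery_of_verifyC F s rfl hy fun h => h1.1 (by rw [hy, h])
        have h3 := congrArg Val.snd hparse
        rw [Val.snd_pair] at h3
        rw [h3] at this
        exact this
      · rintro ⟨ρ₁, π₁⟩ ⟨ρ₂, π₂⟩ h
        simp only [Val.pair.injEq] at h
        refine Prod.ext (funext fun i => ?_) (funext fun i => ?_)
        · have := congrArg (fun v => v.nth i) h.1
          exact (𝒢.inst κ s).enc_inj 0 (by simpa using this)
        · have := congrArg (fun v => v.nth i) h.2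
          exact (𝒢.inst κ s).enc_inj 1 (by simpa using this)

/-- The matrix of blinding factors that belongs to the matrix `T` and the exponent `a`. -/
def unmask (a : ℕ) (T : Fin (F.n κ) → Fin (F.n κ) → (𝒢.inst κ s).G 0) :
    Fin (F.n κ) → Fin (F.n κ) → (𝒢.inst κ s).G 0 :=
  fun i j => ((𝒢.inst κ s).g 0 ^ ((𝒢.inst κ s).p ^ 2 * a * F.M κ i j))⁻¹ * T i j

theorem unmask_keyMatrix (a : ℕ) (W : Fin (F.n κ) → Fin (F.n κ) → (𝒢.inst κ s).G 0) :
    unmask F s a (keyMatrix F s a W) = W := by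
  funext i j
  simp [unmask, keyMatrix]

theorem keyMatrix_unmask (a : ℕ) (T : Fin (F.n κ) → Fin (F.n κ) → (𝒢.inst κ s).G 0) :
    keyMatrix F s a (unmask F s a T) = T := by
  funext i j
  simp [unmask, keyMatrix]

/-- For a given row `T` of the public matrix, the same proof is a forgery with the same plaintext
for at most one exponent `a` modulo `q`. -/
theorem modEq_of_forgery {Γ : TrilinearInstance} {n : ℕ} {M x : Fin n → ℕ} {T : Fin n → Γ.G 0}
    {m a b : ℕ} (hm : (Γ.g 0 ^ Γ.p) ^ m ≠ (Γ.g 0 ^ Γ.p) ^ (∑ j, M j * x j))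
    (h : Γ.g 1 ^ (Γ.p ^ 3 * a * m)
        * Γ.e₁₁ (∏ j, ((Γ.g 0 ^ (Γ.p ^ 2 * a * M j))⁻¹ * T j) ^ x j) (Γ.g 0) ^ Γ.p
      = Γ.g 1 ^ (Γ.p ^ 3 * b * m)
        * Γ.e₁₁ (∏ j, ((Γ.g 0 ^ (Γ.p ^ 2 * b * M j))⁻¹ * T j) ^ x j) (Γ.g 0) ^ Γ.p) :
    a ≡ b [MOD Γ.q] := by
  rw [Ne, TrilinearInstance.g_pow_p_eq_iff] at hm
  set y := ∑ j, M j * x j with hy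
  have key : ∀ c : ℕ, Γ.e₁₁ (∏ j, ((Γ.g 0 ^ (Γ.p ^ 2 * c * M j))⁻¹ * T j) ^ x j) (Γ.g 0) ^ Γ.p
      * Γ.g 1 ^ (Γ.p ^ 3 * c * y) = Γ.e₁₁ (∏ j, T j ^ x j) (Γ.g 0) ^ Γ.p := by
    intro c
    have h1 : Γ.g 1 ^ (Γ.p ^ 3 * c * y) = Γ.e₁₁ (Γ.g 0 ^ (Γ.p ^ 2 * c * y)) (Γ.g 0) ^ Γ.p := by
      rw [TrilinearInstance.e₁₁, TrilinearInstance.e_g_right, ← pow_mul]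
      congr 1; ring
    have h2 : Γ.g 0 ^ (Γ.p ^ 2 * c * y) = ∏ j, (Γ.g 0 ^ (Γ.p ^ 2 * c * M j)) ^ x j := by
      simp only [← pow_mul]
      rw [Finset.prod_pow_eq_pow_sum, hy, Finset.mul_sum]
      simp only [mul_assoc]
    rw [h1, ← mul_pow, TrilinearInstance.e₁₁, ← TrilinearInstance.e_mul_left, h2,
      ← Finset.prod_mul_distrib]
    congr 2
    refine Finset.prod_congr rfl fun j _ => ?_
    rw [← mul_pow, mul_right_comm, inv_mul_cancel, one_mul]
  have h3 : Γ.g 1 ^ (Γ.p ^ 3 * (a * m + b * y)) = Γ.g 1 ^ (Γ.p ^ 3 * (b * m + a * y)) := by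
    rw [mul_add, mul_add, pow_add, pow_add]
    simp only [← mul_assoc]
    exact mul_eq_mul_of_cross h (key a) (key b)
  have : Fact Γ.q.Prime := ⟨Γ.prime_q⟩
  have hp : (Γ.p : ZMod Γ.q) ≠ 0 := by
    rw [Ne, ZMod.natCast_eq_zero_iff, Nat.prime_dvd_prime_iff_eq Γ.prime_q Γ.prime_p]
    exact Γ.p_ne_q.symm
  rw [TrilinearInstance.g_pow_eq_iff] at h3
  have h4 := (ZMod.natCast_eq_natCast_iff _ _ Γ.q).2 (h3.of_mul_left Γ.p)
  push_cast at h4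
  have h5 := mul_left_cancel₀ (pow_ne_zero 3 hp) h4
  have h6 : ((a : ZMod Γ.q) - b) * (m - y) = 0 := by linear_combination h5
  rw [mul_eq_zero, sub_eq_zero, sub_eq_zero] at h6
  exact (ZMod.natCast_eq_natCast_iff _ _ _).1 (h6.resolve_right hm)

/-- A fixed proof is a forgery for a small fraction of the exponents `a` only, if the matrix `T` of
the public key is fixed. -/
theorem prTrue_isForgery_le (T : Fin (F.n κ) → Fin (F.n κ) → (𝒢.inst κ s).G 0)
    (x : Fin (F.n κ) → ℕ) (π : Val) :
    prTrue ((PMF.uniformOfFintype (ZMod (𝒢.inst κ s).N)).bind fun a =>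
      PMF.pure (@decide (IsForgery F s (unmask F s a.val T) a.val x π) (Classical.propDecidable _)))
      ≤ F.n κ * (candidates F κ).card / (𝒢.inst κ s).q := by
  classical
  rw [prTrue_uniform_bind_decide, ZMod.card]
  have hp : (0 : ℝ) < (𝒢.inst κ s).p := by exact_mod_cast (𝒢.inst κ s).prime_p.pos
  have hq : (0 : ℝ) < (𝒢.inst κ s).q := by exact_mod_cast (𝒢.inst κ s).prime_q.pos
  have h : (Finset.univ.filter fun a : ZMod (𝒢.inst κ s).N =>
      IsForgery F s (unmask F s a.val T) a.val x π).card
      ≤ F.n κ * (candidates F κ).card * (𝒢.inst κ s).p := by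
    let P : Fin (F.n κ) × ℕ → ZMod (𝒢.inst κ s).N → Prop := fun im a =>
      ((𝒢.inst κ s).g 0 ^ (𝒢.inst κ s).p) ^ im.2
        ≠ ((𝒢.inst κ s).g 0 ^ (𝒢.inst κ s).p) ^ (∑ j, F.M κ im.1 j * x j) ∧
      𝒢.gpow 1 (𝒢.inst κ s).code (π.nth im.1) (𝒢.inst κ s).p
        = (𝒢.inst κ s).enc 1 ((𝒢.inst κ s).g 1 ^ ((𝒢.inst κ s).p ^ 3 * a.val * im.2)
          * (𝒢.inst κ s).e₁₁ (∏ j, unmask F s a.val T im.1 j ^ x j) ((𝒢.inst κ s).g 0)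
            ^ (𝒢.inst κ s).p)
    have h1 : (Finset.univ.filter fun a : ZMod (𝒢.inst κ s).N =>
        IsForgery F s (unmask F s a.val T) a.val x π) ⊆
        ((Finset.univ : Finset (Fin (F.n κ))) ×ˢ candidates F κ).biUnion fun im =>
          Finset.univ.filter (P im) := by
      intro a ha
      obtain ⟨i, m, hm, hP⟩ := (Finset.mem_filter.1 ha).2
      exact Finset.mem_biUnion.2 ⟨(i, m), Finset.mem_product.2 ⟨Finset.mem_univ _, hm⟩,
        Finset.mem_filter.2 ⟨Finset.mem_univ _, hP⟩⟩
    refine (Finset.card_le_card h1).trans ((Finset.card_biUnion_le_card_mul _ _ (𝒢.inst κ s).p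
      fun im _ => card_le_of_modEq (N := (𝒢.inst κ s).N) rfl _ fun a ha b hb => ?_).trans_eq ?_)
    · obtain ⟨hm, ha⟩ := (Finset.mem_filter.1 ha).2
      obtain ⟨-, hb⟩ := (Finset.mem_filter.1 hb).2
      exact modEq_of_forgery hm ((𝒢.inst κ s).enc_inj 1 (ha.symm.trans hb))
    · rw [Finset.card_product, Finset.card_univ, Fintype.card_fin]
  have hN : ((𝒢.inst κ s).N : ℝ) = (𝒢.inst κ s).p * (𝒢.inst κ s).q := by
    exact_mod_cast rfl
  rw [div_le_div_iff₀ (by rw [hN]; positivity) hq, hN]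
  calc _ ≤ ((F.n κ * (candidates F κ).card * (𝒢.inst κ s).p : ℕ) : ℝ) * (𝒢.inst κ s).q := by
        gcongr
    _ = _ := by push_cast; ring

/-- If the continuation of the experiment wins with small probability over `a`, then so does the
experiment. -/
theorem prTrue_bind_secTail_le (A : VerAdversary) (ω : Fin (2 ^ A.coins.eval κ))
    (h : (𝒢.inst κ s).G 0) (pk : Val) {α : Type} (μ : PMF α)
    (test : α → (Fin (F.n κ) → ℕ) → Val → Prop) {c : ℝ} (hc : 0 ≤ c)
    (H : ∀ x v, prTrue (μ.bind fun a =>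
      PMF.pure (@decide (test a x v) (Classical.propDecidable _))) ≤ c) :
    prTrue (μ.bind fun a => secTail F s A ω h pk (test a)) ≤ c := by
  unfold secTail
  rw [PMF.bind_comm]
  refine prTrue_bind_le _ fun t => ?_
  cases F.input κ (A.run κ ω (Val.list [.num 1, pk, t])) with
  | none => simpa [PMF.bind_const, prTrue_pure] using hc
  | some x =>
    rw [PMF.bind_comm]
    exact prTrue_bind_le _ fun r => H _ _

theorem bijective_keyMatrix (a : ℕ) : Function.Bijective (keyMatrix F s a) :=
  Function.bijective_iff_has_inverse.2
    ⟨unmask F s a, unmask_keyMatrix F s a, keyMatrix_unmask F s a⟩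

/-- With a uniform matrix of blinding factors, the public key is independent of the exponent `a`,
and forgeries are unlikely unconditionally. -/
theorem prTrue_secExp_random_le (A : VerAdversary) :
    prTrue (hybridExp (n := F.n κ) (fun W => secExp F s A W) (F.n κ))
      ≤ F.n κ * (candidates F κ).card / (𝒢.inst κ s).q := by
  rw [hybridExp_self]
  unfold secExp
  rw [PMF.bind_comm]
  refine prTrue_bind_le _ fun ω => ?_
  rw [PMF.bind_comm]
  have h : ∀ a : ZMod (𝒢.inst κ s).N,
      ((PMF.uniformOfFintype (Fin (F.n κ) → Fin (F.n κ) → (𝒢.inst κ s).G 0)).bind fun W =>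
        (PMF.uniformOfFintype ((𝒢.inst κ s).G 0)).bind fun u =>
          secTail F s A ω (u ^ (𝒢.inst κ s).q)
            (pkCode F s (u ^ (𝒢.inst κ s).q) (keyMatrix F s a.val W))
            fun x forged => IsForgery F s W a.val x forged.snd)
      = (PMF.uniformOfFintype (Fin (F.n κ) → Fin (F.n κ) → (𝒢.inst κ s).G 0)).bind fun T =>
        (PMF.uniformOfFintype ((𝒢.inst κ s).G 0)).bind fun u =>
          secTail F s A ω (u ^ (𝒢.inst κ s).q) (pkCode F s (u ^ (𝒢.inst κ s).q) T)
            fun x forged => IsForgery F s (unmask F s a.val T) a.val x forged.snd := by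
    intro a
    refine Eq.trans ?_ (uniform_bind_bijective (bijective_keyMatrix F s a.val) _)
    simp only [unmask_keyMatrix]
  simp only [h]
  rw [PMF.bind_comm]
  refine prTrue_bind_le _ fun T => ?_
  rw [PMF.bind_comm]
  exact prTrue_bind_le _ fun u => prTrue_bind_secTail_le F s A ω _ _ _ _ (by positivity)
    fun x v => prTrue_isForgery_le F s T x v.snd

end

theorem isSecure (𝒢 : TrilinearGenerator) (F : MatrixFamily 𝒢) (hD : DLIN 𝒢) : IsSecure 𝒢 F := by
  intro A
  obtain ⟨D, h_dist⟩ := exists_secDistinguisher F A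
  have hneg := (matrix_pseudorandom F hD D).add
    ((Negligible.half_pow.const_mul 2).add (((Negligible.half_pow.const_mul 4).polynomial_mul
      F.sizePoly).polynomial_mul F.sizePoly))
  refine hneg.of_abs_le fun κ hκ => ?_
  rw [abs_of_nonneg (prTrue_nonneg _)]
  have h1 := prTrue_verExp_le F A κ
  have h2 : ∀ k, |prTrue ((𝒢.sample κ).bind fun s => hybridExp (n := F.n κ)
      (fun W => D.bit κ (matInput (𝒢.inst κ s) W)) k)
      - prTrue ((𝒢.sample κ).bind fun s => hybridExp (n := F.n κ) (fun W => secExp F s A W) k)|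
      ≤ (1 / 2) ^ κ := by
    intro k
    refine abs_prTrue_bind_sub_le _ fun s => ?_
    unfold hybridExp
    exact abs_prTrue_bind_sub_le _ fun W => abs_prTrue_bind_sub_le _ fun α =>
      abs_prTrue_bind_sub_le _ fun β => abs_prTrue_bind_sub_le _ fun A' =>
      abs_prTrue_bind_sub_le _ fun B' => h_dist κ hκ s _
  have h3 : prTrue ((𝒢.sample κ).bind fun s =>
      hybridExp (n := F.n κ) (fun W => secExp F s A W) (F.n κ))
      ≤ (F.sizePoly.eval κ : ℕ) * ((F.sizePoly.eval κ : ℕ) * (4 * (1 / 2) ^ κ)) := by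
    refine prTrue_bind_le _ fun s => (prTrue_secExp_random_le F s A).trans ?_
    have h4 : (F.n κ : ℝ) ≤ (F.sizePoly.eval κ : ℕ) := by exact_mod_cast F.n_le κ
    have h5 : ((candidates F κ).card : ℝ) ≤ (F.sizePoly.eval κ : ℕ) := by
      exact_mod_cast card_candidates_le F κ
    have h6 : 1 / ((𝒢.inst κ s).q : ℝ) ≤ 4 * (1 / 2) ^ κ := by
      have := 𝒢.inv_p_add_inv_q_le s hκ
      have : 0 ≤ 1 / ((𝒢.inst κ s).p : ℝ) := by positivity
      linarith
    rw [div_eq_mul_one_div, mul_assoc]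
    gcongr
  have h4 := abs_le.1 (h2 0)
  have h5 := abs_le.1 (h2 (F.n κ))
  have h6 := le_abs_self (prTrue (matrixExp F D true κ) - prTrue (matrixExp F D false κ))
  change prTrue ((𝒢.sample κ).bind fun s => hybridExp (n := F.n κ)
      (fun W => D.bit κ (matInput (𝒢.inst κ s) W)) 0) - prTrue ((𝒢.sample κ).bind fun s =>
      hybridExp (n := F.n κ) (fun W => D.bit κ (matInput (𝒢.inst κ s) W)) (F.n κ)) ≤ _ at h6
  linarith

/-! ### Simulation of the privacy experiment -/

section

variable {𝒢 : TrilinearGenerator} (F : MatrixFamily 𝒢)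

/-- The privacy experiment for a given public key, with the coins `R` after those of the adversary;
`q₁` and `q₂` perform the two query phases. -/
def priTailV (A : PPT) (κu c h pk : Val) (ω : ℕ) (q₁ : ℕ → Val) (q₂ : Val → ℕ → Val) (R : ℕ) : ℕ :=
  let st := q₁ R
  let b := st.snd.toNat % 2
  let R' := st.snd.toNat / 2
  let ch := A.out κu ω (Val.list [.num 1, pk, st.fst])
  let view := Val.list [pk, st.fst, ch.fst, ch.snd,
    sigmaV F κu c h (Val.cond b ch.snd ch.fst) (R' % F.vecCard κu c)]
  F.mem κu ch.fst * F.mem κu ch.snd *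
    eqv (A.out κu ω (Val.list [.num 3, view, (q₂ view (R' / F.vecCard κu c)).fst])) (.num b)

theorem ptn_priTailV (A : PPT) (B₁ Q₁ B₂ Q₂ : Polynomial ℕ) {κu c h pk : Val → Val} {ω R : Val → ℕ}
    (hκ : PT κu) (hc : PT c) (hh : PT h) (hpk : PT pk) (hω : PTN ω) (hR : PTN R) :
    PTN fun X => priTailV F A (κu X) (c X) (h X) (pk X) (ω X)
      (queryV F A B₁ Q₁ (κu X) (c X) (h X) (ω X) 0 (pk X))
      (queryV F A B₂ Q₂ (κu X) (c X) (h X) (ω X) 2) (R X) := by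
  dsimp only [priTailV]
  simp only [Val.list]
  fun_prop

/-- The distinguisher that runs the privacy experiment with a given matrix of blinding factors. -/
def priMatrixV (A : PPT) (B₁ Q₁ B₂ Q₂ : Polynomial ℕ) (X : Val) : ℕ :=
  let κu := X.nth 0
  let R := (X.nth 1).toNat
  let p := ((X.nth 2).nth 0).toNat
  let q := ((X.nth 2).nth 1).toNat
  let c := (X.nth 2).nth 2
  let W := (X.nth 2).nth 3
  let N := (c.nth 1).toNat
  let ω := R % coinCard A.coins κu
  let R₁ := R / coinCard A.coins κu
  let a := R₁ % N
  let R₂ := R₁ / N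
  let h := 𝒢.gpow 0 c (𝒢.gpow 0 c (c.nth 2) (R₂ % N)) q
  let pk := pkV F κu c h (keyMatrixV F κu c p a W)
  priTailV F A κu c h pk ω (queryV F A B₁ Q₁ κu c h ω 0 pk) (queryV F A B₂ Q₂ κu c h ω 2) (R₂ / N)

theorem ptn_priMatrixV (A : PPT) (B₁ Q₁ B₂ Q₂ : Polynomial ℕ) :
    PTN (priMatrixV F A B₁ Q₁ B₂ Q₂) := by
  unfold priMatrixV
  dsimp only
  exact ptn_priTailV F A B₁ Q₁ B₂ Q₂ (by fun_prop) (by fun_prop) (by fun_prop) (by fun_prop)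
    (by fun_prop) (by fun_prop)

/-- The matrix of group elements with number `R`. -/
def randMatrixV (κu c : Val) (R : ℕ) : Val :=
  tab (F.dim κu) fun i => tab (F.dim κu) fun j =>
    𝒢.gpow 0 c (c.nth 2) (F.digit κu c (F.rowDigit κu c R i) j)

@[fun_prop]
theorem pt_randMatrixV {κu c : Val → Val} {R : Val → ℕ} (hκ : PT κu) (hc : PT c) (hR : PTN R) :
    PT fun X => randMatrixV F (κu X) (c X) (R X) := by
  refine PT.tab (F.pts_dim hκ) (PT.tab (F.pts_dim (hκ.comp (.fst .id))) ?_)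
  fun_prop

/-- The reduction to the subgroup decision assumption: it runs the privacy experiment with a uniform
matrix `T` in the public key, and with the challenge as the element `h`. -/
def priSubgroupV (A : PPT) (B₁ Q₁ B₂ Q₂ : Polynomial ℕ) (X : Val) : ℕ :=
  let κu := X.nth 0
  let R := (X.nth 1).toNat
  let c := (X.nth 2).nth 0
  let h := (X.nth 2).nth 1
  let ω := R % coinCard A.coins κu
  let R₁ := R / coinCard A.coins κu
  let pk := pkV F κu c h (randMatrixV F κu c (R₁ % F.matCard κu c))
  priTailV F A κu c h pk ω (queryV F A B₁ Q₁ κu c h ω 0 pk) (queryV F A B₂ Q₂ κu c h ω 2)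
    (R₁ / F.matCard κu c)

theorem ptn_priSubgroupV (A : PPT) (B₁ Q₁ B₂ Q₂ : Polynomial ℕ) :
    PTN (priSubgroupV F A B₁ Q₁ B₂ Q₂) := by
  unfold priSubgroupV
  dsimp only
  exact ptn_priTailV F A B₁ Q₁ B₂ Q₂ (by fun_prop) (by fun_prop) (by fun_prop) (by fun_prop)
    (by fun_prop) (by fun_prop)

variable {κ : ℕ} (s : 𝒢.Seed κ)

theorem randMatrixV_eq (R : ℕ) : randMatrixV F (Val.unary κ) (𝒢.inst κ s).code R
    = Val.vec fun i : Fin (F.n κ) => Val.vec fun j : Fin (F.n κ) => (𝒢.inst κ s).enc 0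
      ((𝒢.inst κ s).g 0 ^ (R / ((𝒢.inst κ s).N ^ F.n κ) ^ (i : ℕ)
        % (𝒢.inst κ s).N ^ F.n κ / (𝒢.inst κ s).N ^ (j : ℕ) % (𝒢.inst κ s).N)) := by
  rw [randMatrixV, F.dim_unary]
  refine tab_eq_vec fun i => tab_eq_vec fun j => ?_
  simp only [MatrixFamily.digit_code, MatrixFamily.rowDigit_code, TrilinearInstance.code_nth_two,
    TrilinearGenerator.gpow_enc]

/-- What the adversary sees at the challenge. -/
def challengeView (h : (𝒢.inst κ s).G 0) (pk t : Val) (x₀ x₁ : F.D κ) (b : Bool)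
    (r : Fin (F.n κ) → ZMod (𝒢.inst κ s).N) : Val :=
  Val.list [pk, t, Val.natVec x₀.1, Val.natVec x₁.1, encVec F s h (if b then x₁.1 else x₀.1) r]

/-- The privacy experiment for given coins `ω` of the adversary, the element `h` and the code `pk`
of a public key. -/
def priTail (A : PriAdversary) (ω : Fin (2 ^ A.coins.eval κ)) (h : (𝒢.inst κ s).G 0) (pk : Val) :
    PMF Bool :=
  (queryPhase (fun t => A.run κ ω (Val.list [.num 0, pk, t])) (pubEnc F s h)
    (A.queries₁.eval κ) (.num 0)).bind fun t =>
  match F.input κ (A.run κ ω (Val.list [.num 1, pk, t])).fst,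
    F.input κ (A.run κ ω (Val.list [.num 1, pk, t])).snd with
  | some x₀, some x₁ => (PMF.uniformOfFintype Bool).bind fun b =>
    (PMF.uniformOfFintype (Fin (F.n κ) → ZMod (𝒢.inst κ s).N)).bind fun r =>
    (queryPhase (fun t' => A.run κ ω
      (Val.list [.num 2, challengeView F s h pk t x₀ x₁ b r, t'])) (pubEnc F s h)
      (A.queries₂.eval κ) (.num 0)).bind fun t' =>
    PMF.pure (decide (A.run κ ω (Val.list [.num 3, challengeView F s h pk t x₀ x₁ b r, t'])
      = .num (if b then 1 else 0)))
  | _, _ => PMF.pure false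

/-- The query phase with unbounded states. -/
def queryIter (A : PPT) (Q : ℕ) (h : (𝒢.inst κ s).G 0) (ω i : ℕ) (view : Val) (R : ℕ) : Val :=
  (queryStep (fun t => A.out (Val.unary κ) ω (Val.list [.num i, view, t]))
    (ansV F (Val.unary κ) (𝒢.inst κ s).code ((𝒢.inst κ s).enc 0 h))
    ((𝒢.inst κ s).N ^ F.n κ))^[Q] (.pair (.num 0) (.num R))

theorem sim_priTail (A : PriAdversary) (ω : Fin (2 ^ A.coins.eval κ)) (h : (𝒢.inst κ s).G 0)
    (pk : Val) :
    Sim (((𝒢.inst κ s).N ^ F.n κ) ^ A.queries₁.eval κ * (2 * ((𝒢.inst κ s).N ^ F.n κ *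
      (((𝒢.inst κ s).N ^ F.n κ) ^ A.queries₂.eval κ * 1)))) (priTail F s A ω h pk) fun R =>
      decide (priTailV F A.toPPT (Val.unary κ) (𝒢.inst κ s).code ((𝒢.inst κ s).enc 0 h) pk ω
        (queryIter F s A.toPPT (A.queries₁.eval κ) h ω 0 pk)
        (queryIter F s A.toPPT (A.queries₂.eval κ) h ω 2) R = 1) := by
  have hK : 0 < (𝒢.inst κ s).N ^ F.n κ := pow_pos (𝒢.inst κ s).N_pos _
  -- The first query phase enters the program only through its final state.
  refine (impl_queryPhase hK (impl_pubEnc F s h) _ _).sim_bind (f₂ := fun t R =>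
    decide (priTailV F A.toPPT (Val.unary κ) (𝒢.inst κ s).code ((𝒢.inst κ s).enc 0 h) pk ω
        (fun R => .pair t (.num R))
        (queryIter F s A.toPPT (A.queries₂.eval κ) h ω 2) R = 1)) (fun t => ?_) (by positivity)
  simp only [PPT.run_eq_out]
  cases hx₀ : F.input κ (A.out (Val.unary κ) ω (Val.list [.num 1, pk, t])).fst with
  | none =>
    simp only [priTailV, Val.fst_pair, F.mem_of_input_eq_none hx₀, zero_mul, zero_ne_one,
      decide_false]
    exact Sim.pure _ _
  | some x₀ =>
    cases hx₁ : F.input κ (A.out (Val.unary κ) ω (Val.list [.num 1, pk, t])).snd with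
    | none =>
      simp only [priTailV, Val.fst_pair, F.mem_of_input_eq_none hx₁, zero_mul, mul_zero,
        zero_ne_one, decide_false]
      exact Sim.pure _ _
    | some x₁ =>
      have h₀ := F.mem_of_input_eq_some hx₀
      have h₁ := F.mem_of_input_eq_some hx₁
      rw [← F.input_eq_some_iff.1 hx₀] at h₀
      rw [← F.input_eq_some_iff.1 hx₁] at h₁
      have h2 := (decodes_bool.impl two_pos).sim_bind (fun b =>
        ((decodes_zmodVec (𝒢.inst κ s) (F.n κ)).impl hK).sim_bind (fun r =>
        (impl_queryPhase (ask := fun t' => A.out (Val.unary κ) ω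
          (Val.list [.num 2, challengeView F s h pk t x₀ x₁ b r, t'])) hK (impl_pubEnc F s h)
          (A.queries₂.eval κ) (.num 0)).sim_bind
          (f₂ := fun t' _ => decide (A.out (Val.unary κ) ω
            (Val.list [.num 3, challengeView F s h pk t x₀ x₁ b r, t'])
              = .num (if b then 1 else 0)))
          (fun t' => Sim.pure 1 _) (by positivity)) (by positivity)) (by positivity)
      refine Eq.mp (congrArg _ (funext fun R => ?_)) h2
      rw [decide_eq_decide]
      have hb : ∀ m : ℕ, m % 2 = 0 ∨ m % 2 = 1 := Nat.mod_two_eq_zero_or_one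
      rcases hb R with hb | hb <;>
      simp [priTailV, ← F.input_eq_some_iff.1 hx₀, ← F.input_eq_some_iff.1 hx₁, h₀, h₁, hb,
        sigmaV_natVec, F.vecCard_code, challengeView, Val.cond_of_ne, queryIter]

theorem priTailV_congr (A : PPT) (κu c h pk : Val) (ω : ℕ) {q₁ q₁' : ℕ → Val}
    {q₂ q₂' : Val → ℕ → Val} {R L : ℕ} (h₁ : q₁ R = q₁' R) (hR : (q₁ R).snd.toNat < L)
    (h₂ : ∀ v, ∀ R < L, q₂ v R = q₂' v R) :
    priTailV F A κu c h pk ω q₁ q₂ R = priTailV F A κu c h pk ω q₁' q₂' R := by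
  have : (q₁' R).snd.toNat / 2 / F.vecCard κu c < L := by
    rw [← h₁]
    exact ((Nat.div_le_self _ _).trans (Nat.div_le_self _ _)).trans_lt hR
  simp only [priTailV, h₁, h₂ _ _ this]

/-- With the bounds of `queryPoly` no truncation occurs in the query phases. -/
theorem priTailV_eq (A : PPT) (Q₁ Q₂ C : Polynomial ℕ) (h : (𝒢.inst κ s).G 0) (pk : Val) (ω : ℕ)
    {R : ℕ} (hR : R < 2 ^ C.eval κ) :
    priTailV F A (Val.unary κ) (𝒢.inst κ s).code ((𝒢.inst κ s).enc 0 h) pk ω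
      (queryV F A (queryPoly F Q₁ C) Q₁ (Val.unary κ) (𝒢.inst κ s).code ((𝒢.inst κ s).enc 0 h) ω 0
        pk)
      (queryV F A (queryPoly F Q₂ C) Q₂ (Val.unary κ) (𝒢.inst κ s).code ((𝒢.inst κ s).enc 0 h) ω 2)
      R
    = priTailV F A (Val.unary κ) (𝒢.inst κ s).code ((𝒢.inst κ s).enc 0 h) pk ω
      (queryIter F s A (Q₁.eval κ) h ω 0 pk) (queryIter F s A (Q₂.eval κ) h ω 2) R := by
  refine priTailV_congr F A _ _ _ _ _ (queryV_eq F s A Q₁ C h ω 0 pk hR) ?_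
    fun v R' hR' => queryV_eq F s A Q₂ C h ω 2 v hR'
  rw [queryV_eq F s A Q₁ C h ω 0 pk hR]
  exact (queryStep_iterate_le _ _ _).trans_lt hR

/-- The privacy experiment with a given matrix of blinding factors. -/
def priMatrixExp (A : PriAdversary) (W : Fin (F.n κ) → Fin (F.n κ) → (𝒢.inst κ s).G 0) : PMF Bool :=
  (A.coinDist κ).bind fun ω =>
  (PMF.uniformOfFintype (ZMod (𝒢.inst κ s).N)).bind fun a =>
  (PMF.uniformOfFintype ((𝒢.inst κ s).G 0)).bind fun u =>
    priTail F s A ω (u ^ (𝒢.inst κ s).q)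
      (pkCode F s (u ^ (𝒢.inst κ s).q) (keyMatrix F s a.val W))

/-- The privacy experiment with element `h` and a uniform matrix `T` in the public key. -/
def priSubgroupExp (A : PriAdversary) (h : (𝒢.inst κ s).G 0) : PMF Bool :=
  (A.coinDist κ).bind fun ω =>
  (PMF.uniformOfFintype (Fin (F.n κ) → Fin (F.n κ) → (𝒢.inst κ s).G 0)).bind fun T =>
    priTail F s A ω h (pkCode F s h T)

/-- The privacy experiment for a given matrix of blinding factors can be run in polynomial time. -/
theorem exists_priMatrixDistinguisher (A : PriAdversary) : ∃ D : PPT, ∀ (κ : ℕ) (_ : 2 ≤ κ)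
    (s : 𝒢.Seed κ) (W : Fin (F.n κ) → Fin (F.n κ) → (𝒢.inst κ s).G 0),
    |prTrue (D.bit κ (matInput (𝒢.inst κ s) W)) - prTrue (priMatrixExp F s A W)|
      ≤ (1 / 2) ^ κ := by
  let X : Polynomial ℕ := Polynomial.X
  let S := F.sizePoly
  let C := A.coins + 4 * X + 2 * X * S * (A.queries₁ + A.queries₂ + 1) + 1 + X
  obtain ⟨D, hD⟩ := exists_ppt_of_sim (ptn_priMatrixV F A.toPPT (queryPoly F A.queries₁ C) A.queries₁
    (queryPoly F A.queries₂ C) A.queries₂) C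
  refine ⟨D, fun κ hκ s W => ?_⟩
  have hN := (𝒢.inst κ s).N_pos
  have hv : 0 < (𝒢.inst κ s).N ^ F.n κ := pow_pos hN _
  have hsim := (impl_coinDist A.toPPT κ).sim_bind (fun ω =>
    ((decodes_zmod (𝒢.inst κ s).N).impl hN).sim_bind (fun a =>
    (((𝒢.inst κ s).decodes_G 0).impl hN).sim_bind (fun u => sim_priTail F s A ω
      (u ^ (𝒢.inst κ s).q) (pkCode F s (u ^ (𝒢.inst κ s).q) (keyMatrix F s a.val W)))
      (by positivity)) (by positivity)) (by positivity)
  refine hD κ _ _ _ _ (by positivity) ?_ hsim fun R hR => ?_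
  · have h2 := (𝒢.N_lt s hκ).le
    have h3 := F.N_pow_le s hκ
    calc _ ≤ 2 ^ A.coins.eval κ * (2 ^ (2 * κ) * (2 ^ (2 * κ) *
          ((2 ^ (2 * κ * S.eval κ)) ^ A.queries₁.eval κ * (2 ^ 1 * (2 ^ (2 * κ * S.eval κ) *
            ((2 ^ (2 * κ * S.eval κ)) ^ A.queries₂.eval κ * 1)))))) * 2 ^ κ := by
          gcongr
          norm_num
      _ = _ := by
        simp only [mul_one, ← pow_add, ← pow_mul, Polynomial.eval_add, Polynomial.eval_mul, X, C,
          Polynomial.eval_X, Polynomial.eval_ofNat, Polynomial.eval_one]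
        congr 1; ring
  · have hR' : R / 2 ^ A.coins.eval κ / (𝒢.inst κ s).N / (𝒢.inst κ s).N < 2 ^ C.eval κ :=
      (((Nat.div_le_self _ _).trans (Nat.div_le_self _ _)).trans (Nat.div_le_self _ _)).trans_lt hR
    have hX : ∀ a b c : Val, (Val.list [a, b, c]).nth 0 = a ∧ (Val.list [a, b, c]).nth 1 = b ∧
      (Val.list [a, b, c]).nth 2 = c := fun _ _ _ => ⟨rfl, rfl, rfl⟩
    have hI : ∀ a b c d : Val, (Val.list [a, b, c, d]).nth 0 = a ∧
      (Val.list [a, b, c, d]).nth 1 = b ∧ (Val.list [a, b, c, d]).nth 2 = c ∧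
      (Val.list [a, b, c, d]).nth 3 = d := fun _ _ _ _ => ⟨rfl, rfl, rfl, rfl⟩
    simp only [priMatrixV, matInput, hX, hI, Val.toNat_num, coinCard_unary,
      TrilinearInstance.code_nth_one, TrilinearInstance.code_nth_two, TrilinearGenerator.gpow_enc,
      keyMatrixV_eq, pkV_eq, priTailV_eq F s A.toPPT A.queries₁ A.queries₂ C _ _ _ hR',
      decide_eq_true_eq, ZMod.val_natCast, Nat.mod_mod, Fin.val_ofNat]

/-- The privacy experiment with a uniform matrix `T` and a given element `h` can be run in polynomial
time without knowing `p` and `q`. -/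
theorem exists_subgroupReduction (A : PriAdversary) : ∃ B : PPT, ∀ (κ : ℕ) (_ : 2 ≤ κ)
    (s : 𝒢.Seed κ) (h : (𝒢.inst κ s).G 0),
    |prTrue (B.bit κ (Val.list [(𝒢.inst κ s).code, (𝒢.inst κ s).enc 0 h]))
      - prTrue (priSubgroupExp F s A h)| ≤ (1 / 2) ^ κ := by
  let X : Polynomial ℕ := Polynomial.X
  let S := F.sizePoly
  let C := A.coins + 2 * X * S * S + 2 * X * S * (A.queries₁ + A.queries₂ + 1) + 1 + X
  obtain ⟨D, hD⟩ := exists_ppt_of_sim (ptn_priSubgroupV F A.toPPT (queryPoly F A.queries₁ C)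
    A.queries₁ (queryPoly F A.queries₂ C) A.queries₂) C
  refine ⟨D, fun κ hκ s h => ?_⟩
  have hN := (𝒢.inst κ s).N_pos
  have hv : 0 < (𝒢.inst κ s).N ^ F.n κ := pow_pos hN _
  have hsim := (impl_coinDist A.toPPT κ).sim_bind (fun ω =>
    ((decodes_mat (𝒢.inst κ s) (F.n κ)).impl (pow_pos hv _)).sim_bind (fun T =>
      sim_priTail F s A ω h (pkCode F s h T)) (by positivity)) (by positivity)
  refine hD κ _ _ _ _ (by positivity) ?_ hsim fun R hR => ?_
  · have h1 := F.n_le κ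
    have h3 := F.N_pow_le s hκ
    have h4 : ((𝒢.inst κ s).N ^ F.n κ) ^ F.n κ ≤ 2 ^ (2 * κ * S.eval κ * S.eval κ) := by
      rw [pow_mul]
      exact (Nat.pow_le_pow_left h3 _).trans (Nat.pow_le_pow_right (by positivity) h1)
    calc _ ≤ 2 ^ A.coins.eval κ * (2 ^ (2 * κ * S.eval κ * S.eval κ) *
          ((2 ^ (2 * κ * S.eval κ)) ^ A.queries₁.eval κ * (2 ^ 1 * (2 ^ (2 * κ * S.eval κ) *
            ((2 ^ (2 * κ * S.eval κ)) ^ A.queries₂.eval κ * 1))))) * 2 ^ κ := by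
          gcongr
          norm_num
      _ = _ := by
        simp only [mul_one, ← pow_add, ← pow_mul, Polynomial.eval_add, Polynomial.eval_mul, X, C,
          Polynomial.eval_X, Polynomial.eval_ofNat, Polynomial.eval_one]
        congr 1; ring
  · have hR' : R / 2 ^ A.coins.eval κ / ((𝒢.inst κ s).N ^ F.n κ) ^ F.n κ < 2 ^ C.eval κ :=
      ((Nat.div_le_self _ _).trans (Nat.div_le_self _ _)).trans_lt hR
    have hX : ∀ a b c : Val, (Val.list [a, b, c]).nth 0 = a ∧ (Val.list [a, b, c]).nth 1 = b ∧
      (Val.list [a, b, c]).nth 2 = c := fun _ _ _ => ⟨rfl, rfl, rfl⟩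
    have hI : ∀ a b : Val, (Val.list [a, b]).nth 0 = a ∧ (Val.list [a, b]).nth 1 = b :=
      fun _ _ => ⟨rfl, rfl⟩
    simp only [priSubgroupV, hX, hI, Val.toNat_num, coinCard_unary, F.matCard_code, randMatrixV_eq,
      pkV_eq, priTailV_eq F s A.toPPT A.queries₁ A.queries₂ C _ _ _ hR',
      decide_eq_true_eq, Fin.val_ofNat, Nat.mod_mod]

end

/-! ### Input privacy -/

section

variable {𝒢 : TrilinearGenerator} (F : MatrixFamily 𝒢) {κ : ℕ} (s : 𝒢.Seed κ)

/-- The privacy experiment is the one of `priMatrixExp` for the pseudorandom matrix. -/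
theorem priExp_eq (A : PriAdversary) (κ : ℕ) : priExp 𝒢 F A κ =
    (𝒢.sample κ).bind fun s => hybridExp (n := F.n κ) (fun W => priMatrixExp F s A W) 0 := by
  unfold priExp
  simp only [bind, pure, keyGen, PMF.bind_bind, PMF.pure_bind]
  refine congrArg _ (funext fun s => ?_)
  rw [hybridExp_zero]
  rw [PMF.bind_comm (A.coinDist κ)]
  refine congrArg _ (funext fun α => ?_)
  rw [PMF.bind_comm (A.coinDist κ)]
  refine congrArg _ (funext fun β => ?_)
  rw [PMF.bind_comm (A.coinDist κ)]
  refine congrArg _ (funext fun A' => ?_)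
  rw [PMF.bind_comm (A.coinDist κ)]
  refine congrArg _ (funext fun B' => congrArg _ (funext fun ω => congrArg _ (funext fun a =>
    congrArg _ (funext fun u => ?_))))
  rw [pubProbGen_eq]
  refine congrArg _ (funext fun t => ?_)
  change (match F.input κ (A.run κ ω (Val.list [.num 1, pkCode F s
      (u ^ (𝒢.inst κ s).q) (keyMatrix F s a.val (PRFKey.F ⟨α, β, A', B'⟩)), t])).fst,
    F.input κ (A.run κ ω (Val.list [.num 1, pkCode F s
      (u ^ (𝒢.inst κ s).q) (keyMatrix F s a.val (PRFKey.F ⟨α, β, A', B'⟩)), t])).snd with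
    | some x₀, some x₁ => _
    | _, _ => _) = _
  cases F.input κ (A.run κ ω (Val.list [.num 1, pkCode F s
      (u ^ (𝒢.inst κ s).q) (keyMatrix F s a.val (PRFKey.F ⟨α, β, A', B'⟩)), t])).fst with
  | none => rfl
  | some x₀ =>
    cases F.input κ (A.run κ ω (Val.list [.num 1, pkCode F s
      (u ^ (𝒢.inst κ s).q) (keyMatrix F s a.val (PRFKey.F ⟨α, β, A', B'⟩)), t])).snd with
    | none => rfl
    | some x₁ =>
      simp only [probGen, bind, pure, PMF.bind_bind, PMF.pure_bind, probGenWith_val]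
      rfl

/-- If the matrix of blinding factors is uniform, then so is the matrix `T`. -/
theorem priMatrixExp_random (A : PriAdversary) :
    hybridExp (n := F.n κ) (fun W => priMatrixExp F s A W) (F.n κ)
      = (PMF.uniformOfFintype ((𝒢.inst κ s).G 0)).bind fun u =>
        priSubgroupExp F s A (u ^ (𝒢.inst κ s).q) := by
  rw [hybridExp_self]
  unfold priMatrixExp priSubgroupExp
  rw [PMF.bind_comm, PMF.bind_comm (PMF.uniformOfFintype ((𝒢.inst κ s).G 0))]
  refine congrArg _ (funext fun ω => ?_)
  rw [PMF.bind_comm, PMF.bind_comm (PMF.uniformOfFintype ((𝒢.inst κ s).G 0))]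
  refine Eq.trans (congrArg _ (funext fun a => ?_)) (PMF.bind_const _ _)
  exact uniform_bind_bijective (bijective_keyMatrix F s a.val) fun T =>
    (PMF.uniformOfFintype ((𝒢.inst κ s).G 0)).bind fun u =>
      priTail F s A ω (u ^ (𝒢.inst κ s).q) (pkCode F s (u ^ (𝒢.inst κ s).q) T)

/-- If `h` generates `G₁`, then the encoding of an input is uniform. -/
theorem bijective_encoding {h : (𝒢.inst κ s).G 0} (hh : h ∈ (𝒢.inst κ s).gens 0)
    (x : Fin (F.n κ) → ℕ) : Function.Bijective
      fun (r : Fin (F.n κ) → ZMod (𝒢.inst κ s).N) j => (𝒢.inst κ s).g 0 ^ x j * h ^ (r j).val :=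
  ((Equiv.arrowCongr (Equiv.refl (Fin (F.n κ)))
    (Equiv.ofBijective _ ((𝒢.inst κ s).bijective_pow_val hh))).trans
    (Equiv.mulLeft fun j => (𝒢.inst κ s).g 0 ^ x j)).bijective

/-- A datum that is independent of a uniform bit agrees with it with probability at most `1 / 2`. -/
theorem prTrue_guess_le (v : Val) : prTrue ((PMF.uniformOfFintype Bool).bind fun b =>
    PMF.pure (decide (v = .num (if b then 1 else 0)))) ≤ 1 / 2 := by
  rw [prTrue_uniform_bind, Fintype.card_bool, Fintype.sum_bool, prTrue_pure, prTrue_pure]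
  have h : ¬ (v = .num 1 ∧ v = .num 0) := by
    rintro ⟨rfl, h⟩
    simp at h
  by_cases h1 : v = .num 1 <;> by_cases h0 : v = .num 0
  · exact absurd ⟨h1, h0⟩ h
  all_goals simp [h1, h0]

/-- If `h` generates `G₁`, then the encodings carry no information on the inputs. -/
theorem prTrue_priTail_le (A : PriAdversary) (ω : Fin (2 ^ A.coins.eval κ))
    {h : (𝒢.inst κ s).G 0} (hh : h ∈ (𝒢.inst κ s).gens 0) (pk : Val) :
    prTrue (priTail F s A ω h pk) ≤ 1 / 2 := by
  unfold priTail
  refine prTrue_bind_le _ fun t => ?_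
  cases F.input κ (A.run κ ω (Val.list [.num 1, pk, t])).fst with
  | none => simp [prTrue_pure]
  | some x₀ =>
    cases F.input κ (A.run κ ω (Val.list [.num 1, pk, t])).snd with
    | none => simp [prTrue_pure]
    | some x₁ =>
      let view : (Fin (F.n κ) → (𝒢.inst κ s).G 0) → Val := fun y =>
        Val.list [pk, t, Val.natVec x₀.1, Val.natVec x₁.1, Val.vec fun j => (𝒢.inst κ s).enc 0 (y j)]
      have key := fun b : Bool => uniform_bind_bijective
        (bijective_encoding F s hh (if b then x₁.1 else x₀.1)) fun y =>
        (queryPhase (fun t' => A.run κ ω (Val.list [.num 2, view y, t'])) (pubEnc F s h)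
          (A.queries₂.eval κ) (.num 0)).bind fun t' =>
        PMF.pure (decide (A.run κ ω (Val.list [.num 3, view y, t']) = .num (if b then 1 else 0)))
      refine le_of_eq_of_le (congrArg (fun f => prTrue (PMF.bind _ f)) (funext key)) ?_
      rw [PMF.bind_comm]
      refine prTrue_bind_le _ fun y => ?_
      rw [PMF.bind_comm]
      exact prTrue_bind_le _ fun t' => prTrue_guess_le _

/-- If `h` is uniform in `G₁`, then the adversary has hardly any advantage, unconditionally. -/
theorem prTrue_priSubgroupExp_le (A : PriAdversary) (hκ : 2 ≤ κ) :
    prTrue ((PMF.uniformOfFintype ((𝒢.inst κ s).G 0)).bind fun u => priSubgroupExp F s A u)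
      ≤ 1 / 2 + 4 * (1 / 2) ^ κ := by
  classical
  have h1 := abs_prTrue_uniform_bind_sub_le (f := fun u => priSubgroupExp F s A u)
    (g := fun u => if u ∈ (𝒢.inst κ s).gens 0 then priSubgroupExp F s A u else PMF.pure false)
    le_rfl _ (((𝒢.inst κ s).card_compl_gens_div_le 0).trans (𝒢.inv_p_add_inv_q_le s hκ))
    fun u hu => by
      rw [Finset.mem_compl, not_not] at hu
      simp [hu]
  have h2 : prTrue ((PMF.uniformOfFintype ((𝒢.inst κ s).G 0)).bind fun u =>
      if u ∈ (𝒢.inst κ s).gens 0 then priSubgroupExp F s A u else PMF.pure false) ≤ 1 / 2 := by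
    refine prTrue_bind_le _ fun u => ?_
    split_ifs with hu
    · exact prTrue_bind_le _ fun ω => prTrue_bind_le _ fun T => prTrue_priTail_le F s A ω hu _
    · simp [prTrue_pure]
  have := (abs_le.1 h1).2
  linarith

theorem sdaExp_eq (B : PPT) (real : Bool) (κ : ℕ) : sdaExp 𝒢 0 B real κ =
    (𝒢.sample κ).bind fun s => (PMF.uniformOfFintype ((𝒢.inst κ s).G 0)).bind fun u =>
      B.bit κ (Val.list [(𝒢.inst κ s).code,
        (𝒢.inst κ s).enc 0 (if real then u else u ^ (𝒢.inst κ s).q)]) := by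
  refine congrArg _ (funext fun s => ?_)
  simp only [bind, pure]
  rw [PMF.bind_comm (B.coinDist κ)]
  rfl

end

theorem isPrivate (𝒢 : TrilinearGenerator) (F : MatrixFamily 𝒢) (hD : DLIN 𝒢) (hS : SDA 𝒢) :
    IsPrivate 𝒢 F := by
  intro A
  obtain ⟨D, h_dist⟩ := exists_priMatrixDistinguisher F A
  obtain ⟨B, hB⟩ := exists_subgroupReduction F A
  refine ⟨fun κ => max 0 (prTrue (priExp 𝒢 F A κ) - 1 / 2), ?_, fun κ => by
    have := le_max_right 0 (prTrue (priExp 𝒢 F A κ) - 1 / 2)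
    linarith⟩
  refine (((matrix_pseudorandom F hD D).add (hS 0 B)).add
    (Negligible.half_pow.const_mul 8)).of_abs_le fun κ hκ => ?_
  have h2 : ∀ k, |prTrue ((𝒢.sample κ).bind fun s => hybridExp (n := F.n κ)
      (fun W => D.bit κ (matInput (𝒢.inst κ s) W)) k)
      - prTrue ((𝒢.sample κ).bind fun s =>
        hybridExp (n := F.n κ) (fun W => priMatrixExp F s A W) k)| ≤ (1 / 2) ^ κ := by
    intro k
    refine abs_prTrue_bind_sub_le _ fun s => ?_
    unfold hybridExp
    exact abs_prTrue_bind_sub_le _ fun W => abs_prTrue_bind_sub_le _ fun α =>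
      abs_prTrue_bind_sub_le _ fun β => abs_prTrue_bind_sub_le _ fun A' =>
      abs_prTrue_bind_sub_le _ fun B' => h_dist κ hκ s _
  have h3 : ∀ real : Bool, |prTrue (sdaExp 𝒢 0 B real κ) - prTrue ((𝒢.sample κ).bind fun s =>
      (PMF.uniformOfFintype ((𝒢.inst κ s).G 0)).bind fun u =>
        priSubgroupExp F s A (if real then u else u ^ (𝒢.inst κ s).q))| ≤ (1 / 2) ^ κ := by
    intro real
    rw [sdaExp_eq]
    exact abs_prTrue_bind_sub_le _ fun s => abs_prTrue_bind_sub_le _ fun u => hB κ hκ s _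
  have h4 : prTrue ((𝒢.sample κ).bind fun s =>
      (PMF.uniformOfFintype ((𝒢.inst κ s).G 0)).bind fun u => priSubgroupExp F s A u)
      ≤ 1 / 2 + 4 * (1 / 2) ^ κ := prTrue_bind_le _ fun s => prTrue_priSubgroupExp_le F s A hκ
  have a0 := abs_le.1 (h2 0)
  have a1 := abs_le.1 (h2 (F.n κ))
  have a2 := le_abs_self (prTrue (matrixExp F D true κ) - prTrue (matrixExp F D false κ))
  change prTrue ((𝒢.sample κ).bind fun s => hybridExp (n := F.n κ)
      (fun W => D.bit κ (matInput (𝒢.inst κ s) W)) 0) - prTrue ((𝒢.sample κ).bind fun s =>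
      hybridExp (n := F.n κ) (fun W => D.bit κ (matInput (𝒢.inst κ s) W)) (F.n κ)) ≤ _ at a2
  have b0 := abs_le.1 (h3 false)
  have b1 := abs_le.1 (h3 true)
  have b2 := neg_abs_le (prTrue (sdaExp 𝒢 0 B true κ) - prTrue (sdaExp 𝒢 0 B false κ))
  simp only [priMatrixExp_random] at a1
  simp only [Bool.false_eq_true, if_false] at b0
  simp only [if_true] at b1
  rw [← priExp_eq] at a0
  have hnn : (0 : ℝ) ≤ (1 / 2) ^ κ := by positivity
  have e1 := abs_nonneg (prTrue (matrixExp F D true κ) - prTrue (matrixExp F D false κ))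
  have e2 := abs_nonneg (prTrue (sdaExp 𝒢 0 B true κ) - prTrue (sdaExp 𝒢 0 B false κ))
  rw [abs_of_nonneg (le_max_left _ _)]
  exact max_le (by linarith) (by linarith)

end

end MatVC

theorem mainTheorem2 :
    ∃ C : ℕ, ∀ (𝒢 : MatVC.TrilinearGenerator) (F : MatVC.MatrixFamily 𝒢),
      MatVC.IsCorrect 𝒢 F ∧ MatVC.ClientCostLE 𝒢 F C ∧
      (MatVC.CoCDHS 𝒢 → MatVC.DLIN 𝒢 → MatVC.SDA 𝒢 →
        MatVC.IsSecure 𝒢 F ∧ MatVC.IsPrivate 𝒢 F) :=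
  ⟨13, fun 𝒢 F => ⟨MatVC.isCorrect 𝒢 F, MatVC.clientCostLE 𝒢 F, fun _ hD hS =>
    ⟨MatVC.isSecure 𝒢 F hD, MatVC.isPrivate 𝒢 F hD hS⟩⟩⟩
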